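/- **Conventions.** Let $\mathbb{F}$ be a field with a bit length $|a|\in\mathbb{N}$ for each element $a$, such that $1$ is a shortest non-zero element and, for some constant $c$, $|\det N|\le (n+b+2)^c$ for every $n\times n$ matrix $N$ whose entries have length at most $b$, where $b\ge|1|$, and $|a^{-1}|\le(|a|+2)^c$ for $a\neq 0$. (Examples: $\mathbb{Q}$ with the binary length of reduced fractions; finite fields with $|a|=\lfloor\log_2|\mathbb{F}|\rfloor+1$; any field, such as $\mathbb{C}$, with unit length.) Algorithms are randomized random access programs over natural numbers and elements of $\mathbb{F}$, with fair coin tosses, field operations and zero tests; every operation is charged the bit lengths of its operands and results. The polynomial $\text{Tr-IMM}_{w,3}=\mathrm{tr}(Q_0Q_1Q_2)$ is the trace of the product of three $w\times w$ matrices of distinct variables; $\mathbf{x}_k$ denotes the $w^2$ variables of $Q_k$. An $\mathsf{MMTI}$ oracle receives the coefficients of a $3$-tensor $f(\mathbf{x}_0,\mathbf{x}_1,\mathbf{x}_2)$ (a cubic form each of whose monomials contains exactly one variable from each $\mathbf{x}_k$), where $|\mathbf{x}_k|=w^2$. It returns $B_0,B_1,B_2\in\mathrm{GL}(w^2,\mathbb{F})$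 with $f=\text{Tr-IMM}_{w,3}(B_0\mathbf{x}_0,B_1\mathbf{x}_1,B_2\mathbf{x}_2)$ if such matrices exist, and "No" otherwise; the bit lengths of its answers are bounded by a polynomial in $w$ and the bit lengths of the coefficients. Throughout, only $w\ge 2$ with $\mathrm{char}(\mathbb{F})=0$ or $\mathrm{char}(\mathbb{F})>(3w^2)^5$ are considered, for the oracle and for the input below when $\dim_{\mathbb{F}}\mathcal{A}=w^2$. **Theorem.** There is a randomized algorithm that takes as input a basis of an algebra $\mathcal{A}\subseteq\mathcal{M}_m(\mathbb{F})$ (a linear subspace closed under multiplication) and has oracle access to $\mathsf{MMTI}$, and that does the following with probability at least $1-2^{-(m+1)}$: if $\mathcal{A}\cong\mathcal{M}_w(\mathbb{F})$, where $w^2=\dim_{\mathbb{F}}\mathcal{A}$, then it outputs "Yes"; otherwise it outputs "No". Whenever the algorithm outputs "Yes", it also outputs $w$ and an algebra isomorphism $\mathcal{A}\to\mathcal{M}_w(\mathbb{F})$, given by the images of the input basis. For all outcomes of the coin tosses the algorithm runs in time $\mathrm{poly}(m,\beta)$, where $\beta$ is the maximal bit length of the entries of the input basis matrices. The algorithm depends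 neither on the field nor on the oracle, and the polynomial depends only on $c$ and on the bound for the oracle's answers. -/

import Mathlib

/-! ### Iterated matrix multiplication polynomials and tensor isomorphism -/

section Tensors

/-- `Tr-IMM_{w,d}`: the trace of the product `Q_0 ⋯ Q_{d-1}` of `d` generic `w × w` matrices, where
the `(i, j)` entry of `Q_k` is the variable `(k, i, j)`. -/
noncomputable def TrIMM (F : Type*) [Field F] (w d : ℕ) :
    MvPolynomial (Fin d × Fin w × Fin w) F :=
  Matrix.trace (List.ofFn fun k : Fin d =>
    (Matrix.of fun i j => MvPolynomial.X (k, i, j) :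
      Matrix (Fin w) (Fin w) (MvPolynomial (Fin d × Fin w × Fin w) F))).prod

/-- The coefficients of a `3`-tensor in three sets of `n` variables. -/
abbrev Coeffs (F : Type*) (n : ℕ) : Type _ := Fin n → Fin n → Fin n → F

/-- The `3`-tensor (set-multilinear cubic form) with the given coefficients; variable `(k, i)` is
the `i`-th variable of the `k`-th variable set. -/
noncomputable def tensorPoly {F : Type*} [Field F] {n : ℕ} (t : Coeffs F n) :
    MvPolynomial (Fin 3 × Fin n) F :=
  ∑ i, ∑ j, ∑ k, MvPolynomial.C (t i j k) *
    (MvPolynomial.X (0, i) * MvPolynomial.X (1, j) * MvPolynomial.X (2, k))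

/-- `Tr-IMM_{w,3}(B_0 x_0, B_1 x_1, B_2 x_2)`, where the `w²` variables of each set are numbered in
row-major order. -/
noncomputable def substTrIMM {F : Type*} [Field F] (w : ℕ)
    (B : Fin 3 → Matrix (Fin (w * w)) (Fin (w * w)) F) :
    MvPolynomial (Fin 3 × Fin (w * w)) F :=
  MvPolynomial.bind₁ (fun v : Fin 3 × Fin w × Fin w =>
    ∑ l, MvPolynomial.C (B v.1 (finProdFinEquiv v.2) l) * MvPolynomial.X (v.1, l)) (TrIMM F w 3)

/-- `B = (B_0, B_1, B_2)` is an isomorphism from the tensor with coefficients `t` to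
`Tr-IMM_{w,3}`. -/
def IsTensorIso {F : Type*} [Field F] (w : ℕ) (t : Coeffs F (w * w))
    (B : Fin 3 → Matrix (Fin (w * w)) (Fin (w * w)) F) : Prop :=
  (∀ k, IsUnit (B k)) ∧ tensorPoly t = substTrIMM w B

/-- The standing assumption on the field and on the width `w` and degree `d`. -/
def Standing (F : Type*) [Field F] (w d : ℕ) : Prop :=
  2 ≤ w ∧ 3 ≤ d ∧ (ringChar F = 0 ∨ (w ^ 2 * d) ^ 5 < ringChar F)

/-- An oracle takes a width `w` and the coefficients of a `3`-tensor in three sets of `w²`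
variables, and answers either `none` ("No") or three matrices. -/
abbrev Oracle (F : Type*) : Type _ :=
  ∀ w : ℕ, Coeffs F (w * w) → Option (Fin 3 → Matrix (Fin (w * w)) (Fin (w * w)) F)

/-- The oracle solves the search problem `MMTI`: it answers with an isomorphism to the matrix
multiplication tensor `Tr-IMM_{w,3}` if there is one, and with "No" otherwise. -/
def SolvesMMTI {F : Type*} [Field F] (O : Oracle F) : Prop :=
  ∀ w, Standing F w 3 → ∀ t : Coeffs F (w * w),
    (∀ B, O w t = some B → IsTensorIso w t B) ∧ (O w t = none → ¬ ∃ B, IsTensorIso w t B)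

/-- The oracle's answers are polynomially long: their entries have length at most
`(w + b + 2) ^ q` when the coefficients in the query have length at most `b`. -/
def PolyLength {F : Type*} [Field F] (len : F → ℕ) (q : ℕ) (O : Oracle F) : Prop :=
  ∀ w, Standing F w 3 → ∀ (t : Coeffs F (w * w)) (b : ℕ), (∀ i j k, len (t i j k) ≤ b) →
    ∀ B, O w t = some B → ∀ k i j, len (B k i j) ≤ (w + b + 2) ^ q

end Tensors

/-! ### Bit lengths of field elements -/

section BitLength

/-- `len a` is an admissible bit length for the elements of the field `F`: `1` is a shortest
non-zero element, determinants of matrices are polynomially long in the size of the matrix and the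
length of its entries, and so are inverses. (Sums and products of many elements are determinants.)
The exponent `c` bounds the growth. -/
structure IsBitLength {F : Type*} [Field F] (len : F → ℕ) (c : ℕ) : Prop where
  one_le : ∀ a : F, a ≠ 0 → len 1 ≤ len a
  det_le : ∀ (n : ℕ) (A : Matrix (Fin n) (Fin n) F) (b : ℕ), len 1 ≤ b →
    (∀ i j, len (A i j) ≤ b) → len A.det ≤ (n + b + 2) ^ c
  inv_le : ∀ a : F, a ≠ 0 → len a⁻¹ ≤ (len a + 2) ^ c

/-- The algebraic model, in which every element of `F` has length one, is admissible for every
field, with the same `c`. -/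
theorem isBitLength_unit (F : Type*) [Field F] : IsBitLength (fun _ : F => 1) 1 :=
  ⟨fun _ _ => le_rfl, fun n _ b _ _ => by simp only [pow_one]; omega, fun _ _ => by norm_num⟩

/-- Over a finite field the elements have length `⌊log₂ |F|⌋ + 1`, and this is admissible, with the
same `c` for all finite fields. -/
theorem isBitLength_finite (F : Type*) [Field F] [Finite F] :
    IsBitLength (fun _ : F => Nat.size (Nat.card F)) 1 :=
  ⟨fun _ _ => le_rfl, fun n _ b hb _ => by simp only [pow_one] at *; omega,
    fun _ _ => by simp only [pow_one]; omega⟩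

/-- The bit length of a rational number, written as a reduced fraction in binary. -/
def ratLen (x : ℚ) : ℕ := Nat.size x.num.natAbs + Nat.size x.den

theorem ratLen_bounds {x : ℚ} {N M : ℕ} {z : ℤ} {r s : ℕ} (hN : 0 < N) (hz : (N : ℚ) * x = z)
    (hx : |x| ≤ M) (hr : N ≤ 2 ^ r) (hs : M ≤ 2 ^ s) : ratLen x ≤ (s + r + 1) + (r + 1) := by
  have hNq : (N : ℚ) ≠ 0 := by exact_mod_cast hN.ne'
  have hx' : x = (z : ℚ) / ((N : ℤ) : ℚ) := by
    rw [eq_div_iff (by exact_mod_cast hN.ne')]; rw [← hz]; push_cast; ring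
  have hdvd : (x.den : ℤ) ∣ (N : ℤ) := by
    rw [hx', ← Rat.divInt_eq_div]; exact Rat.den_dvd z N
  have hden : x.den ≤ N := Nat.le_of_dvd hN (by exact_mod_cast hdvd)
  have hnum : x.num.natAbs ≤ M * N := by
    have h1 : (x.num.natAbs : ℚ) = |x| * x.den := by
      have := Rat.mul_den_eq_num x
      rw [Nat.cast_natAbs, Int.cast_abs, ← this, abs_mul, Nat.abs_cast]
    have h2 : (x.num.natAbs : ℚ) ≤ (M : ℚ) * N := by
      rw [h1]
      exact mul_le_mul hx (by exact_mod_cast hden) (by positivity) (by positivity)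
    exact_mod_cast h2
  have hp : ∀ k, (2 : ℕ) ^ k < 2 ^ (k + 1) := fun k => Nat.pow_lt_pow_right (by norm_num) (by omega)
  refine add_le_add (Nat.size_le.2 ?_) (Nat.size_le.2 ?_)
  · calc x.num.natAbs ≤ M * N := hnum
      _ ≤ 2 ^ s * 2 ^ r := Nat.mul_le_mul hs hr
      _ = 2 ^ (s + r) := (pow_add _ _ _).symm
      _ < _ := hp _
  · exact lt_of_le_of_lt (hden.trans hr) (hp r)

/-- The binary length of rational numbers is admissible. -/
theorem isBitLength_rat : IsBitLength ratLen 7 := by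
  have h1 : ratLen 1 = 2 := by
    have : Nat.size 1 = 1 := by simp
    simp [ratLen, this]
  refine ⟨fun a ha => ?_, fun n A b hb hA => ?_, fun a ha => ?_⟩
  · rw [h1]
    have h2 : 0 < Nat.size a.num.natAbs := Nat.size_pos.2 (by simpa [Int.natAbs_pos] using ha)
    have h3 : 0 < Nat.size a.den := Nat.size_pos.2 a.den_pos
    unfold ratLen; omega
  · have hden : ∀ i j, (A i j).den ≤ 2 ^ b := fun i j =>
      (Nat.size_le.1 (le_trans (Nat.le_add_left _ _) (hA i j))).le
    have hnum : ∀ i j, |A i j| ≤ ((2 ^ b : ℕ) : ℚ) := fun i j => by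
      have h2 : (A i j).num.natAbs ≤ 2 ^ b :=
        (Nat.size_le.1 (le_trans (Nat.le_add_right _ _) (hA i j))).le
      have h3 : |A i j| = ((A i j).num.natAbs : ℚ) / (A i j).den := by
        conv_lhs => rw [← Rat.num_div_den (A i j)]
        rw [abs_div, Nat.abs_cast, Nat.cast_natAbs, Int.cast_abs]
      rw [h3]
      have h4 : (1 : ℚ) ≤ (A i j).den := by exact_mod_cast (A i j).den_pos
      exact (div_le_self (by positivity) h4).trans (by exact_mod_cast h2)
    set D : ℕ := ∏ i, ∏ j, (A i j).den with hD
    have hDpos : 0 < D := Finset.prod_pos fun i _ => Finset.prod_pos fun j _ => (A i j).den_pos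
    have hDle : D ≤ 2 ^ (b * n * n) := by
      calc D ≤ ∏ _i : Fin n, ∏ _j : Fin n, 2 ^ b :=
            Finset.prod_le_prod' fun i _ => Finset.prod_le_prod' fun j _ => hden i j
        _ = _ := by simp [← pow_mul]
    have hex : ∀ i j, ∃ z : ℤ, (D : ℚ) * A i j = z := fun i j => by
      have hd : (A i j).den ∣ D :=
        (Finset.dvd_prod_of_mem (fun j => (A i j).den) (Finset.mem_univ j)).trans
          (Finset.dvd_prod_of_mem (fun i => ∏ j, (A i j).den) (Finset.mem_univ i))
      obtain ⟨e, he⟩ := hd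
      refine ⟨e * (A i j).num, ?_⟩
      rw [he]; push_cast; rw [← Rat.mul_den_eq_num (A i j)]; ring
    choose Z hZ using hex
    have hdet : ((D ^ n : ℕ) : ℚ) * A.det = (((Matrix.of Z).det : ℤ) : ℚ) := by
      have h2 : ((D : ℚ) • A) = (Matrix.of Z).map (Int.castRingHom ℚ) := by
        ext i j; simpa using hZ i j
      have h3 := Matrix.det_smul A (D : ℚ)
      rw [h2, ← RingHom.mapMatrix_apply, ← RingHom.map_det, Fintype.card_fin] at h3
      rw [Nat.cast_pow, ← h3]; rfl
    have habs : |A.det| ≤ ((n.factorial * (2 ^ b) ^ n : ℕ) : ℚ) := by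
      have := Matrix.det_le (abv := AbsoluteValue.abs) (A := A) (x := ((2 ^ b : ℕ) : ℚ)) hnum
      simpa [nsmul_eq_mul] using this
    have hfac : n.factorial * (2 ^ b) ^ n ≤ 2 ^ (n * n + b * n) := by
      rw [pow_add, ← pow_mul]
      refine Nat.mul_le_mul_right _ ((Nat.factorial_le_pow n).trans ?_)
      rw [pow_mul]
      exact Nat.pow_le_pow_left Nat.lt_two_pow_self.le n
    have hDn : D ^ n ≤ 2 ^ (b * n * n * n) := by
      rw [pow_mul 2 (b * n * n) n]; exact Nat.pow_le_pow_left hDle n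
    refine (ratLen_bounds (pow_pos hDpos n) hdet habs hDn hfac).trans ?_
    set S := n + b + 2 with hS
    have hSn : n ≤ S := by omega
    have hSb : b ≤ S := by omega
    have hS2 : 2 ≤ S := by omega
    have e1 : b * n * n * n ≤ S ^ 4 := by
      calc b * n * n * n ≤ S * S * S * S := by gcongr
        _ = _ := by ring
    have hpos : 0 < S := by omega
    have e2 : n * n ≤ S ^ 4 := by
      calc n * n ≤ S * S := by gcongr
        _ = S ^ 2 := by ring
        _ ≤ S ^ 4 := Nat.pow_le_pow_right hpos (by norm_num)
    have e3 : b * n ≤ S ^ 4 := by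
      calc b * n ≤ S * S := by gcongr
        _ = S ^ 2 := by ring
        _ ≤ S ^ 4 := Nat.pow_le_pow_right hpos (by norm_num)
    have e4 : 1 ≤ S ^ 4 := Nat.one_le_pow _ _ hpos
    have e5 : 8 ≤ S ^ 3 := by
      calc 8 = 2 ^ 3 := by norm_num
        _ ≤ _ := Nat.pow_le_pow_left hS2 3
    have e6 : S ^ 7 = S ^ 4 * S ^ 3 := by ring
    rw [e6]; nlinarith
  · have h2 : ratLen a⁻¹ = ratLen a := by
      unfold ratLen
      rw [Rat.num_inv, Rat.den_inv_of_ne_zero ha, Int.natAbs_mul, Int.natAbs_sign_of_ne_zero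
        (Rat.num_ne_zero.2 ha), one_mul, Int.natAbs_natCast, add_comm]
    rw [h2]
    calc ratLen a ≤ (ratLen a + 2) ^ 1 := by simp
      _ ≤ _ := Nat.pow_le_pow_right (by omega) (by norm_num)

end BitLength

/-! ### Randomized oracle programs over a field

A program works on a random access memory of natural numbers, a random access memory of field
elements, and a sequence of coin tosses. It is a finite text that does not mention the field. Every
operation is charged the bit lengths of the numbers, addresses and field elements it handles
(logarithmic cost). -/

section Machine

/-- Expressions for natural numbers; `load a` is the content of address `a` of the memory of
natural numbers, and `sub` is truncated subtraction. -/
inductive NExp : Type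
  | const (n : ℕ)
  | load (a : NExp)
  | add (a b : NExp)
  | sub (a b : NExp)
  | mul (a b : NExp)

/-- Expressions for field elements; `load a` is the content of address `a` of the memory of field
elements. -/
inductive FExp : Type
  | load (a : NExp)
  | zero
  | one
  | add (x y : FExp)
  | sub (x y : FExp)
  | mul (x y : FExp)
  | inv (x : FExp)

/-- Tests. -/
inductive BExp : Type
  | lt (a b : NExp)
  | isZero (x : FExp)
  | not (b : BExp)

/-- Programs. -/
inductive Prog : Type
  /-- store a natural number at address `a` -/
  | setNat (a e : NExp)
  /-- store a field element at address `a` -/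
  | setFld (a : NExp) (e : FExp)
  /-- toss a coin and store the outcome `0` or `1` at address `a` -/
  | toss (a : NExp)
  /-- call the oracle with width `w` on the `(w²)³` coefficients that start at address `src`; store
  `1` or `0` at address `flag` for "Yes" or "No", and in the first case the `3 · (w²)²` matrix
  entries of the answer from address `dst` on -/
  | query (w src dst flag : NExp)
  | seq (p q : Prog)
  | cond (b : BExp) (p q : Prog)
  | loop (b : BExp) (p : Prog)

/-- A state: the two memories and the coin tosses to come. -/
structure State (F : Type*) where
  nat : ℕ → ℕ
  fld : ℕ → F
  coins : ℕ → Bool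

variable {F : Type*} [Field F] (len : F → ℕ)

def NExp.eval (s : State F) : NExp → ℕ
  | .const n => n
  | .load a => s.nat (a.eval s)
  | .add a b => a.eval s + b.eval s
  | .sub a b => a.eval s - b.eval s
  | .mul a b => a.eval s * b.eval s

/-- The cost of an evaluation. -/
def NExp.cost (s : State F) : NExp → ℕ
  | .const n => 1 + n.size
  | .load a => a.cost s + 1 + (a.eval s).size + (s.nat (a.eval s)).size
  | .add a b => a.cost s + b.cost s + 1 + (a.eval s).size + (b.eval s).size
  | .sub a b => a.cost s + b.cost s + 1 + (a.eval s).size + (b.eval s).size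
  | .mul a b => a.cost s + b.cost s + 1 + (a.eval s).size + (b.eval s).size

def FExp.eval (s : State F) : FExp → F
  | .load a => s.fld (a.eval s)
  | .zero => 0
  | .one => 1
  | .add x y => x.eval s + y.eval s
  | .sub x y => x.eval s - y.eval s
  | .mul x y => x.eval s * y.eval s
  | .inv x => (x.eval s)⁻¹

/-- The cost of an evaluation. -/
def FExp.cost (s : State F) : FExp → ℕ
  | .load a => a.cost s + 1 + (a.eval s).size + len (s.fld (a.eval s))
  | .zero => 1 + len (0 : F)
  | .one => 1 + len (1 : F)
  | .add x y => x.cost s + y.cost s + 1 + len (x.eval s) + len (y.eval s)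
      + len (x.eval s + y.eval s)
  | .sub x y => x.cost s + y.cost s + 1 + len (x.eval s) + len (y.eval s)
      + len (x.eval s - y.eval s)
  | .mul x y => x.cost s + y.cost s + 1 + len (x.eval s) + len (y.eval s)
      + len (x.eval s * y.eval s)
  | .inv x => x.cost s + 1 + len (x.eval s) + len (x.eval s)⁻¹

def BExp.Holds (s : State F) : BExp → Prop
  | .lt a b => a.eval s < b.eval s
  | .isZero x => x.eval s = 0
  | .not b => ¬ b.Holds s

/-- The cost of a test. -/
def BExp.cost (s : State F) : BExp → ℕ
  | .lt a b => a.cost s + b.cost s + 1 + (a.eval s).size + (b.eval s).size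
  | .isZero x => x.cost len s + 1 + len (x.eval s)
  | .not b => b.cost s + 1

/-- The coefficients of a tensor that are stored in the order of the triples `(i, j, k)` from
address `src` on. -/
def readCoeffs (s : State F) (src n : ℕ) : Coeffs F n :=
  fun i j k => s.fld (src + ((i * n + j) * n + k))

/-- The memory after the entries of `B` were written in the order of the triples `(k, i, j)` from
address `dst` on. -/
def writeMatrices (f : ℕ → F) (dst : ℕ) {n : ℕ} (B : Fin 3 → Matrix (Fin n) (Fin n) F) : ℕ → F :=
  fun x => if h : dst ≤ x ∧ x - dst < 3 * (n * n) then
      B (finProdFinEquiv.symm ⟨x - dst, h.2⟩).1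
        (finProdFinEquiv.symm (finProdFinEquiv.symm ⟨x - dst, h.2⟩).2).1
        (finProdFinEquiv.symm (finProdFinEquiv.symm ⟨x - dst, h.2⟩).2).2
    else f x

/-- The state after an oracle call. -/
def State.afterQuery (O : Oracle F) (s : State F) (w src dst flag : ℕ) : State F :=
  match O w (readCoeffs s src (w * w)) with
  | none => { s with nat := Function.update s.nat flag 0 }
  | some B => { s with
      nat := Function.update s.nat flag 1
      fld := writeMatrices s.fld dst B }

/-- The cost of writing the query and of reading the answer. -/
def queryCost (O : Oracle F) (s : State F) (w src dst flag : ℕ) : ℕ :=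
  1 + w.size + src.size + dst.size + flag.size
    + ∑ i, ∑ j, ∑ k, (1 + len (readCoeffs s src (w * w) i j k))
    + match O w (readCoeffs s src (w * w)) with
      | none => 0
      | some B => ∑ k, ∑ i, ∑ j, (1 + len (B k i j))

/-- `Exec len O p s s' t`: started in state `s`, the program `p` with oracle `O` halts in state
`s'` after time `t`. -/
inductive Exec (O : Oracle F) : Prog → State F → State F → ℕ → Prop
  | setNat (a e : NExp) (s : State F) :
      Exec O (.setNat a e) s { s with nat := Function.update s.nat (a.eval s) (e.eval s) }
        (a.cost s + e.cost s + 1 + (a.eval s).size + (e.eval s).size)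
  | setFld (a : NExp) (e : FExp) (s : State F) :
      Exec O (.setFld a e) s { s with fld := Function.update s.fld (a.eval s) (e.eval s) }
        (a.cost s + e.cost len s + 1 + (a.eval s).size + len (e.eval s))
  | toss (a : NExp) (s : State F) :
      Exec O (.toss a) s
        { s with
          nat := Function.update s.nat (a.eval s) (s.coins 0).toNat
          coins := fun i => s.coins (i + 1) }
        (a.cost s + 2 + (a.eval s).size)
  | query (w src dst flag : NExp) (s : State F) :
      Exec O (.query w src dst flag) s
        (s.afterQuery O (w.eval s) (src.eval s) (dst.eval s) (flag.eval s))
        (w.cost s + src.cost s + dst.cost s + flag.cost s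
          + queryCost len O s (w.eval s) (src.eval s) (dst.eval s) (flag.eval s))
  | seq {p q : Prog} {s₁ s₂ s₃ : State F} {t₁ t₂ : ℕ} :
      Exec O p s₁ s₂ t₁ → Exec O q s₂ s₃ t₂ → Exec O (.seq p q) s₁ s₃ (t₁ + t₂)
  | cond_true {b : BExp} {p : Prog} (q : Prog) {s s' : State F} {t : ℕ} :
      b.Holds s → Exec O p s s' t → Exec O (.cond b p q) s s' (b.cost len s + t)
  | cond_false {b : BExp} (p : Prog) {q : Prog} {s s' : State F} {t : ℕ} :
      ¬ b.Holds s → Exec O q s s' t → Exec O (.cond b p q) s s' (b.cost len s + t)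
  | loop_true {b : BExp} {p : Prog} {s₁ s₂ s₃ : State F} {t₁ t₂ : ℕ} :
      b.Holds s₁ → Exec O p s₁ s₂ t₁ → Exec O (.loop b p) s₂ s₃ t₂ →
        Exec O (.loop b p) s₁ s₃ (b.cost len s₁ + t₁ + t₂)
  | loop_false {b : BExp} (p : Prog) {s : State F} :
      ¬ b.Holds s → Exec O (.loop b p) s s (b.cost len s)

/-- Once the coin tosses are given, the final state and the running time are determined. -/
theorem Exec.unique {len : F → ℕ} {O : Oracle F} {p : Prog} {s s₁ : State F} {t₁ : ℕ}
    (h : Exec len O p s s₁ t₁) : ∀ {s₂ : State F} {t₂ : ℕ}, Exec len O p s s₂ t₂ →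
      s₁ = s₂ ∧ t₁ = t₂ := by
  induction h with
  | setNat => rintro _ _ ⟨⟩; exact ⟨rfl, rfl⟩
  | setFld => rintro _ _ ⟨⟩; exact ⟨rfl, rfl⟩
  | toss => rintro _ _ ⟨⟩; exact ⟨rfl, rfl⟩
  | query => rintro _ _ ⟨⟩; exact ⟨rfl, rfl⟩
  | seq _ _ ih₁ ih₂ =>
    rintro _ _ (_ | _ | _ | _ | ⟨h₁, h₂⟩)
    obtain ⟨rfl, rfl⟩ := ih₁ h₁
    obtain ⟨rfl, rfl⟩ := ih₂ h₂
    exact ⟨rfl, rfl⟩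
  | cond_true _ hb _ ih =>
    intro _ _ h'
    cases h' with
    | cond_true _ _ h => obtain ⟨rfl, rfl⟩ := ih h; exact ⟨rfl, rfl⟩
    | cond_false _ hb' _ => exact absurd hb hb'
  | cond_false _ hb _ ih =>
    intro _ _ h'
    cases h' with
    | cond_true _ hb' _ => exact absurd hb' hb
    | cond_false _ _ h => obtain ⟨rfl, rfl⟩ := ih h; exact ⟨rfl, rfl⟩
  | loop_true hb _ _ ih₁ ih₂ =>
    intro _ _ h'
    cases h' with
    | loop_true _ h₁ h₂ =>
      obtain ⟨rfl, rfl⟩ := ih₁ h₁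
      obtain ⟨rfl, rfl⟩ := ih₂ h₂
      exact ⟨rfl, rfl⟩
    | loop_false _ hb' => exact absurd hb hb'
  | loop_false _ hb =>
    intro _ _ h'
    cases h' with
    | loop_true hb' _ _ => exact absurd hb' hb
    | loop_false _ _ => exact ⟨rfl, rfl⟩

/-- The law of a sequence of independent fair coin tosses. -/
noncomputable def fairCoins : MeasureTheory.Measure (ℕ → Bool) :=
  MeasureTheory.Measure.infinitePi fun _ => (PMF.uniformOfFintype Bool).toMeasure

end Machine

/-! ### Full matrix algebra isomorphism -/

section FMAI

variable {F : Type*} [Field F] {m r : ℕ}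

/-- The initial state on the input `E_0, …, E_{r-1}`: `m` and `r` are stored as natural numbers at
addresses `0` and `1`, the matrix entries in the order of the triples (index of the matrix, row,
column) from address `0` on, and everything else is zero. -/
def inputState (E : Fin r → Matrix (Fin m) (Fin m) F) (coins : ℕ → Bool) : State F where
  nat := fun x => if x = 0 then m else if x = 1 then r else 0
  fld := fun x => if h : x < r * (m * m) then
      E (finProdFinEquiv.symm ⟨x, h⟩).1
        (finProdFinEquiv.symm (finProdFinEquiv.symm ⟨x, h⟩).2).1
        (finProdFinEquiv.symm (finProdFinEquiv.symm ⟨x, h⟩).2).2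
    else 0
  coins := coins

/-- The output is "No". -/
def OutputsNo (s : State F) : Prop := s.nat 0 = 0

/-- The output is "Yes", together with the width `w` (at address `1`) and matrices
`Φ_0, …, Φ_{r-1}` of size `w × w`, stored like the input. -/
def OutputsYes (s : State F) (w : ℕ) (Φ : Fin r → Matrix (Fin w) (Fin w) F) : Prop :=
  s.nat 0 = 1 ∧ s.nat 1 = w ∧
    ∀ (i : Fin r) (a b : Fin w), s.fld ((i * w + a) * w + b) = Φ i a b

variable {A : NonUnitalSubalgebra F (Matrix (Fin m) (Fin m) F)}

/-- `A ≅ M_w(F)` for some `w` with `w² = dim A`: there is a bijective linear multiplicative map.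
(`A` need not contain the identity matrix.) -/
def IsFullMatrixAlgebra (A : NonUnitalSubalgebra F (Matrix (Fin m) (Fin m) F)) : Prop :=
  ∃ w : ℕ, w ^ 2 = Module.finrank F A ∧
    ∃ φ : A →ₙₐ[F] Matrix (Fin w) (Fin w) F, Function.Bijective φ

/-- The final state `s` says "Yes" and presents an isomorphism of algebras `φ : A → M_w(F)`, where
`w² = dim A`, by the images of the basis `E`. -/
def OutputsIso (E : Module.Basis (Fin r) F A) (s : State F) : Prop :=
  ∃ w : ℕ, w ^ 2 = Module.finrank F A ∧
    ∃ φ : A →ₙₐ[F] Matrix (Fin w) (Fin w) F, Function.Bijective φ ∧ OutputsYes s w fun i => φ (E i)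

end FMAI

/-!
The algorithm is deterministic. Let `A` have dimension `r`. If `r` is not a square, the answer is
"No". If `r = w²`, let `T x` be the trace of the left multiplication by `x` on `A`, and ask the oracle
about the tensor with coefficients `T (e_i e_j e_k)` for a basis `e` of `A` (`regTensor`).

If `φ : A → M_w(F)` is an isomorphism, then `T x = w tr (φ x)`, so the tensor is matrix
multiplication in other coordinates (`exists_isTensorIso`). Conversely, suppose that
`T (x y z) = tr (B₀(x) B₁(y) B₂(z))` with bijective linear maps `B_k`. The form `T (x y)` is then
non-degenerate, even if `A` is not known to be unital. Hence `A` has a left identity `e` and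
`x ↦ B₀(x) B₀(e)⁻¹` is an isomorphism from `A` to `M_w(F)` (`exists_isUnit_mul_inv_mul`). So the
oracle decides the question. As the characteristic does not divide `w`, the matrix
`M = w B₀(e)⁻¹` is the only solution of the linear system `tr (B₀(x) M) = T x`, from which it is
computed (`exists_algHom_of_tensor`, `exists_algHom_of_isTensorIso`).

The running time comes from the lengths of the numbers that occur. Apart from the inversion of `w`,
all field arithmetic is done by two kinds of program: `fill`, which stores sums of products in an
array, and `elim`, a Gauss–Jordan elimination. A sum of products is, up to sign, a determinant whose
entries are the factors, `0` and `1`, and by Cramer's rule the entries of a reduced matrix are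
quotients of minors of the matrix at the start, however many steps of elimination have gone before
(`IsPivoted`). So such a program turns a bound `P ^ e` for the whole memory into `P ^ e'`, where
`e'` depends on `e` and the constants only (`nextExp`), and a fixed number of them runs in polynomial
time (`Reaches`). The cost of an instruction is bounded by a power of the bound for the memory, with
an exponent that depends on the text of the program (`Runs`).
-/

/-! ### Costs of single instructions -/

/-- The exponent in the bound `P ^ wt` for the cost of an evaluation, where `P` bounds the memory. -/
def NExp.wt : NExp → ℕ
  | .const n => n.size + 1
  | .load a => 2 * a.wt + 6
  | .add a b => 2 * a.wt + 2 * b.wt + 4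
  | .sub a b => 2 * a.wt + 2 * b.wt + 4
  | .mul a b => 2 * a.wt + 2 * b.wt + 4

/-- The exponent in the bound for the cost of an evaluation, over a field with constant `c`. -/
def FExp.wt (c : ℕ) : FExp → ℕ
  | .load a => 2 * a.wt + 6
  | .zero => 2
  | .one => 2
  | .add x y => 2 * x.wt c + 2 * y.wt c + 5 + (x.wt c + y.wt c + 9) * c
  | .sub x y => 2 * x.wt c + 2 * y.wt c + 5 + (x.wt c + y.wt c + 9) * c
  | .mul x y => 2 * x.wt c + 2 * y.wt c + 5 + (x.wt c + y.wt c + 9) * c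
  | .inv x => 2 * x.wt c + 5 + (x.wt c + 2) * c

/-- The exponent in the bound for the cost of a test. -/
def BExp.wt (c : ℕ) : BExp → ℕ
  | .lt a b => 2 * a.wt + 2 * b.wt + 4
  | .isZero x => 2 * x.wt c + 2
  | .not b => b.wt c + 1

/-- The exponent in the bound for the cost of each instruction of a program. -/
def Prog.wt (c : ℕ) : Prog → ℕ
  | .setNat a e => 2 * a.wt + 2 * e.wt + 4
  | .setFld a e => 2 * a.wt + 2 * e.wt c + 4
  | .toss a => 2 * a.wt + 4
  | .query w src dst flag => 2 * w.wt + 2 * src.wt + 2 * dst.wt + 2 * flag.wt + 30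
  | .seq p q => p.wt c + q.wt c
  | .cond b p q => b.wt c + p.wt c + q.wt c
  | .loop b p => b.wt c + p.wt c

theorem add_le_pow {P a b x y : ℕ} (z : ℕ) (hP : 2 ≤ P) (ha : a ≤ P ^ x) (hb : b ≤ P ^ y)
    (h : x + y + 1 ≤ z) : a + b ≤ P ^ z := by
  have h1 : P ^ x ≤ P ^ (x + y) := Nat.pow_le_pow_right (by omega) (by omega)
  have h2 : P ^ y ≤ P ^ (x + y) := Nat.pow_le_pow_right (by omega) (by omega)
  calc a + b ≤ P ^ (x + y) * 2 := by omega
    _ ≤ P ^ (x + y) * P := Nat.mul_le_mul_left _ hP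
    _ = P ^ (x + y + 1) := (pow_succ _ _).symm
    _ ≤ _ := Nat.pow_le_pow_right (by omega) h

theorem Nat.size_add_le (a b : ℕ) : (a + b).size ≤ a.size + b.size + 1 := by
  rw [Nat.size_le]
  have h1 := Nat.lt_size_self a
  have h2 := Nat.lt_size_self b
  have h3 : 2 ^ a.size ≤ 2 ^ (a.size + b.size) := Nat.pow_le_pow_right (by omega) (by omega)
  have h4 : 2 ^ b.size ≤ 2 ^ (a.size + b.size) := Nat.pow_le_pow_right (by omega) (by omega)
  rw [pow_succ]; omega

theorem Nat.size_mul_le (a b : ℕ) : (a * b).size ≤ a.size + b.size := by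
  rcases Nat.eq_zero_or_pos b with rfl | hb
  · simp
  rw [Nat.size_le, pow_add]
  exact lt_of_lt_of_le (Nat.mul_lt_mul_of_pos_right (Nat.lt_size_self a) hb)
    (Nat.mul_le_mul_left _ (Nat.lt_size_self b).le)

theorem Nat.size_le_self' (a : ℕ) : a.size ≤ a := Nat.size_le.2 Nat.lt_two_pow_self

section Lengths

variable {F : Type*} [Field F] {len : F → ℕ} {c : ℕ}

theorem IsBitLength.len_zero_le (h : IsBitLength len c) : len 0 ≤ (len 1 + 4) ^ c := by
  have := h.det_le 2 !![1, 1; 1, 1] (len 1) le_rfl (by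
    intro i j; fin_cases i <;> fin_cases j <;> simp)
  rw [Matrix.det_fin_two_of] at this
  simpa [add_comm, add_left_comm, add_assoc] using this

theorem IsBitLength.len_add_le (h : IsBitLength len c) {x y : F} {b : ℕ} (h0 : len 0 ≤ b)
    (h1 : len 1 ≤ b) (hx : len x ≤ b) (hy : len y ≤ b) : len (x + y) ≤ (b + 5) ^ c := by
  have := h.det_le 3 !![0, 1, 1; 1, 0, 1; x, y, 0] b h1 (by
    intro i j; fin_cases i <;> fin_cases j <;> simp [*])
  rw [Matrix.det_fin_three] at this
  simp at this
  rwa [show b + 5 = 3 + b + 2 by omega]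

theorem IsBitLength.len_sub_le (h : IsBitLength len c) {x y : F} {b : ℕ}
    (h1 : len 1 ≤ b) (hx : len x ≤ b) (hy : len y ≤ b) : len (x - y) ≤ (b + 5) ^ c := by
  have := h.det_le 2 !![x, y; 1, 1] b h1 (by
    intro i j; fin_cases i <;> fin_cases j <;> simp [*])
  rw [Matrix.det_fin_two_of] at this
  simp only [mul_one] at this
  exact this.trans (Nat.pow_le_pow_left (by omega) _)

theorem IsBitLength.len_mul_le (h : IsBitLength len c) {x y : F} {b : ℕ} (h0 : len 0 ≤ b)
    (h1 : len 1 ≤ b) (hx : len x ≤ b) (hy : len y ≤ b) : len (x * y) ≤ (b + 5) ^ c := by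
  have := h.det_le 2 !![x, 0; 0, y] b h1 (by
    intro i j; fin_cases i <;> fin_cases j <;> simp [*])
  rw [Matrix.det_fin_two_of] at this
  simp only [mul_zero, sub_zero] at this
  exact this.trans (Nat.pow_le_pow_left (by omega) _)

theorem IsBitLength.len_inv_le (h : IsBitLength len c) {x : F} {b : ℕ} (h0 : len 0 ≤ b)
    (hx : len x ≤ b) : len x⁻¹ ≤ b + (b + 2) ^ c := by
  by_cases hx0 : x = 0
  · subst hx0; rw [inv_zero]; omega
  · exact (h.inv_le x hx0).trans
      ((Nat.pow_le_pow_left (by omega) _).trans (Nat.le_add_left _ _))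

/-- The numbers in both memories of a state are at most `V`, respectively have length at most `V`. -/
structure State.Good (len : F → ℕ) (V : ℕ) (s : State F) : Prop where
  nat : ∀ x, s.nat x ≤ V
  fld : ∀ x, len (s.fld x) ≤ V
  zero : len 0 ≤ V
  one : len 1 ≤ V

variable {V : ℕ} {s : State F}

theorem NExp.size_le_and_cost_le (hs : s.Good len V) (e : NExp) :
    (e.eval s).size ≤ (V + 2) ^ e.wt ∧ e.cost s ≤ (V + 2) ^ e.wt := by
  have hP : 2 ≤ V + 2 := by omega
  have one : 1 ≤ (V + 2) ^ 0 := by simp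
  induction e with
  | const n =>
    have h : 1 + n.size ≤ (V + 2) ^ (n.size + 1) := by
      calc 1 + n.size ≤ 2 ^ (n.size + 1) := by
            have := Nat.lt_two_pow_self (n := n.size + 1); omega
        _ ≤ _ := Nat.pow_le_pow_left hP _
    simp only [NExp.eval, NExp.cost, NExp.wt]
    exact ⟨by omega, h⟩
  | load a ih =>
    have h1 : (s.nat (a.eval s)).size ≤ (V + 2) ^ 1 := by
      have := (Nat.size_le_self' _).trans (hs.nat (a.eval s)); rw [pow_one]; omega
    simp only [NExp.eval, NExp.cost, NExp.wt]
    refine ⟨h1.trans (Nat.pow_le_pow_right (by omega) (by omega)), ?_⟩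
    exact add_le_pow _ hP (add_le_pow _ hP (add_le_pow _ hP ih.2 one le_rfl) ih.1 le_rfl) h1
      (by omega)
  | add a b iha ihb =>
    simp only [NExp.eval, NExp.cost, NExp.wt]
    refine ⟨(Nat.size_add_le _ _).trans ?_, ?_⟩
    · exact add_le_pow _ hP (add_le_pow _ hP iha.1 ihb.1 le_rfl) one (by omega)
    · exact add_le_pow _ hP (add_le_pow _ hP (add_le_pow _ hP (add_le_pow _ hP iha.2 ihb.2 le_rfl)
        one le_rfl) iha.1 le_rfl) ihb.1 (by omega)
  | sub a b iha ihb =>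
    simp only [NExp.eval, NExp.cost, NExp.wt]
    refine ⟨(Nat.size_le_size (Nat.sub_le _ _)).trans (iha.1.trans
      (Nat.pow_le_pow_right (by omega) (by omega))), ?_⟩
    · exact add_le_pow _ hP (add_le_pow _ hP (add_le_pow _ hP (add_le_pow _ hP iha.2 ihb.2 le_rfl)
        one le_rfl) iha.1 le_rfl) ihb.1 (by omega)
  | mul a b iha ihb =>
    simp only [NExp.eval, NExp.cost, NExp.wt]
    refine ⟨(Nat.size_mul_le _ _).trans ?_, ?_⟩
    · exact add_le_pow _ hP iha.1 ihb.1 (by omega)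
    · exact add_le_pow _ hP (add_le_pow _ hP (add_le_pow _ hP (add_le_pow _ hP iha.2 ihb.2 le_rfl)
        one le_rfl) iha.1 le_rfl) ihb.1 (by omega)

theorem FExp.len_le_and_cost_le (hl : IsBitLength len c) (hs : s.Good len V) (e : FExp) :
    len (e.eval s) ≤ (V + 2) ^ e.wt c ∧ e.cost len s ≤ (V + 2) ^ e.wt c := by
  have hP : 2 ≤ V + 2 := by omega
  have one : 1 ≤ (V + 2) ^ 0 := by simp
  have hV : V ≤ (V + 2) ^ 1 := by simp
  have h0 := hs.zero.trans hV
  have h1 := hs.one.trans hV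
  -- a bound for the lengths of the arguments and of `0` and `1`, and the length of the result
  have key : ∀ (x y z : F) (a b : ℕ), len x ≤ (V + 2) ^ a → len y ≤ (V + 2) ^ b →
      (∀ B, len 0 ≤ B → len 1 ≤ B → len x ≤ B → len y ≤ B → len z ≤ (B + 5) ^ c) →
      len z ≤ (V + 2) ^ ((a + b + 9) * c) := by
    intro x y z a b hx hy hz
    have hB := add_le_pow _ hP (add_le_pow _ hP (add_le_pow _ hP hx hy le_rfl) h0 le_rfl) h1 le_rfl
    have h5 : 5 ≤ (V + 2) ^ 3 := by
      calc 5 ≤ 2 ^ 3 := by norm_num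
        _ ≤ _ := Nat.pow_le_pow_left hP 3
    refine (hz _ (by omega) (by omega) (by omega) (by omega)).trans
      ((Nat.pow_le_pow_left (add_le_pow (a + b + 9) hP hB h5 (by omega)) c).trans ?_)
    rw [pow_mul]
  induction e with
  | load a =>
    have h2 : len (s.fld (a.eval s)) ≤ (V + 2) ^ 1 := (hs.fld _).trans hV
    obtain ⟨ih1, ih2⟩ := NExp.size_le_and_cost_le hs a
    simp only [FExp.eval, FExp.cost, FExp.wt]
    refine ⟨h2.trans (Nat.pow_le_pow_right (by omega) (by omega)), ?_⟩
    exact add_le_pow _ hP (add_le_pow _ hP (add_le_pow _ hP ih2 one le_rfl) ih1 le_rfl) h2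
      (by omega)
  | zero => exact ⟨h0.trans (Nat.pow_le_pow_right (by omega) (by simp [FExp.wt])),
      add_le_pow _ hP one h0 (by simp [FExp.wt])⟩
  | one => exact ⟨h1.trans (Nat.pow_le_pow_right (by omega) (by simp [FExp.wt])),
      add_le_pow _ hP one h1 (by simp [FExp.wt])⟩
  | add x y ihx ihy =>
    have h := key _ _ (x.eval s + y.eval s) _ _ ihx.1 ihy.1
      fun B b0 b1 bx b2 => hl.len_add_le b0 b1 bx b2
    simp only [FExp.eval, FExp.cost, FExp.wt]
    exact ⟨h.trans (Nat.pow_le_pow_right (by omega) (by omega)),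
      add_le_pow _ hP (add_le_pow _ hP (add_le_pow _ hP (add_le_pow _ hP (add_le_pow _ hP
        ihx.2 ihy.2 le_rfl) one le_rfl) ihx.1 le_rfl) ihy.1 le_rfl) h (by omega)⟩
  | sub x y ihx ihy =>
    have h := key _ _ (x.eval s - y.eval s) _ _ ihx.1 ihy.1
      fun B b0 b1 bx b2 => hl.len_sub_le b1 bx b2
    simp only [FExp.eval, FExp.cost, FExp.wt]
    exact ⟨h.trans (Nat.pow_le_pow_right (by omega) (by omega)),
      add_le_pow _ hP (add_le_pow _ hP (add_le_pow _ hP (add_le_pow _ hP (add_le_pow _ hP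
        ihx.2 ihy.2 le_rfl) one le_rfl) ihx.1 le_rfl) ihy.1 le_rfl) h (by omega)⟩
  | mul x y ihx ihy =>
    have h := key _ _ (x.eval s * y.eval s) _ _ ihx.1 ihy.1
      fun B b0 b1 bx b2 => hl.len_mul_le b0 b1 bx b2
    simp only [FExp.eval, FExp.cost, FExp.wt]
    exact ⟨h.trans (Nat.pow_le_pow_right (by omega) (by omega)),
      add_le_pow _ hP (add_le_pow _ hP (add_le_pow _ hP (add_le_pow _ hP (add_le_pow _ hP
        ihx.2 ihy.2 le_rfl) one le_rfl) ihx.1 le_rfl) ihy.1 le_rfl) h (by omega)⟩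
  | inv x ih =>
    have h : len (x.eval s)⁻¹ ≤ (V + 2) ^ (2 + (x.wt c + 2) * c) := by
      by_cases hx0 : x.eval s = 0
      · rw [hx0, inv_zero]; exact h0.trans (Nat.pow_le_pow_right (by omega) (by omega))
      · have h2 : len (x.eval s) + 2 ≤ (V + 2) ^ (x.wt c + 2) :=
          add_le_pow (y := 1) _ hP ih.1 (by simp) (by omega)
        refine (hl.inv_le _ hx0).trans ((Nat.pow_le_pow_left h2 c).trans ?_)
        rw [← pow_mul]; exact Nat.pow_le_pow_right (by omega) (by omega)
    simp only [FExp.eval, FExp.cost, FExp.wt]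
    exact ⟨h.trans (Nat.pow_le_pow_right (by omega) (by omega)),
      add_le_pow _ hP (add_le_pow _ hP (add_le_pow _ hP ih.2 one le_rfl) ih.1 le_rfl) h
        (by omega)⟩

theorem BExp.cost_le (hl : IsBitLength len c) (hs : s.Good len V) (b : BExp) :
    b.cost len s ≤ (V + 2) ^ b.wt c := by
  have hP : 2 ≤ V + 2 := by omega
  have one : 1 ≤ (V + 2) ^ 0 := by simp
  induction b with
  | lt a b =>
    obtain ⟨ha1, ha2⟩ := NExp.size_le_and_cost_le hs a
    obtain ⟨hb1, hb2⟩ := NExp.size_le_and_cost_le hs b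
    exact add_le_pow _ hP (add_le_pow _ hP (add_le_pow _ hP (add_le_pow _ hP ha2 hb2 le_rfl)
        one le_rfl) ha1 le_rfl) hb1 (by simp only [BExp.wt]; omega)
  | isZero x =>
    obtain ⟨hx1, hx2⟩ := FExp.len_le_and_cost_le hl hs x
    exact add_le_pow _ hP (add_le_pow _ hP hx2 one le_rfl) hx1 (by simp only [BExp.wt]; omega)
  | not b ih => exact add_le_pow _ hP ih one (by simp only [BExp.wt]; omega)

end Lengths

/-! ### Running programs on bounded states -/

section Runs

variable {F : Type*} [Field F] {len : F → ℕ} {c V : ℕ} {O : Oracle F}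

/-- The state with `x` stored at address `a` of the memory of natural numbers. -/
abbrev State.setN (s : State F) (a x : ℕ) : State F := { s with nat := Function.update s.nat a x }

/-- The state with `x` stored at address `a` of the memory of field elements. -/
abbrev State.setF (s : State F) (a : ℕ) (x : F) : State F :=
  { s with fld := Function.update s.fld a x }

theorem State.Good.setN {s : State F} (h : s.Good len V) (a : ℕ) {x : ℕ} (hx : x ≤ V) :
    (s.setN a x).Good len V := by
  refine ⟨fun y => ?_, h.fld, h.zero, h.one⟩
  by_cases hy : y = a
  · subst hy; simpa using hx
  · simpa [hy] using h.nat y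

theorem State.Good.setF {s : State F} (h : s.Good len V) (a : ℕ) {x : F} (hx : len x ≤ V) :
    (s.setF a x).Good len V := by
  refine ⟨h.nat, fun y => ?_, h.zero, h.one⟩
  by_cases hy : y = a
  · subst hy; simpa using hx
  · simpa [hy] using h.fld y

variable (len c V O) in
/-- The program `p` leads from `s` to the state `s'`, whose contents are bounded by `V`, and its time
is that of `n` instructions, each charged with the uniform bound `(V + 2) ^ p.wt c`. -/
def Runs (p : Prog) (s s' : State F) (n : ℕ) : Prop :=
  s'.Good len V ∧ ∃ t, Exec len O p s s' t ∧ t ≤ n * (V + 2) ^ p.wt c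

theorem Runs.mono {p : Prog} {s s' : State F} {n n' : ℕ} (h : Runs len c V O p s s' n)
    (hn : n ≤ n') : Runs len c V O p s s' n' := by
  obtain ⟨h1, t, h2, h3⟩ := h
  exact ⟨h1, t, h2, h3.trans (Nat.mul_le_mul_right _ hn)⟩

theorem Runs.setNat {s : State F} (hs : s.Good len V) (a e : NExp) (he : e.eval s ≤ V) :
    Runs len c V O (.setNat a e) s (s.setN (a.eval s) (e.eval s)) 1 := by
  refine ⟨hs.setN _ he, _, Exec.setNat a e s, ?_⟩
  have hP : 2 ≤ V + 2 := by omega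
  have one : 1 ≤ (V + 2) ^ 0 := by simp
  obtain ⟨ha1, ha2⟩ := NExp.size_le_and_cost_le hs a
  obtain ⟨hb1, hb2⟩ := NExp.size_le_and_cost_le hs e
  rw [one_mul]
  exact add_le_pow _ hP (add_le_pow _ hP (add_le_pow _ hP (add_le_pow _ hP ha2 hb2 le_rfl)
    one le_rfl) ha1 le_rfl) hb1 (by simp only [Prog.wt]; omega)

theorem Runs.setFld (hl : IsBitLength len c) {s : State F} (hs : s.Good len V) (a : NExp) (e : FExp)
    (he : len (e.eval s) ≤ V) :
    Runs len c V O (.setFld a e) s (s.setF (a.eval s) (e.eval s)) 1 := by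
  refine ⟨hs.setF _ he, _, Exec.setFld a e s, ?_⟩
  have hP : 2 ≤ V + 2 := by omega
  have one : 1 ≤ (V + 2) ^ 0 := by simp
  obtain ⟨ha1, ha2⟩ := NExp.size_le_and_cost_le hs a
  obtain ⟨hb1, hb2⟩ := FExp.len_le_and_cost_le hl hs e
  rw [one_mul]
  exact add_le_pow _ hP (add_le_pow _ hP (add_le_pow _ hP (add_le_pow _ hP ha2 hb2 le_rfl)
    one le_rfl) ha1 le_rfl) hb1 (by simp only [Prog.wt]; omega)

theorem Runs.seq {p q : Prog} {s₁ s₂ s₃ : State F} {m n : ℕ} (h₁ : Runs len c V O p s₁ s₂ m)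
    (h₂ : Runs len c V O q s₂ s₃ n) : Runs len c V O (.seq p q) s₁ s₃ (m + n) := by
  obtain ⟨-, t₁, e₁, b₁⟩ := h₁
  obtain ⟨g, t₂, e₂, b₂⟩ := h₂
  refine ⟨g, _, e₁.seq e₂, ?_⟩
  have h1 : (V + 2) ^ p.wt c ≤ (V + 2) ^ (Prog.seq p q).wt c :=
    Nat.pow_le_pow_right (by omega) (by simp only [Prog.wt]; omega)
  have h2 : (V + 2) ^ q.wt c ≤ (V + 2) ^ (Prog.seq p q).wt c :=
    Nat.pow_le_pow_right (by omega) (by simp only [Prog.wt]; omega)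
  rw [add_mul]
  exact add_le_add (b₁.trans (Nat.mul_le_mul_left _ h1)) (b₂.trans (Nat.mul_le_mul_left _ h2))

theorem Runs.cond_true (hl : IsBitLength len c) {b : BExp} {p : Prog} (q : Prog) {s s' : State F}
    {n : ℕ} (hs : s.Good len V) (hb : b.Holds s) (h : Runs len c V O p s s' n) :
    Runs len c V O (.cond b p q) s s' (n + 1) := by
  obtain ⟨g, t, e, bd⟩ := h
  refine ⟨g, _, Exec.cond_true q hb e, ?_⟩
  have h1 : (V + 2) ^ p.wt c ≤ (V + 2) ^ (Prog.cond b p q).wt c :=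
    Nat.pow_le_pow_right (by omega) (by simp only [Prog.wt]; omega)
  have h2 : (V + 2) ^ b.wt c ≤ (V + 2) ^ (Prog.cond b p q).wt c :=
    Nat.pow_le_pow_right (by omega) (by simp only [Prog.wt]; omega)
  have h3 := b.cost_le hl hs
  rw [add_mul, one_mul, add_comm]
  exact add_le_add (bd.trans (Nat.mul_le_mul_left _ h1)) (h3.trans h2)

theorem Runs.cond_false (hl : IsBitLength len c) {b : BExp} (p : Prog) {q : Prog} {s s' : State F}
    {n : ℕ} (hs : s.Good len V) (hb : ¬ b.Holds s) (h : Runs len c V O q s s' n) :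
    Runs len c V O (.cond b p q) s s' (n + 1) := by
  obtain ⟨g, t, e, bd⟩ := h
  refine ⟨g, _, Exec.cond_false p hb e, ?_⟩
  have h1 : (V + 2) ^ q.wt c ≤ (V + 2) ^ (Prog.cond b p q).wt c :=
    Nat.pow_le_pow_right (by omega) (by simp only [Prog.wt]; omega)
  have h2 : (V + 2) ^ b.wt c ≤ (V + 2) ^ (Prog.cond b p q).wt c :=
    Nat.pow_le_pow_right (by omega) (by simp only [Prog.wt]; omega)
  have h3 := b.cost_le hl hs
  rw [add_mul, one_mul, add_comm]
  exact add_le_add (bd.trans (Nat.mul_le_mul_left _ h1)) (h3.trans h2)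

theorem Runs.loop_true (hl : IsBitLength len c) {b : BExp} {p : Prog} {s₁ s₂ s₃ : State F}
    {m n : ℕ} (hs : s₁.Good len V) (hb : b.Holds s₁) (h₁ : Runs len c V O p s₁ s₂ m)
    (h₂ : Runs len c V O (.loop b p) s₂ s₃ n) : Runs len c V O (.loop b p) s₁ s₃ (1 + m + n) := by
  obtain ⟨-, t₁, e₁, b₁⟩ := h₁
  obtain ⟨g, t₂, e₂, b₂⟩ := h₂
  refine ⟨g, _, Exec.loop_true hb e₁ e₂, ?_⟩
  have h1 : (V + 2) ^ p.wt c ≤ (V + 2) ^ (Prog.loop b p).wt c :=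
    Nat.pow_le_pow_right (by omega) (by simp only [Prog.wt]; omega)
  have h2 : (V + 2) ^ b.wt c ≤ (V + 2) ^ (Prog.loop b p).wt c :=
    Nat.pow_le_pow_right (by omega) (by simp only [Prog.wt]; omega)
  have h3 := b.cost_le hl hs
  rw [add_mul, add_mul, one_mul]
  exact add_le_add (add_le_add (h3.trans h2) (b₁.trans (Nat.mul_le_mul_left _ h1))) b₂

theorem Runs.loop_false (hl : IsBitLength len c) {b : BExp} (p : Prog) {s : State F}
    (hs : s.Good len V) (hb : ¬ b.Holds s) : Runs len c V O (.loop b p) s s 1 := by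
  refine ⟨hs, _, Exec.loop_false p hb, ?_⟩
  rw [one_mul]
  exact (b.cost_le hl hs).trans (Nat.pow_le_pow_right (by omega) (by simp only [Prog.wt]; omega))

/-- A loop whose body preserves an invariant `Inv i` while a counter `i` runs from `0` to `N`. -/
theorem Runs.loop (hl : IsBitLength len c) {b : BExp} {p : Prog} (Inv : ℕ → State F → Prop)
    {N T : ℕ} (hlt : ∀ i < N, ∀ s, Inv i s → b.Holds s) (hN : ∀ s, Inv N s → ¬ b.Holds s)
    (hbody : ∀ i < N, ∀ s, s.Good len V → Inv i s →
      ∃ s', Runs len c V O p s s' T ∧ Inv (i + 1) s')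
    {s : State F} (hs : s.Good len V) (h0 : Inv 0 s) :
    ∃ s', Runs len c V O (.loop b p) s s' (N * (T + 1) + 1) ∧ Inv N s' := by
  suffices H : ∀ k ≤ N, ∀ s : State F, s.Good len V → Inv (N - k) s →
      ∃ s', Runs len c V O (.loop b p) s s' (k * (T + 1) + 1) ∧ Inv N s' from
    H N le_rfl s hs (by simpa using h0)
  intro k
  induction k with
  | zero => exact fun _ s hs h => ⟨s, (Runs.loop_false hl p hs (hN s h)).mono (by omega), h⟩
  | succ k ih =>
    intro hk s hs h
    obtain ⟨s₂, h1, h2⟩ := hbody _ (by omega) s hs h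
    rw [show N - (k + 1) + 1 = N - k by omega] at h2
    obtain ⟨s₃, h3, h4⟩ := ih (by omega) s₂ h1.1 h2
    exact ⟨s₃, (Runs.loop_true hl hs (hlt _ (by omega) s h) h1 h3).mono (by ring_nf; omega), h4⟩

/-- The content of the fixed address `a`. -/
abbrev cell (a : ℕ) : NExp := .load (.const a)

/-- `for v = 0, …, nb - 1 do p`, where `v` and `nb` are addresses of natural numbers. -/
def forLoop (v nb : ℕ) (p : Prog) : Prog :=
  .seq (.setNat (.const v) (.const 0))
    (.loop (.lt (cell v) (cell nb)) (.seq p (.setNat (.const v) (.add (cell v) (.const 1)))))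

theorem Runs.forLoop (hl : IsBitLength len c) {v nb : ℕ} {p : Prog} (Inv : ℕ → State F → Prop)
    {N T : ℕ} (hNV : N ≤ V) (hnb : ∀ i ≤ N, ∀ s, Inv i s → s.nat nb = N ∧ s.nat v = i)
    (hbody : ∀ i < N, ∀ s, s.Good len V → Inv i s →
      ∃ s', Runs len c V O p s s' T ∧ s'.nat v = i ∧ Inv (i + 1) (s'.setN v (i + 1)))
    {s : State F} (hs : s.Good len V) (h0 : Inv 0 (s.setN v 0)) :
    ∃ s', Runs len c V O (forLoop v nb p) s s' (N * (T + 2) + 2) ∧ Inv N s' := by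
  have h1 : Runs len c V O (.setNat (.const v) (.const 0)) s (s.setN v 0) 1 :=
    Runs.setNat hs (.const v) (.const 0) (by simp [NExp.eval])
  obtain ⟨s', h2, h3⟩ := Runs.loop (O := O) (b := .lt (cell v) (cell nb))
    (p := .seq p (.setNat (.const v) (.add (cell v) (.const 1)))) hl Inv (N := N) (T := T + 1)
    (fun i hi s h => by
      obtain ⟨h4, h5⟩ := hnb i hi.le s h
      simp only [BExp.Holds, NExp.eval, h4, h5]; exact hi)
    (fun s h => by
      obtain ⟨h4, h5⟩ := hnb N le_rfl s h
      simp only [BExp.Holds, NExp.eval, h4, h5]; omega)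
    (fun i hi s hs h => by
      obtain ⟨s', h4, h5, h6⟩ := hbody i hi s hs h
      refine ⟨s'.setN v (i + 1), h4.seq ?_, h6⟩
      have := Runs.setNat (c := c) (O := O) h4.1 (.const v) (.add (cell v) (.const 1))
        (by simp only [NExp.eval, h5]; omega)
      simpa only [NExp.eval, h5] using this)
    h1.1 h0
  exact ⟨s', (h1.seq h2).mono (by ring_nf; omega), h3⟩

end Runs

/-! ### Oracle calls and nested loops that fill arrays -/

/-- The value of an expression in terms of the memory of natural numbers. -/
def NExp.ev (ν : ℕ → ℕ) : NExp → ℕ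
  | .const n => n
  | .load a => ν (a.ev ν)
  | .add a b => a.ev ν + b.ev ν
  | .sub a b => a.ev ν - b.ev ν
  | .mul a b => a.ev ν * b.ev ν

/-- The value of an expression in terms of the two memories. -/
def FExp.ev {F : Type*} [Field F] (ν : ℕ → ℕ) (f : ℕ → F) : FExp → F
  | .load a => f (a.ev ν)
  | .zero => 0
  | .one => 1
  | .add x y => x.ev ν f + y.ev ν f
  | .sub x y => x.ev ν f - y.ev ν f
  | .mul x y => x.ev ν f * y.ev ν f
  | .inv x => (x.ev ν f)⁻¹

/-- The values of the environment `ν` when the loop variables run through their ranges: the pair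
`(v, b)` stands for a loop in which `v` runs from `0` to the content of address `b`, exclusively. -/
def box : List (ℕ × ℕ) → (ℕ → ℕ) → Set (ℕ → ℕ)
  | [], ν => {ν}
  | (v, b) :: ls, ν => {ν' | ∃ i < ν b, ν' ∈ box ls (Function.update ν v i)}

theorem forall_box_nil {ν : ℕ → ℕ} {P : (ℕ → ℕ) → Prop} : (∀ ν' ∈ box [] ν, P ν') ↔ P ν := by
  simp [box]

theorem forall_box_cons {v b : ℕ} {ls : List (ℕ × ℕ)} {ν : ℕ → ℕ} {P : (ℕ → ℕ) → Prop} :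
    (∀ ν' ∈ box ((v, b) :: ls) ν, P ν') ↔
      ∀ i < ν b, ∀ ν' ∈ box ls (Function.update ν v i), P ν' := by
  simp only [box, Set.mem_ofPred_eq]
  exact ⟨fun h i hi ν' h' => h ν' ⟨i, hi, h'⟩, fun h ν' ⟨i, hi, h'⟩ => h i hi ν' h'⟩

/-- Nested loops, the first of the list being the outermost. -/
def nest : List (ℕ × ℕ) → Prog → Prog
  | [], p => p
  | (v, b) :: ls, p => forLoop v b (nest ls p)

/-- The address of the accumulator: the start of array number `12`. -/
abbrev accAddr : NExp := .mul (.const 12) (cell 4)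

/-- Store at address `d` the sum of the values of `e` when the variable at address `14` runs from `0`
to the content of address `nl`, exclusively. -/
def sumProg (d : NExp) (nl : ℕ) (e : FExp) : Prog :=
  .seq (.setFld accAddr .zero) (.seq
    (forLoop 14 nl (.setFld accAddr (.add (.load accAddr) e))) (.setFld d (.load accAddr)))

/-- Fill an array: nested loops around `sumProg`. -/
def tab (ls : List (ℕ × ℕ)) (d : NExp) (nl : ℕ) (e : FExp) : Prog := nest ls (sumProg d nl e)

theorem NExp.eval_eq_ev {F : Type*} (s : State F) (e : NExp) : e.eval s = e.ev s.nat := by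
  induction e <;> simp_all [NExp.eval, NExp.ev]

section Tab

variable {F : Type*} [Field F] {len : F → ℕ} {c V : ℕ} {O : Oracle F}

theorem FExp.eval_eq_ev (s : State F) (e : FExp) : e.eval s = e.ev s.nat s.fld := by
  induction e <;> simp_all [FExp.eval, FExp.ev, NExp.eval_eq_ev]

theorem Runs.query {s s' : State F} (hs : s.Good len V) (w src dst flag : NExp)
    (hw : w.eval s ≤ V)
    (hB : ∀ B, O (w.eval s) (readCoeffs s (src.eval s) (w.eval s * w.eval s)) = some B →
      ∀ k i j, len (B k i j) ≤ V)
    (h : s' = s.afterQuery O (w.eval s) (src.eval s) (dst.eval s) (flag.eval s))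
    (hs' : s'.Good len V) :
    Runs len c V O (.query w src dst flag) s s' 1 := by
  subst h
  refine ⟨hs', _, Exec.query w src dst flag s, ?_⟩
  have hP : 2 ≤ V + 2 := by omega
  have one : 1 ≤ (V + 2) ^ 0 := by simp
  obtain ⟨w1, w2⟩ := NExp.size_le_and_cost_le hs w
  obtain ⟨s1, s2⟩ := NExp.size_le_and_cost_le hs src
  obtain ⟨d1, d2⟩ := NExp.size_le_and_cost_le hs dst
  obtain ⟨f1, f2⟩ := NExp.size_le_and_cost_le hs flag
  set W := w.eval s with hW
  have hWV : W ≤ V + 2 := by omega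
  have hsum : ∑ i, ∑ j, ∑ k, (1 + len (readCoeffs s (src.eval s) (W * W) i j k))
      ≤ (V + 2) ^ 7 := by
    calc _ ≤ ∑ _i : Fin (W * W), ∑ _j : Fin (W * W), ∑ _k : Fin (W * W), (V + 2) := by
          refine Finset.sum_le_sum fun i _ => Finset.sum_le_sum fun j _ =>
            Finset.sum_le_sum fun k _ => ?_
          have := hs.fld (src.eval s + ((i * (W * W) + j) * (W * W) + k))
          simp only [readCoeffs]; omega
      _ = W * W * (W * W * (W * W * (V + 2))) := by simp
      _ ≤ (V + 2) * (V + 2) * ((V + 2) * (V + 2) * ((V + 2) * (V + 2) * (V + 2))) := by gcongr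
      _ = _ := by ring
  have hans : (match O W (readCoeffs s (src.eval s) (W * W)) with
      | none => 0
      | some B => ∑ k, ∑ i, ∑ j, (1 + len (B k i j))) ≤ (V + 2) ^ 7 := by
    split
    · exact Nat.zero_le _
    · rename_i B hOB
      calc _ ≤ ∑ _k : Fin 3, ∑ _i : Fin (W * W), ∑ _j : Fin (W * W), (V + 2) := by
            refine Finset.sum_le_sum fun k _ => Finset.sum_le_sum fun i _ =>
              Finset.sum_le_sum fun j _ => ?_
            have := hB B hOB k i j
            omega
        _ = 3 * (W * W * (W * W * (V + 2))) := by simp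
        _ ≤ ((V + 2) * (V + 2)) * ((V + 2) * (V + 2) * ((V + 2) * (V + 2) * (V + 2))) := by
            gcongr; nlinarith
        _ = _ := by ring
  rw [one_mul]
  unfold queryCost
  have q := add_le_pow _ hP (add_le_pow _ hP (add_le_pow _ hP (add_le_pow _ hP (add_le_pow _ hP
    (add_le_pow _ hP one w1 le_rfl) s1 le_rfl) d1 le_rfl) f1 le_rfl) hsum le_rfl) hans le_rfl
  exact add_le_pow _ hP (add_le_pow _ hP (add_le_pow _ hP (add_le_pow _ hP w2 s2 le_rfl)
    d2 le_rfl) f2 le_rfl) q (by simp only [Prog.wt]; omega)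

variable (len c V O) in
/-- Started with the natural numbers `ν` outside of `Vs` and the field elements `f₀` outside of `D`
and of the accumulator `a`, the program `p` stores at each address `x` in `W` the value `g x`. It
changes no other field elements than these and the one at `a`, and natural numbers only in `Vs`. -/
def WritesTo (p : Prog) (Vs : Set ℕ) (ν : ℕ → ℕ) (f₀ : ℕ → F) (D : Set ℕ) (a : ℕ) (g : ℕ → F)
    (W : Set ℕ) (T : ℕ) : Prop :=
  ∀ s : State F, s.Good len V → (∀ x ∉ Vs, s.nat x = ν x) →
    (∀ x ∉ D, x ≠ a → s.fld x = f₀ x) →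
    ∃ s', Runs len c V O p s s' T ∧ (∀ x ∉ Vs, s'.nat x = ν x) ∧
      (∀ x ∉ D, x ≠ a → s'.fld x = f₀ x) ∧
      (∀ x ≠ a, s'.fld x = s.fld x ∨ (x ∈ W ∧ s'.fld x = g x)) ∧ ∀ x ∈ W, s'.fld x = g x

/-- The sets written by the passes of a loop are united. The passes may overlap, as all of them agree
with the same target `g`. -/
theorem WritesTo.forLoop (hl : IsBitLength len c) {v nb : ℕ} {p : Prog} {Vs : Set ℕ} {ν : ℕ → ℕ}
    {f₀ : ℕ → F} {D : Set ℕ} {a : ℕ} {g : ℕ → F} {W : ℕ → Set ℕ} {T : ℕ} (hv : v ∉ Vs)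
    (hvb : nb ≠ v) (hb : nb ∉ Vs) (haW : ∀ i < ν nb, a ∉ W i)
    (h : ∀ i < ν nb, WritesTo len c V O p Vs (Function.update ν v i) f₀ D a g (W i) T) :
    WritesTo len c V O (forLoop v nb p) (insert v Vs) ν f₀ D a g {x | ∃ i < ν nb, x ∈ W i}
      (V * (T + 2) + 2) := by
  intro s hs hn hf
  have hN : ν nb ≤ V := by rw [← hn nb (by simp [hvb, hb])]; exact hs.nat nb
  obtain ⟨s', h1, h2⟩ := Runs.forLoop (O := O) (v := v) (nb := nb) (p := p) (N := ν nb) (T := T) hl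
    (fun i s' => s'.nat v = i ∧ (∀ x ∉ insert v Vs, s'.nat x = ν x) ∧
      (∀ x ∉ D, x ≠ a → s'.fld x = f₀ x) ∧
      (∀ x ≠ a, s'.fld x = s.fld x ∨ ((∃ i' < i, x ∈ W i') ∧ s'.fld x = g x)) ∧
      ∀ i' < i, ∀ x ∈ W i', s'.fld x = g x) hN
    (fun i _ s' h' => ⟨h'.2.1 nb (by simp [hvb, hb]), h'.1⟩)
    (fun i hi s' hs' ⟨a1, a2, a3, a4, a5⟩ => by
      obtain ⟨s'', b1, b2, b3, b4, b5⟩ := h i hi s' hs' (fun x hx => by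
        by_cases hxv : x = v
        · subst hxv; simpa using a1
        · simpa [hxv] using a2 x (by simp [hxv, hx])) a3
      refine ⟨s'', b1, by simpa using b2 v hv, by simp, fun x hx => ?_, b3, fun x hx => ?_,
        fun i' hi' x hx => ?_⟩
      · have hx' : x ≠ v ∧ x ∉ Vs := by simpa using hx
        simpa [hx'.1] using b2 x hx'.2
      · rcases b4 x hx with hb4 | hb4
        · rcases a4 x hx with ha4 | ⟨⟨i', hi', hW⟩, ha4⟩
          · exact Or.inl (hb4.trans ha4)
          · exact Or.inr ⟨⟨i', by omega, hW⟩, hb4.trans ha4⟩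
        · exact Or.inr ⟨⟨i, by omega, hb4.1⟩, hb4.2⟩
      · rcases Nat.lt_succ_iff_lt_or_eq.1 hi' with hlt | rfl
        · have hxa : x ≠ a := fun hxa => haW i' (by omega) (hxa ▸ hx)
          rcases b4 x hxa with hb4 | hb4
          · exact hb4.trans (a5 i' hlt x hx)
          · exact hb4.2
        · exact b5 x hx)
    hs ⟨by simp, fun x hx => by
      have hx' : x ≠ v ∧ x ∉ Vs := by simpa using hx
      simpa [hx'.1] using hn x hx, hf, fun x _ => Or.inl rfl, fun i' hi' => by omega⟩
  obtain ⟨-, c2, c3, c4, c5⟩ := h2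
  exact ⟨s', h1.mono (by gcongr), c2, c3, c4, fun x ⟨i, hi, hx⟩ => c5 i hi x hx⟩

/-- The addresses of the loop variables of `nest ls (sumProg _ _ _)`. -/
def loopVars (ls : List (ℕ × ℕ)) : Set ℕ := {x | x = 14 ∨ x ∈ ls.map Prod.fst}

theorem WritesTo.nest (hl : IsBitLength len c) {p : Prog} {f₀ : ℕ → F} {D : Set ℕ} {a : ℕ}
    {g : ℕ → F} {d : NExp} {T : ℕ} (hT : 2 ≤ T) (ls : List (ℕ × ℕ))
    (hnd : (14 :: ls.map Prod.fst).Nodup) (hb : ∀ q ∈ ls, q.2 ∉ 14 :: ls.map Prod.fst) :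
    ∀ ν : ℕ → ℕ, (∀ ν' ∈ box ls ν, a ≠ d.ev ν') →
      (∀ ν' ∈ box ls ν, WritesTo len c V O p {14} ν' f₀ D a g {d.ev ν'} T) →
      WritesTo len c V O (nest ls p) (loopVars ls) ν f₀ D a g {x | ∃ ν' ∈ box ls ν, x = d.ev ν'}
        ((V + 2) ^ (2 * ls.length) * T) := by
  induction ls with
  | nil =>
    intro ν _ h
    have := h ν rfl
    simpa [_root_.nest, loopVars, box] using this
  | cons q ls ih =>
    obtain ⟨v, nb⟩ := q
    intro ν ha h
    simp only [List.map_cons, List.nodup_cons, List.mem_cons, not_or] at hnd hb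
    have hb0 := hb (v, nb) (by simp)
    have H := WritesTo.forLoop (O := O) (V := V) (p := _root_.nest ls p) (f₀ := f₀) (D := D) (a := a)
      (g := g) (ν := ν) (Vs := loopVars ls) (T := (V + 2) ^ (2 * ls.length) * T)
      (W := fun i => {x | ∃ ν' ∈ box ls (Function.update ν v i), x = d.ev ν'}) hl (v := v) (nb := nb)
      (by simp only [loopVars, Set.mem_ofPred_eq, not_or]; exact ⟨fun h => hnd.1.1 h.symm, hnd.2.1⟩)
      hb0.2.1 (by simp only [loopVars, Set.mem_ofPred_eq, not_or]; exact ⟨hb0.1, hb0.2.2⟩)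
      (fun i hi ⟨ν', h1, h2⟩ => ha ν' ⟨i, hi, h1⟩ h2)
      (fun i hi => ih (by
          simp only [List.nodup_cons]; exact ⟨hnd.1.2, hnd.2.2⟩)
        (fun q hq => by
          have := hb q (Or.inr hq)
          simp only [List.mem_cons, not_or]; exact ⟨this.1, this.2.2⟩) _
        (fun ν' h' => ha ν' ⟨i, hi, h'⟩) (fun ν' h' => h ν' ⟨i, hi, h'⟩))
    have e1 : insert v (loopVars ls) = loopVars ((v, nb) :: ls) := by
      ext x; simp only [loopVars, Set.mem_insert_iff, Set.mem_ofPred_eq, List.map_cons,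
        List.mem_cons]; tauto
    have e2 : {x | ∃ i < ν nb, x ∈ {x | ∃ ν' ∈ box ls (Function.update ν v i), x = d.ev ν'}}
        = {x | ∃ ν' ∈ box ((v, nb) :: ls) ν, x = d.ev ν'} := by
      ext x; simp only [box, Set.mem_ofPred_eq]
      exact ⟨fun ⟨i, hi, ν', h1, h2⟩ => ⟨ν', ⟨i, hi, h1⟩, h2⟩,
        fun ⟨ν', ⟨i, hi, h1⟩, h2⟩ => ⟨i, hi, ν', h1, h2⟩⟩
    rw [e1, e2] at H
    intro s hs hn hf
    obtain ⟨s', h1, h2⟩ := H s hs hn hf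
    refine ⟨s', h1.mono ?_, h2⟩
    set U := (V + 2) ^ (2 * ls.length) * T with hU
    have hU2 : 2 ≤ U := hT.trans (Nat.le_mul_of_pos_left _ (by positivity))
    have e : (V + 2) ^ (2 * ((v, nb) :: ls).length) * T = (V + 2) * (V + 2) * U := by
      rw [hU, List.length_cons]; ring
    rw [e]; nlinarith [Nat.mul_le_mul_left V hU2, Nat.zero_le (V * V * U), Nat.zero_le (V * U)]

/-- The hypothesis `he` says that `e` does not read what is written: neither the set `D` of target
addresses nor the accumulator. -/
theorem WritesTo.sumProg (hl : IsBitLength len c) {ν : ℕ → ℕ} {f₀ : ℕ → F} {D : Set ℕ}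
    {g : ℕ → F} {d : NExp} {nl : ℕ} {e : FExp} (hnl : nl ≠ 14)
    (hd : ∀ x, d.ev (Function.update ν 14 x) = d.ev ν) (hD : d.ev ν ∈ D) (ha : 12 * ν 4 ∉ D)
    (he : ∀ l < ν nl, ∀ f : ℕ → F, (∀ x ∉ D, x ≠ 12 * ν 4 → f x = f₀ x) →
      e.ev (Function.update ν 14 l) f = e.ev (Function.update ν 14 l) f₀)
    (hlen : ∀ n ≤ ν nl, len (∑ l ∈ Finset.range n, e.ev (Function.update ν 14 l) f₀) ≤ V)
    (hg : g (d.ev ν) = ∑ l ∈ Finset.range (ν nl), e.ev (Function.update ν 14 l) f₀) :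
    WritesTo len c V O (sumProg d nl e) {14} ν f₀ D (12 * ν 4) g {d.ev ν} (3 * V + 4) := by
  intro s hs hn hf
  have hn4 : s.nat 4 = ν 4 := hn 4 (by simp)
  have hnn : s.nat nl = ν nl := hn nl (by simpa using hnl)
  have hda : d.ev ν ≠ 12 * ν 4 := fun h => ha (h ▸ hD)
  have h1 : Runs len c V O (.setFld accAddr .zero) s (s.setF (12 * ν 4) 0) 1 := by
    have := Runs.setFld (O := O) hl hs accAddr .zero hs.zero
    simpa only [NExp.eval, hn4, FExp.eval] using this
  obtain ⟨s₂, h2, a1, a2, a3, a4, a5⟩ := Runs.forLoop (O := O) (v := 14) (nb := nl) (N := ν nl)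
    (T := 1) (p := .setFld accAddr (.add (.load accAddr) e)) hl
    (fun i s' => s'.nat 14 = i ∧ (∀ x ∉ ({14} : Set ℕ), s'.nat x = ν x) ∧
      (∀ x ∉ D, x ≠ 12 * ν 4 → s'.fld x = f₀ x) ∧ (∀ x ≠ 12 * ν 4, s'.fld x = s.fld x) ∧
      s'.fld (12 * ν 4) = ∑ l ∈ Finset.range i, e.ev (Function.update ν 14 l) f₀)
    (by rw [← hnn]; exact hs.nat nl) (fun i _ s' h' => ⟨h'.2.1 nl (by simpa using hnl), h'.1⟩)
    (fun i hi s' hs' ⟨b1, b2, b3, b4, b5⟩ => by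
      have hev : (FExp.add (.load accAddr) e).eval s'
          = ∑ l ∈ Finset.range (i + 1), e.ev (Function.update ν 14 l) f₀ := by
        have hnat : s'.nat = Function.update ν 14 i := by
          funext x
          by_cases hx : x = 14
          · subst hx; simpa using b1
          · simpa [hx] using b2 x (by simpa using hx)
        rw [Finset.sum_range_succ, ← b5, ← he i hi s'.fld b3]
        simp only [FExp.eval, NExp.eval, b2 4 (by simp), FExp.eval_eq_ev, hnat]
      refine ⟨s'.setF (12 * ν 4) (∑ l ∈ Finset.range (i + 1), e.ev (Function.update ν 14 l) f₀),
        ?_, b1, by simp, fun x hx => ?_, fun x hx hxa => ?_, fun x hx => ?_, by simp⟩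
      · have := Runs.setFld (O := O) hl hs' accAddr (.add (.load accAddr) e)
          (by rw [hev]; exact hlen _ hi)
        rw [hev] at this
        simpa only [NExp.eval, b2 4 (by simp)] using this
      · have hx' : x ≠ 14 := by simpa using hx
        simpa [hx'] using b2 x hx
      · simpa [hxa] using b3 x hx hxa
      · simpa [hx] using b4 x hx)
    h1.1 ⟨by simp, fun x hx => by
        have hx' : x ≠ 14 := by simpa using hx
        simpa [hx'] using hn x hx, fun x hx hxa => by simpa [hxa] using hf x hx hxa,
      fun x hx => by simp [hx], by simp⟩
  have hdev : d.eval s₂ = d.ev ν := by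
    rw [NExp.eval_eq_ev, ← hd (s₂.nat 14)]
    congr 1
    funext x
    by_cases hx : x = 14
    · subst hx; simp
    · simpa [hx] using a2 x (by simpa using hx)
  have h3 : Runs len c V O (.setFld d (.load accAddr)) s₂ (s₂.setF (d.ev ν) (g (d.ev ν))) 1 := by
    have h4 : (FExp.load accAddr).eval s₂ = g (d.ev ν) := by
      simp only [FExp.eval, NExp.eval, a2 4 (by simp), a5, hg]
    have := Runs.setFld (O := O) hl h2.1 d (.load accAddr) (by rw [h4, hg]; exact hlen _ le_rfl)
    rwa [h4, hdev] at this
  have hN : ν nl ≤ V := by rw [← hnn]; exact hs.nat nl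
  refine ⟨_, (h1.seq (h2.seq h3)).mono (by omega), a2, fun x hx hxa => ?_, fun x hx => ?_,
    fun x hx => ?_⟩
  · have : x ≠ d.ev ν := fun h => hx (h ▸ hD)
    simpa [this] using a3 x hx hxa
  · by_cases hxd : x = d.ev ν
    · subst hxd; simp
    · exact Or.inl (by simpa [hxd] using a4 x hx)
  · rw [Set.mem_singleton_iff] at hx; subst hx; simp

/-- The effect of `tab`, provided that the expression `e` does not read from the set `D` of
addresses that are written, and that equal target addresses come with equal values. -/
theorem Runs.tab (hl : IsBitLength len c) (ls : List (ℕ × ℕ)) (d : NExp) (nl : ℕ) (e : FExp)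
    {s : State F} (hs : s.Good len V) (D : Set ℕ) (hnd : (14 :: ls.map Prod.fst).Nodup)
    (hb : ∀ q ∈ ls, q.2 ∉ 14 :: ls.map Prod.fst) (h4 : 4 ∉ ls.map Prod.fst)
    (hnl : nl ∉ 14 :: ls.map Prod.fst) (hlen4 : ls.length ≤ 4)
    (hd : ∀ ν ∈ box ls s.nat, ∀ x, d.ev (Function.update ν 14 x) = d.ev ν)
    (hD : ∀ ν ∈ box ls s.nat, d.ev ν ∈ D) (ha : 12 * s.nat 4 ∉ D)
    (he : ∀ ν ∈ box ls s.nat, ∀ l < s.nat nl, ∀ f : ℕ → F,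
      (∀ x ∉ D, x ≠ 12 * s.nat 4 → f x = s.fld x) →
      e.ev (Function.update ν 14 l) f = e.ev (Function.update ν 14 l) s.fld)
    (hinj : ∀ ν ∈ box ls s.nat, ∀ ν' ∈ box ls s.nat, d.ev ν = d.ev ν' → ∀ l < s.nat nl,
      e.ev (Function.update ν 14 l) s.fld = e.ev (Function.update ν' 14 l) s.fld)
    (hlen : ∀ ν ∈ box ls s.nat, ∀ n ≤ s.nat nl,
      len (∑ l ∈ Finset.range n, e.ev (Function.update ν 14 l) s.fld) ≤ V) :
    ∃ s', Runs len c V O (tab ls d nl e) s s' ((V + 2) ^ 11) ∧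
      (∀ x ∉ loopVars ls, s'.nat x = s.nat x) ∧
      (∀ ν ∈ box ls s.nat, s'.fld (d.ev ν)
        = ∑ l ∈ Finset.range (s.nat nl), e.ev (Function.update ν 14 l) s.fld) ∧
      ∀ x ≠ 12 * s.nat 4, (∀ ν ∈ box ls s.nat, x ≠ d.ev ν) → s'.fld x = s.fld x := by
  classical
  set val : (ℕ → ℕ) → F := fun ν =>
    ∑ l ∈ Finset.range (s.nat nl), e.ev (Function.update ν 14 l) s.fld with hval
  obtain ⟨g, hg⟩ : ∃ g : ℕ → F, ∀ ν ∈ box ls s.nat, g (d.ev ν) = val ν := by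
    refine ⟨fun x => if h : ∃ ν ∈ box ls s.nat, d.ev ν = x then val h.choose else 0,
      fun ν hν => ?_⟩
    have h : ∃ ν' ∈ box ls s.nat, d.ev ν' = d.ev ν := ⟨ν, hν, rfl⟩
    beta_reduce
    rw [dif_pos h]
    exact Finset.sum_congr rfl fun l hl =>
      hinj _ h.choose_spec.1 ν hν h.choose_spec.2 l (Finset.mem_range.1 hl)
  -- the loops leave the bounds and the position of the arrays alone
  have hcell : ∀ x ∉ ls.map Prod.fst, ∀ ν, ∀ ν' ∈ box ls ν, ν' x = ν x := by
    intro x hx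
    clear * - hx
    induction ls with
    | nil => rintro ν _ rfl; rfl
    | cons q ls ih =>
      rintro ν ν' ⟨i, hi, h⟩
      simp only [List.map_cons, List.mem_cons, not_or] at hx
      rw [ih hx.2 _ _ h, Function.update_of_ne hx.1]
  have hnl' : nl ∉ ls.map Prod.fst ∧ nl ≠ 14 := by
    simp only [List.mem_cons, not_or] at hnl; exact ⟨hnl.2, hnl.1⟩
  have H := WritesTo.nest (O := O) (V := V) (T := 3 * V + 4) (f₀ := s.fld) (D := D)
    (a := 12 * s.nat 4) (g := g) (d := d) (p := sumProg d nl e) hl (by omega) ls hnd hb s.nat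
    (fun ν hν h => ha (h ▸ hD ν hν))
    (fun ν hν => by
      have c4 := hcell 4 h4 _ ν hν
      have cn := hcell nl hnl'.1 _ ν hν
      have := WritesTo.sumProg (O := O) (V := V) (ν := ν) (f₀ := s.fld) (D := D) (g := g) (d := d)
        (nl := nl) (e := e) hl hnl'.2 (hd ν hν) (hD ν hν) (by rwa [c4]) (by rw [c4, cn]; exact he ν hν)
        (by rw [cn]; exact hlen ν hν) (by rw [cn]; exact hg ν hν)
      rwa [c4] at this)
  obtain ⟨s', a1, a2, -, a4, a5⟩ := H s hs (fun _ _ => rfl) (fun _ _ _ => rfl)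
  refine ⟨s', a1.mono ?_, a2, fun ν hν => (a5 _ ⟨ν, hν, rfl⟩).trans (hg ν hν), fun x hx h => ?_⟩
  · calc (V + 2) ^ (2 * ls.length) * (3 * V + 4) ≤ (V + 2) ^ 8 * (V + 2) ^ 3 := by
          refine Nat.mul_le_mul (Nat.pow_le_pow_right (by omega) (by omega)) ?_
          nlinarith [Nat.zero_le (V ^ 3), Nat.zero_le (V ^ 2), Nat.zero_le V]
      _ = _ := by ring
  · rcases a4 x hx with h' | ⟨⟨ν, hν, rfl⟩, -⟩
    · exact h'
    · exact absurd rfl (h ν hν)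

end Tab

/-! ### Filling arrays with up to four indices -/

/-- The address of the entry at offset `o` of array number `a`; the arrays have length `S`, which is
stored at address `4`. -/
abbrev arr (a : ℕ) (o : NExp) : NExp := .add (.mul (.const a) (cell 4)) o

/-- Four nested loops with indices at the addresses `10, …, 13` and bounds at the addresses `b₁, …,
b₄`: store at offset `o` of array `a` the sum of the `e` for the summation index at address `14`
below the content of `nl`. -/
def fill (b₁ b₂ b₃ b₄ a : ℕ) (o : NExp) (nl : ℕ) (e : FExp) : Prog :=
  tab [(10, b₁), (11, b₂), (12, b₃), (13, b₄)] (arr a o) nl e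

/-- Agreement of two memories of natural numbers outside of the loop variables of `fill`. -/
def AgreeN (ν ν' : ℕ → ℕ) : Prop := ∀ x, x < 10 ∨ 14 < x → ν x = ν' x

/-- Agreement of two memories of field elements on all arrays of length `S` but array `a` and the one
of the accumulator. -/
def AgreeF {F : Type*} (S a : ℕ) (f f' : ℕ → F) : Prop :=
  ∀ b o, b ≠ a → b ≠ 12 → o < S → f (b * S + o) = f' (b * S + o)

theorem arr_ne {S a b o o' : ℕ} (hab : a ≠ b) (ho : o < S) (ho' : o' < S) :
    a * S + o ≠ b * S + o' := by
  intro h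
  rcases Nat.lt_or_gt_of_ne hab with hlt | hlt
  · have : (a + 1) * S ≤ b * S := Nat.mul_le_mul_right _ hlt
    rw [add_mul, one_mul] at this; omega
  · have : (b + 1) * S ≤ a * S := Nat.mul_le_mul_right _ hlt
    rw [add_mul, one_mul] at this; omega

section Fill

variable {F : Type*} [Field F] {len : F → ℕ} {c V : ℕ} {O : Oracle F}

/-- The result of `fill`: the entry at offset `δ i j k h` of array `a` is the sum of the `τ i j k h l`,
and all other arrays but the one of the accumulator are as before. -/
theorem Runs.fill (hl : IsBitLength len c) {b₁ b₂ b₃ b₄ a nl S N₁ N₂ N₃ N₄ n : ℕ}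
    (o : NExp) (e : FExp) (δ : ℕ → ℕ → ℕ → ℕ → ℕ) (τ : ℕ → ℕ → ℕ → ℕ → ℕ → F)
    {s : State F} (hs : s.Good len V) (hS : s.nat 4 = S)
    (hb₁ : s.nat b₁ = N₁) (hb₂ : s.nat b₂ = N₂) (hb₃ : s.nat b₃ = N₃) (hb₄ : s.nat b₄ = N₄)
    (hnl : s.nat nl = n)
    (hsmall : b₁ < 10 ∧ b₂ < 10 ∧ b₃ < 10 ∧ b₄ < 10 ∧ nl < 10 ∧ a ≠ 12)
    (hδ : ∀ ν, AgreeN ν s.nat → o.ev ν = δ (ν 10) (ν 11) (ν 12) (ν 13))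
    (hτ : ∀ i < N₁, ∀ j < N₂, ∀ k < N₃, ∀ h < N₄, ∀ l < n, ∀ ν f, AgreeN ν s.nat →
      AgreeF S a f s.fld → ν 10 = i → ν 11 = j → ν 12 = k → ν 13 = h → ν 14 = l →
      e.ev ν f = τ i j k h l)
    (hδS : ∀ i < N₁, ∀ j < N₂, ∀ k < N₃, ∀ h < N₄, δ i j k h < S)
    (hinj : ∀ i < N₁, ∀ j < N₂, ∀ k < N₃, ∀ h < N₄, ∀ i' < N₁, ∀ j' < N₂, ∀ k' < N₃, ∀ h' < N₄,
      δ i j k h = δ i' j' k' h' → i = i' ∧ j = j' ∧ k = k' ∧ h = h')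
    (hlen : ∀ i < N₁, ∀ j < N₂, ∀ k < N₃, ∀ h < N₄, ∀ n' ≤ n,
      len (∑ l ∈ Finset.range n', τ i j k h l) ≤ V) :
    ∃ s', Runs len c V O (_root_.fill b₁ b₂ b₃ b₄ a o nl e) s s' ((V + 2) ^ 11) ∧
      AgreeN s'.nat s.nat ∧
      (∀ i < N₁, ∀ j < N₂, ∀ k < N₃, ∀ h < N₄,
        s'.fld (a * S + δ i j k h) = ∑ l ∈ Finset.range n, τ i j k h l) ∧
      ∀ b o', b ≠ 12 → o' < S →
        (b ≠ a ∨ ∀ i < N₁, ∀ j < N₂, ∀ k < N₃, ∀ h < N₄, o' ≠ δ i j k h) →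
        s'.fld (b * S + o') = s.fld (b * S + o') := by
  obtain ⟨s1, s2, s3, s4, s5, s6⟩ := hsmall
  -- membership in the box, in terms of the four indices
  have hbox : ∀ P : (ℕ → ℕ) → Prop,
      (∀ ν ∈ box [(10, b₁), (11, b₂), (12, b₃), (13, b₄)] s.nat, P ν) ↔
        ∀ i < N₁, ∀ j < N₂, ∀ k < N₃, ∀ h < N₄, P (Function.update (Function.update
          (Function.update (Function.update s.nat 10 i) 11 j) 12 k) 13 h) := by
    intro P
    have u : ∀ {x y : ℕ}, x < 10 → 10 ≤ y → x ≠ y := by omega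
    simp only [forall_box_cons, forall_box_nil, Function.update_of_ne, u s2, u s3, u s4, ne_eq,
      not_false_eq_true, Nat.reduceLeDiff, le_refl, hb₁, hb₂, hb₃, hb₄]
  have hag : ∀ i j k h l, AgreeN (Function.update (Function.update (Function.update
      (Function.update (Function.update s.nat 10 i) 11 j) 12 k) 13 h) 14 l) s.nat := by
    intro i j k h l x hx
    have : x ≠ 10 ∧ x ≠ 11 ∧ x ≠ 12 ∧ x ≠ 13 ∧ x ≠ 14 := by omega
    simp [this]
  have hag' : ∀ i j k h, AgreeN (Function.update (Function.update (Function.update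
      (Function.update s.nat 10 i) 11 j) 12 k) 13 h) s.nat := by
    intro i j k h x hx
    have : x ≠ 10 ∧ x ≠ 11 ∧ x ≠ 12 ∧ x ≠ 13 := by omega
    simp [this]
  have hd : ∀ i j k h, (arr a o).ev (Function.update (Function.update (Function.update
      (Function.update s.nat 10 i) 11 j) 12 k) 13 h) = a * S + δ i j k h := by
    intro i j k h
    simp only [NExp.ev]
    rw [hδ _ (hag' i j k h), hag' i j k h 4 (by norm_num), hS]
    simp
  have hd' : ∀ i j k h x, (arr a o).ev (Function.update (Function.update (Function.update
      (Function.update (Function.update s.nat 10 i) 11 j) 12 k) 13 h) 14 x)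
      = a * S + δ i j k h := by
    intro i j k h x
    simp only [NExp.ev]
    rw [hδ _ (hag i j k h x), hag i j k h x 4 (by norm_num), hS]
    simp
  have hev : ∀ i < N₁, ∀ j < N₂, ∀ k < N₃, ∀ h < N₄, ∀ l < n, ∀ f, AgreeF S a f s.fld →
      e.ev (Function.update (Function.update (Function.update (Function.update
        (Function.update s.nat 10 i) 11 j) 12 k) 13 h) 14 l) f = τ i j k h l :=
    fun i hi j hj k hk h hh l hl f hf => hτ i hi j hj k hk h hh l hl _ f (hag i j k h l) hf
      (by simp) (by simp) (by simp) (by simp) (by simp)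
  have hself : AgreeF S a s.fld s.fld := fun _ _ _ _ _ => rfl
  have mem : ∀ x : ℕ, 10 ≤ x → x ≠ b₁ ∧ x ≠ b₂ ∧ x ≠ b₃ ∧ x ≠ b₄ ∧ x ≠ nl := by omega
  obtain ⟨s', r1, r2, r3, r4⟩ := Runs.tab (O := O) (V := V) hl
    [(10, b₁), (11, b₂), (12, b₃), (13, b₄)] (arr a o) nl e hs {x | ∃ o < S, x = a * S + o}
    (by simp) (by simp; omega) (by simp) (by simp; omega) (by simp)
    ((hbox _).2 fun i hi j hj k hk h hh x => by rw [hd', hd])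
    ((hbox _).2 fun i hi j hj k hk h hh => ⟨_, hδS i hi j hj k hk h hh, hd i j k h⟩)
    (by
      rintro ⟨o, ho, h⟩
      rw [hS] at h
      exact arr_ne (o := 0) (Ne.symm s6) (by omega) ho (by simpa using h))
    ((hbox _).2 fun i hi j hj k hk h hh l hl f hf => by
      rw [hnl] at hl
      rw [hev i hi j hj k hk h hh l hl f, hev i hi j hj k hk h hh l hl _ hself]
      intro b o' hba hb ho'
      refine hf _ ?_ ?_
      · rintro ⟨o, ho, h⟩; exact arr_ne hba ho' ho h
      · rw [hS]; simpa using arr_ne (o' := 0) hb ho' (by omega))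
    ((hbox _).2 fun i hi j hj k hk h hh => (hbox _).2 fun i' hi' j' hj' k' hk' h' hh' heq l hl => by
      rw [hnl] at hl
      rw [hd, hd] at heq
      obtain ⟨rfl, rfl, rfl, rfl⟩ := hinj i hi j hj k hk h hh i' hi' j' hj' k' hk' h' hh' (by omega)
      rfl)
    ((hbox _).2 fun i hi j hj k hk h hh n' hn' => by
      rw [hnl] at hn'
      rw [Finset.sum_congr rfl fun l hl => hev i hi j hj k hk h hh l
        (lt_of_lt_of_le (Finset.mem_range.1 hl) hn') _ hself]
      exact hlen i hi j hj k hk h hh n' hn')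
  refine ⟨s', r1, fun x hx => r2 x ?_, fun i hi j hj k hk h hh => ?_, fun b o' hb ho' h => ?_⟩
  · simp [loopVars]; omega
  · have := (hbox _).1 r3 i hi j hj k hk h hh
    rw [hd, hnl] at this
    rw [this]
    exact Finset.sum_congr rfl fun l hl =>
      hev i hi j hj k hk h hh l (Finset.mem_range.1 hl) _ hself
  · refine r4 _ ?_ ((hbox _).2 fun i hi j hj k hk l hl' => ?_)
    · rw [hS]; simpa using arr_ne (o' := 0) hb ho' (by omega)
    · rw [hd]
      rcases h with h | h
      · exact arr_ne h ho' (hδS i hi j hj k hk l hl')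
      · intro heq
        by_cases hba : b = a
        · subst hba; exact h i hi j hj k hk l hl' (by omega)
        · exact arr_ne hba ho' (hδS i hi j hj k hk l hl') heq

end Fill

/-! ### Bit lengths of inner products and of solutions of linear systems -/

section Bounds

variable {F : Type*} [Field F] {len : F → ℕ} {c : ℕ}

theorem IsBitLength.len_sum_mul_le (h : IsBitLength len c) {n b : ℕ} {x y : ℕ → F}
    (h0 : len 0 ≤ b) (h1 : len 1 ≤ b) (hx : ∀ l < n, len (x l) ≤ b) (hy : ∀ l < n, len (y l) ≤ b) :
    len (∑ l ∈ Finset.range n, x l * y l) ≤ (b + (n + b + 3) ^ c + 5) ^ c := by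
  -- up to sign, the sum is the determinant of a bordered identity matrix
  set A : Matrix (Fin n ⊕ Fin 1) (Fin n ⊕ Fin 1) F :=
    Matrix.fromBlocks 1 (Matrix.of fun l _ => y l) (Matrix.of fun _ l => x l) 0 with hA
  have hdet : A.det = -∑ l ∈ Finset.range n, x l * y l := by
    rw [hA, Matrix.det_fromBlocks_one₁₁, Matrix.det_fin_one, Finset.sum_range]
    simp [Matrix.mul_apply]
  have hlen := h.det_le (n + 1) (A.submatrix finSumFinEquiv.symm finSumFinEquiv.symm) b h1 (by
    intro i j
    simp only [Matrix.submatrix_apply]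
    generalize finSumFinEquiv.symm i = i'
    generalize finSumFinEquiv.symm j = j'
    rcases i' with i' | i' <;> rcases j' with j' | j'
    · simp only [hA, Matrix.fromBlocks_apply₁₁, Matrix.one_apply]; split <;> assumption
    · simpa [hA] using hy i' i'.2
    · simpa [hA] using hx j' j'.2
    · simpa [hA] using h0)
  rw [Matrix.det_submatrix_equiv_self, hdet] at hlen
  have := h.len_sub_le (x := 0) (y := -∑ l ∈ Finset.range n, x l * y l)
    (b := b + (n + b + 3) ^ c) (by omega) (by omega)
    (hlen.trans ((Nat.pow_le_pow_left (by omega) c).trans (Nat.le_add_left _ _)))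
  simpa using this

/-- Cramer's rule bounds the length of the solution of a linear system. -/
theorem IsBitLength.len_solution_le (h : IsBitLength len c) {n N b : ℕ}
    {C : Matrix (Fin n) (Fin n) F} {X X₀ : Matrix (Fin n) (Fin N) F} (hC : C * X = X₀)
    (hdet : C.det ≠ 0) (h0 : len 0 ≤ b) (h1 : len 1 ≤ b) (hCb : ∀ i j, len (C i j) ≤ b)
    (hXb : ∀ i j, len (X₀ i j) ≤ b) (l : Fin n) (j : Fin N) :
    len (X l j) ≤ (b + (n + b + 2) ^ c + ((n + b + 2) ^ c + 2) ^ c + 5) ^ c := by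
  have hcr : X l j = (C.updateCol l fun a => X₀ a j).det * C.det⁻¹ := by
    have h2 : (fun a => X₀ a j) = C.mulVec fun a => X a j := by
      rw [← hC]; rfl
    have h3 : (C.updateCol l fun a => X₀ a j).det = C.det * X l j := by
      rw [h2, ← Matrix.cramer_apply, Matrix.cramer_eq_adjugate_mulVec, Matrix.mulVec_mulVec,
        Matrix.adjugate_mul, Matrix.smul_mulVec, Matrix.one_mulVec]
      rfl
    rw [h3]; field_simp
  have hnum := h.det_le n (C.updateCol l fun a => X₀ a j) b h1 (by
    intro a a'
    rw [Matrix.updateCol_apply]; split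
    · exact hXb _ _
    · exact hCb _ _)
  have hden := h.det_le n C b h1 hCb
  have hinv := (h.inv_le _ hdet).trans (Nat.pow_le_pow_left (Nat.add_le_add_right hden 2) c)
  rw [hcr]
  exact h.len_mul_le (by omega) (by omega) (by omega) (by omega)

/-- The exponent for the length of inner products. -/
def dotExp (c e : ℕ) : ℕ := e + (e + (2 * e + 4) * c + 5) * c

/-- The exponent for the length of the entries of the solution of a linear system. -/
def solExp (c e : ℕ) : ℕ := e + (e + (2 * e + 3) * c + ((2 * e + 3) * c + 2) * c + 6) * c

/-- The exponent for the length of inverses. -/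
def invExp (c e : ℕ) : ℕ := e + (e + 2) * c + 1

theorem le_pow_mul {P a x c : ℕ} (z : ℕ) (ha : a ≤ P ^ x) (hz : x * c = z) : a ^ c ≤ P ^ z := by
  rw [← hz, pow_mul]; exact Nat.pow_le_pow_left ha c

variable {P e : ℕ}

theorem IsBitLength.len_sum_mul_le_pow (h : IsBitLength len c) {n : ℕ} {x y : ℕ → F} (hP : 2 ≤ P)
    (hn : n ≤ P ^ e) (h0 : len 0 ≤ P ^ e) (h1 : len 1 ≤ P ^ e) (hx : ∀ l < n, len (x l) ≤ P ^ e)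
    (hy : ∀ l < n, len (y l) ≤ P ^ e) :
    len (∑ l ∈ Finset.range n, x l * y l) ≤ P ^ dotExp c e := by
  refine (h.len_sum_mul_le h0 h1 hx hy).trans ?_
  have p3 : 3 ≤ P ^ 2 := by nlinarith
  have p5 : 5 ≤ P ^ 3 := by
    calc 5 ≤ 2 ^ 3 := by norm_num
      _ ≤ _ := Nat.pow_le_pow_left hP 3
  have q1 := le_pow_mul (c := c) _ (add_le_pow _ hP (add_le_pow _ hP hn (le_refl (P ^ e)) le_rfl) p3
    le_rfl) rfl
  have q2 := add_le_pow _ hP (add_le_pow _ hP (le_refl (P ^ e)) q1 le_rfl) p5 le_rfl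
  refine (le_pow_mul (c := c) _ q2 rfl).trans (Nat.pow_le_pow_right (by omega) ?_)
  unfold dotExp
  have : e + (e + e + 1 + 2 + 1) * c + 1 + 3 + 1 = e + (2 * e + 4) * c + 5 := by ring
  rw [this]; omega

theorem IsBitLength.len_solution_le_pow (h : IsBitLength len c) {n N : ℕ}
    {C : Matrix (Fin n) (Fin n) F} {X X₀ : Matrix (Fin n) (Fin N) F} (hC : C * X = X₀)
    (hdet : C.det ≠ 0) (hP : 2 ≤ P) (hn : n ≤ P ^ e) (h0 : len 0 ≤ P ^ e) (h1 : len 1 ≤ P ^ e)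
    (hCb : ∀ i j, len (C i j) ≤ P ^ e) (hXb : ∀ i j, len (X₀ i j) ≤ P ^ e) (l : Fin n)
    (j : Fin N) : len (X l j) ≤ P ^ solExp c e := by
  refine (h.len_solution_le hC hdet h0 h1 hCb hXb l j).trans ?_
  have p2 : 2 ≤ P ^ 1 := by rwa [pow_one]
  have p5 : 5 ≤ P ^ 3 := by
    calc 5 ≤ 2 ^ 3 := by norm_num
      _ ≤ _ := Nat.pow_le_pow_left hP 3
  have q0 := add_le_pow (2 * e + 3) hP (add_le_pow _ hP hn (le_refl (P ^ e)) le_rfl) p2 (by omega)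
  have q1 := le_pow_mul (c := c) _ q0 rfl
  have q2 := le_pow_mul (c := c) _ (add_le_pow _ hP q1 p2 le_rfl) rfl
  have q3 := add_le_pow _ hP (add_le_pow _ hP (add_le_pow _ hP (le_refl (P ^ e)) q1 le_rfl) q2
    le_rfl) p5 le_rfl
  refine (le_pow_mul (c := c) _ q3 rfl).trans (Nat.pow_le_pow_right (by omega) ?_)
  unfold solExp
  have : e + (2 * e + 3) * c + 1 + ((2 * e + 3) * c + 1 + 1) * c + 1 + 3 + 1
      = e + (2 * e + 3) * c + ((2 * e + 3) * c + 2) * c + 6 := by ring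
  rw [this]; omega

theorem IsBitLength.len_inv_le_pow (h : IsBitLength len c) {x : F} (hP : 2 ≤ P)
    (h0 : len 0 ≤ P ^ e) (hx : len x ≤ P ^ e) : len x⁻¹ ≤ P ^ invExp c e := by
  have p2 : 2 ≤ P ^ 1 := by rwa [pow_one]
  exact (h.len_inv_le h0 hx).trans (add_le_pow _ hP (le_refl (P ^ e))
    (le_pow_mul (c := c) ((e + 2) * c) (add_le_pow (e + 2) hP (le_refl (P ^ e)) p2 le_rfl) rfl)
    (by unfold invExp; omega))

theorem le_dotExp (c e : ℕ) : e ≤ dotExp c e := Nat.le_add_right _ _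

end Bounds

/-! ### Gauss–Jordan elimination -/

section Elimination

variable {F : Type*} [Field F] {n N : ℕ}

/-- The matrix after a Gauss–Jordan step with pivot in row `i` and column `p`. -/
def pivotStep (X : Matrix (Fin n) (Fin N) F) (i : Fin n) (p : Fin N) : Matrix (Fin n) (Fin N) F :=
  Matrix.of fun l j => if l = i then X i j * (X i p)⁻¹ else X l j - X l p * (X i j * (X i p)⁻¹)

/-- A pivot step for `X` replaces a column of the matrix `C` with `C * X = X₀` by a column of `X₀`. This
keeps the entries of `C` short. -/
theorem updateCol_mul_pivotStep {C : Matrix (Fin n) (Fin n) F} {X X₀ : Matrix (Fin n) (Fin N) F}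
    (h : C * X = X₀) {i : Fin n} {p : Fin N} (hp : X i p ≠ 0) :
    (C.updateCol i fun a => X₀ a p) * pivotStep X i p = X₀ := by
  ext a j
  have hX : ∀ j, X₀ a j = C a i * X i j + ∑ l ∈ Finset.univ.erase i, C a l * X l j := by
    intro j
    rw [← h, Matrix.mul_apply]
    exact (Finset.add_sum_erase _ (fun l => C a l * X l j) (Finset.mem_univ i)).symm
  rw [Matrix.mul_apply, ← Finset.add_sum_erase _ _ (Finset.mem_univ i)]
  have h1 : ∑ l ∈ Finset.univ.erase i, (C.updateCol i fun a => X₀ a p) a l * pivotStep X i p l j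
      = ∑ l ∈ Finset.univ.erase i, C a l * X l j
        - (∑ l ∈ Finset.univ.erase i, C a l * X l p) * (X i j * (X i p)⁻¹) := by
    rw [Finset.sum_mul, ← Finset.sum_sub_distrib]
    refine Finset.sum_congr rfl fun l hl => ?_
    have hli := Finset.ne_of_mem_erase hl
    rw [Matrix.updateCol_ne hli, pivotStep, Matrix.of_apply, if_neg hli]; ring
  rw [h1, Matrix.updateCol_self, pivotStep, Matrix.of_apply, if_pos rfl, hX p, hX j]
  field_simp
  ring

theorem det_updateCol_mulVec (C : Matrix (Fin n) (Fin n) F) (v : Fin n → F) (i : Fin n) :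
    (C.updateCol i (C.mulVec v)).det = C.det * v i := by
  rw [← Matrix.cramer_apply, Matrix.cramer_eq_adjugate_mulVec, Matrix.mulVec_mulVec,
    Matrix.adjugate_mul, Matrix.smul_mulVec, Matrix.one_mulVec]
  rfl

/-- `X` arises from `X₀` by row operations, in which the first `k` rows got pivots in the columns
`p 0, …, p (k - 1)`: `C` is the inverse of the transformation matrix. -/
structure IsPivoted (X₀ X : Matrix (Fin n) (Fin N) F) (C : Matrix (Fin n) (Fin n) F)
    (p : Fin n → Fin N) (k : ℕ) : Prop where
  mul : C * X = X₀
  det : C.det ≠ 0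
  col : ∀ a l, C a l = if (l : ℕ) < k then X₀ a (p l) else (1 : Matrix (Fin n) (Fin n) F) a l

theorem IsPivoted.zero (X₀ : Matrix (Fin n) (Fin N) F) (p : Fin n → Fin N) :
    IsPivoted X₀ X₀ 1 p 0 := ⟨by simp, by simp, by simp⟩

theorem IsPivoted.succ {X₀ X : Matrix (Fin n) (Fin N) F} {C : Matrix (Fin n) (Fin n) F}
    {p : Fin n → Fin N} {i : Fin n} (h : IsPivoted X₀ X C p i) {q : Fin N} (hq : X i q ≠ 0) :
    IsPivoted X₀ (pivotStep X i q) (C.updateCol i fun a => X₀ a q) (Function.update p i q)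
      (i + 1) := by
  refine ⟨updateCol_mul_pivotStep h.mul hq, ?_, fun a l => ?_⟩
  · have h2 : (fun a => X₀ a q) = C.mulVec fun a => X a q := by
      rw [← h.mul]; rfl
    rw [h2, det_updateCol_mulVec]
    exact mul_ne_zero h.det hq
  · by_cases hl : l = i
    · subst hl; simp
    · have hl' : (l : ℕ) ≠ i := fun hh => hl (Fin.ext hh)
      rw [Matrix.updateCol_ne hl, h.col, Function.update_of_ne hl]
      simp only [show (l : ℕ) < i + 1 ↔ (l : ℕ) < i by omega]

/-- If the rows of `X₀` are linearly independent already in the columns before `L`, then the next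
row has a pivot there. -/
theorem IsPivoted.exists_pivot {X₀ X : Matrix (Fin n) (Fin N) F} {C : Matrix (Fin n) (Fin n) F}
    {p : Fin n → Fin N} {k : ℕ} (h : IsPivoted X₀ X C p k) {L : ℕ}
    (hL : ∀ v : Fin n → F, (∀ j : Fin N, (j : ℕ) < L → Matrix.vecMul v X₀ j = 0) → v = 0)
    (i : Fin n) : ∃ q : Fin N, (q : ℕ) < L ∧ X i q ≠ 0 := by
  by_contra! hcon
  have hu : IsUnit C.det := h.det.isUnit
  have h1 : C⁻¹ * X₀ = X := by
    rw [← h.mul, ← Matrix.mul_assoc, Matrix.nonsing_inv_mul _ hu, Matrix.one_mul]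
  have h2 := hL (C⁻¹ i) fun j hj => by
    have := hcon j hj
    rwa [← h1] at this
  have h3 := congrFun (congrFun (Matrix.nonsing_inv_mul C hu) i) i
  rw [Matrix.mul_apply, Matrix.one_apply_eq, h2] at h3
  simp at h3

theorem IsPivoted.apply_pivot {X₀ X : Matrix (Fin n) (Fin N) F} {C : Matrix (Fin n) (Fin n) F}
    {p : Fin n → Fin N} {k : ℕ} (h : IsPivoted X₀ X C p k) (l j : Fin n) (hj : (j : ℕ) < k) :
    X l (p j) = (1 : Matrix (Fin n) (Fin n) F) l j := by
  have hu : IsUnit C.det := h.det.isUnit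
  have h1 : C⁻¹ * X₀ = X := by
    rw [← h.mul, ← Matrix.mul_assoc, Matrix.nonsing_inv_mul _ hu, Matrix.one_mul]
  rw [← h1, ← Matrix.nonsing_inv_mul C hu, Matrix.mul_apply, Matrix.mul_apply]
  exact Finset.sum_congr rfl fun a _ => by rw [h.col a j, if_pos hj]

theorem IsPivoted.len_le {X₀ X : Matrix (Fin n) (Fin N) F} {C : Matrix (Fin n) (Fin n) F}
    {p : Fin n → Fin N} {k : ℕ} (h : IsPivoted X₀ X C p k) {len : F → ℕ} {c P e : ℕ}
    (hl : IsBitLength len c) (hP : 2 ≤ P) (hn : n ≤ P ^ e) (h0 : len 0 ≤ P ^ e)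
    (h1 : len 1 ≤ P ^ e) (hX : ∀ i j, len (X₀ i j) ≤ P ^ e) (l : Fin n) (j : Fin N) :
    len (X l j) ≤ P ^ solExp c e := by
  refine hl.len_solution_le_pow h.mul h.det hP hn h0 h1 (fun a b => ?_) hX l j
  rw [h.col]
  split
  · exact hX _ _
  · rw [Matrix.one_apply]; split <;> assumption

end Elimination

/-! ### The elimination program -/

theorem mul_add_lt {i j a b : ℕ} (hi : i < a) (hj : j < b) : i * b + j < a * b :=
  calc i * b + j < i * b + b := by omega
    _ = (i + 1) * b := by ring
    _ ≤ a * b := Nat.mul_le_mul_right _ hi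

theorem mul_add_inj {i i' j j' b : ℕ} (hj : j < b) (hj' : j' < b) (h : i * b + j = i' * b + j') :
    i = i' ∧ j = j' := by
  have hb : 0 < b := by omega
  have h1 := congrArg (· / b) h
  have h2 := congrArg (· % b) h
  simp only [Nat.mul_add_mod', Nat.mod_eq_of_lt hj, Nat.mod_eq_of_lt hj'] at h2
  simp only [mul_comm _ b, Nat.mul_add_div hb, Nat.div_eq_of_lt hj, Nat.div_eq_of_lt hj'] at h1
  exact ⟨by simpa using h1, h2⟩

/-- The entry in row `i` and column `j` of the matrix in array `a`, whose number of columns is stored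
at address `cN`. -/
abbrev entry (a cN : ℕ) (i j : NExp) : FExp := .load (arr a (.add (.mul i (cell cN)) j))

/-- The Gauss–Jordan step for the row whose number is stored at address `16`: the pivot is the first
non-zero entry, whose column is stored at address `15` and in the list that starts at address `100`.
Array `13` holds the new matrix until it is complete. -/
def elimStep (a cN : ℕ) : Prog :=
  .seq (.setNat (.const 15) (.const 0)) <|
  .seq (.loop (.isZero (entry a cN (cell 16) (cell 15)))
    (.setNat (.const 15) (.add (cell 15) (.const 1)))) <|
  .seq (.setNat (.add (.const 100) (cell 16)) (cell 15)) <|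
  .seq (fill 1 cN 6 6 13 (.add (.mul (cell 10) (cell cN)) (cell 11)) 6
    (.sub (entry a cN (cell 10) (cell 11)) (.mul (entry a cN (cell 10) (cell 15))
      (.mul (entry a cN (cell 16) (cell 11)) (.inv (entry a cN (cell 16) (cell 15))))))) <|
  .seq (fill 6 cN 6 6 13 (.add (.mul (cell 16) (cell cN)) (cell 11)) 6
    (.mul (entry a cN (cell 16) (cell 11)) (.inv (entry a cN (cell 16) (cell 15)))))
  (fill 1 cN 6 6 a (.add (.mul (cell 10) (cell cN)) (cell 11)) 6
    (entry 13 cN (cell 10) (cell 11)))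

/-- Gauss–Jordan elimination for the matrix in array `a`. -/
def elim (a cN : ℕ) : Prog := forLoop 16 1 (elimStep a cN)

section Elim

variable {F : Type*} [Field F] {len : F → ℕ} {c V : ℕ} {O : Oracle F}

theorem len_sum_range_one {x : F} (h0 : len 0 ≤ V) (hx : len x ≤ V) :
    ∀ n ≤ 1, len (∑ _l ∈ Finset.range n, x) ≤ V := by
  intro n hn
  interval_cases n <;> simpa

/-- One step of the elimination: the pivot of row `i` is its first non-zero entry, its column is stored
at address `100 + i`, and the new matrix is built in array `13` and then copied back. -/
theorem runs_elimStep (hl : IsBitLength len c) {a cN r N S : ℕ} {s : State F} (hs : s.Good len V)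
    (hr : s.nat 1 = r) (hN : s.nat cN = N) (hS : s.nat 4 = S) (h6 : s.nat 6 = 1) (hrN : r * N ≤ S)
    (ha : a ≠ 12 ∧ a ≠ 13) (hc : cN < 10) (hV : 100 + r ≤ V) (i : Fin r) (hi : s.nat 16 = i)
    (X : Matrix (Fin r) (Fin N) F) (hX : ∀ (l : Fin r) (j : Fin N), s.fld (a * S + (l * N + j)) = X l j)
    (hlen : ∀ q, X i q ≠ 0 → ∀ l j, len (pivotStep X i q l j) ≤ V) {L : ℕ}
    (hL : ∃ q : Fin N, (q : ℕ) < L ∧ X i q ≠ 0) :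
    ∃ (s' : State F) (q : Fin N), Runs len c V O (elimStep a cN) s s' ((V + 2) ^ 13) ∧
      (q : ℕ) < L ∧ X i q ≠ 0 ∧ (∀ x < 10, s'.nat x = s.nat x) ∧ s'.nat 16 = i ∧
      (∀ x, 100 ≤ x → s'.nat x = Function.update s.nat (100 + i) (q : ℕ) x) ∧
      (∀ (l : Fin r) (j : Fin N), s'.fld (a * S + (l * N + j)) = pivotStep X i q l j) ∧
      ∀ b o, b ≠ 12 → b ≠ 13 → b ≠ a → o < S → s'.fld (b * S + o) = s.fld (b * S + o) := by
  classical
  obtain ⟨ha12, ha13⟩ := ha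
  obtain ⟨q₀, hq₀L, hq₀⟩ := hL
  -- the first non-zero entry of the row
  obtain ⟨q, hqN, hq, hmin, hqq₀⟩ : ∃ (q : ℕ) (h : q < N), X i ⟨q, h⟩ ≠ 0 ∧
      (∀ j, (hj : j < q) → X i ⟨j, hj.trans h⟩ = 0) ∧ q ≤ q₀ := by
    have hex : ∃ q : ℕ, ∃ h : q < N, X i ⟨q, h⟩ ≠ 0 := ⟨q₀, q₀.2, hq₀⟩
    obtain ⟨hqN, hq⟩ := Nat.find_spec hex
    refine ⟨_, hqN, hq, fun j hj => ?_, Nat.find_min' hex ⟨q₀.2, hq₀⟩⟩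
    by_contra hne
    exact Nat.find_min hex hj ⟨hj.trans hqN, hne⟩
  have hNV : N ≤ V := by rw [← hN]; exact hs.nat cN
  have hoff : ∀ (l : Fin r) (j : Fin N), (l : ℕ) * N + j < S := fun l j =>
    lt_of_lt_of_le (mul_add_lt l.2 j.2) hrN
  have hc15 : cN ≠ 15 := by omega
  have h1 : Runs len c V O (.setNat (.const 15) (.const 0)) s (s.setN 15 0) 1 :=
    Runs.setNat hs (.const 15) (.const 0) (by simp [NExp.eval])
  have hent : ∀ j : ℕ, (hj : j < N) → (entry a cN (cell 16) (cell 15)).eval (s.setN 15 j)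
      = X i ⟨j, hj⟩ := by
    intro j hj
    rw [← hX i ⟨j, hj⟩]
    simp [FExp.eval, NExp.eval, hS, hi, hN, hc15]
  obtain ⟨s₂, h2, h2s⟩ := Runs.loop (O := O) (V := V) (b := .isZero (entry a cN (cell 16) (cell 15)))
    (p := .setNat (.const 15) (.add (cell 15) (.const 1))) hl (fun j s' => s' = s.setN 15 j)
    (N := q) (T := 1) (fun j hj s' h => by
      subst h; simp only [BExp.Holds]; rw [hent j (hj.trans hqN)]; exact hmin j hj)
    (fun s' h => by subst h; simp only [BExp.Holds]; rw [hent q hqN]; exact hq)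
    (fun j hj s' hs' h => by
      subst h
      refine ⟨_, Runs.setNat hs' (.const 15) (.add (cell 15) (.const 1)) ?_, ?_⟩
      · simp [NExp.eval]; omega
      · simp [NExp.eval, State.setN])
    h1.1 rfl
  subst h2s
  have h3 : Runs len c V O (.setNat (.add (.const 100) (cell 16)) (cell 15)) (s.setN 15 q)
      ((s.setN 15 q).setN (100 + i) q) 1 := by
    have := Runs.setNat (c := c) (O := O) h2.1 (.add (.const 100) (cell 16)) (cell 15)
      (by simp [NExp.eval]; omega)
    simpa [NExp.eval, hi] using this
  set s₃ : State F := (s.setN 15 q).setN (100 + i) q with hs₃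
  have n15 : s₃.nat 15 = q := by
    rw [hs₃]; simp only; rw [Function.update_of_ne (by omega)]; simp
  have nlow : ∀ x, x < 10 ∨ x = 16 → s₃.nat x = s.nat x := by
    intro x hx
    rw [hs₃]; simp only; rw [Function.update_of_ne (by omega), Function.update_of_ne (by omega)]
  have n16 : s₃.nat 16 = i := by rw [nlow 16 (by omega), hi]
  have f3 : s₃.fld = s.fld := rfl
  -- the new rows other than row `i`
  obtain ⟨s₄, r4, g4, v4, o4⟩ := Runs.fill (O := O) (V := V) (b₁ := 1) (b₂ := cN) (b₃ := 6) (b₄ := 6)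
    (a := 13) (nl := 6) (S := S) (N₁ := r) (N₂ := N) (N₃ := 1) (N₄ := 1) (n := 1) hl
    (.add (.mul (cell 10) (cell cN)) (cell 11))
    (.sub (entry a cN (cell 10) (cell 11)) (.mul (entry a cN (cell 10) (cell 15))
      (.mul (entry a cN (cell 16) (cell 11)) (.inv (entry a cN (cell 16) (cell 15))))))
    (fun l j _ _ => l * N + j)
    (fun l j _ _ _ => if h : l < r ∧ j < N then X ⟨l, h.1⟩ ⟨j, h.2⟩ - X ⟨l, h.1⟩ ⟨q, hqN⟩ *
      (X i ⟨j, h.2⟩ * (X i ⟨q, hqN⟩)⁻¹) else 0) h3.1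
    (by rw [nlow 4 (by omega), hS]) (by rw [nlow 1 (by omega), hr]) (by rw [nlow cN (by omega), hN])
    (by rw [nlow 6 (by omega), h6]) (by rw [nlow 6 (by omega), h6]) (by rw [nlow 6 (by omega), h6])
    (by omega)
    (fun ν hν => by simp only [NExp.ev, hν cN (by omega), nlow cN (by omega), hN])
    (fun l hl j hj _ _ _ _ _ _ ν f hν hf e10 e11 _ _ _ => by
      simp only [FExp.ev, NExp.ev, hν cN (by omega), nlow cN (by omega), hN, hν 4 (by omega),
        nlow 4 (by omega), hS, hν 15 (by omega), n15, hν 16 (by omega), n16, e10, e11]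
      rw [dif_pos ⟨hl, hj⟩]
      have key : ∀ (l : Fin r) (j : Fin N), f (a * S + (l * N + j)) = X l j := fun l j => by
        rw [hf a _ ha13 ha12 (hoff l j), f3, hX]
      rw [← key, ← key, ← key, ← key])
    (fun l hl j hj _ _ _ _ => hoff ⟨l, hl⟩ ⟨j, hj⟩)
    (fun l _ j hj k hk h hh l' _ j' hj' k' hk' h' hh' heq => by
      have := mul_add_inj hj hj' heq
      omega)
    (fun l hlr j hj _ _ _ _ => by
      refine len_sum_range_one hs.zero ?_
      rw [dif_pos ⟨hlr, hj⟩]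
      by_cases hli : (⟨l, hlr⟩ : Fin r) = i
      · rw [hli]
        have : X i ⟨j, hj⟩ - X i ⟨q, hqN⟩ * (X i ⟨j, hj⟩ * (X i ⟨q, hqN⟩)⁻¹) = 0 := by
          rw [mul_left_comm, mul_inv_cancel₀ hq, mul_one, sub_self]
        rw [this]; exact hs.zero
      · have := hlen ⟨q, hqN⟩ hq ⟨l, hlr⟩ ⟨j, hj⟩
        rwa [pivotStep, Matrix.of_apply, if_neg hli] at this)
  have g4' : ∀ x, x < 10 ∨ 14 < x → s₄.nat x = s₃.nat x := g4
  have k4 : ∀ (l : Fin r) (j : Fin N), s₄.fld (a * S + (l * N + j)) = X l j := fun l j => by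
    rw [o4 a _ ha12 (hoff l j) (Or.inl ha13), f3, hX]
  -- row `i`
  obtain ⟨s₅, r5, g5, v5, o5⟩ := Runs.fill (O := O) (V := V) (b₁ := 6) (b₂ := cN) (b₃ := 6) (b₄ := 6)
    (a := 13) (nl := 6) (S := S) (N₁ := 1) (N₂ := N) (N₃ := 1) (N₄ := 1) (n := 1) hl
    (.add (.mul (cell 16) (cell cN)) (cell 11))
    (.mul (entry a cN (cell 16) (cell 11)) (.inv (entry a cN (cell 16) (cell 15))))
    (fun _ j _ _ => i * N + j)
    (fun _ j _ _ _ => if h : j < N then X i ⟨j, h⟩ * (X i ⟨q, hqN⟩)⁻¹ else 0) r4.1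
    (by rw [g4' 4 (by omega), nlow 4 (by omega), hS])
    (by rw [g4' 6 (by omega), nlow 6 (by omega), h6])
    (by rw [g4' cN (by omega), nlow cN (by omega), hN])
    (by rw [g4' 6 (by omega), nlow 6 (by omega), h6])
    (by rw [g4' 6 (by omega), nlow 6 (by omega), h6])
    (by rw [g4' 6 (by omega), nlow 6 (by omega), h6])
    (by omega)
    (fun ν hν => by simp only [NExp.ev, hν cN (by omega), g4' cN (by omega), nlow cN (by omega), hN,
      hν 16 (by omega), g4' 16 (by omega), n16])
    (fun _ _ j hj _ _ _ _ _ _ ν f hν hf _ e11 _ _ _ => by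
      simp only [FExp.ev, NExp.ev, hν cN (by omega), g4' cN (by omega), nlow cN (by omega), hN,
        hν 4 (by omega), g4' 4 (by omega), nlow 4 (by omega), hS, hν 15 (by omega),
        g4' 15 (by omega), n15, hν 16 (by omega), g4' 16 (by omega), n16, e11]
      rw [dif_pos hj]
      have key : ∀ (l : Fin r) (j : Fin N), f (a * S + (l * N + j)) = X l j := fun l j => by
        rw [hf a _ ha13 ha12 (hoff l j), k4]
      rw [← key, ← key])
    (fun _ _ j hj _ _ _ _ => hoff i ⟨j, hj⟩)
    (fun l _ j hj k hk h hh l' _ j' hj' k' hk' h' hh' heq => by omega)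
    (fun _ _ j hj _ _ _ _ => by
      refine len_sum_range_one hs.zero ?_
      rw [dif_pos hj]
      have := hlen ⟨q, hqN⟩ hq i ⟨j, hj⟩
      rwa [pivotStep, Matrix.of_apply, if_pos rfl] at this)
  have g5' : ∀ x, x < 10 ∨ 14 < x → s₅.nat x = s₃.nat x := fun x hx => (g5 x hx).trans (g4' x hx)
  have k5 : ∀ (l : Fin r) (j : Fin N),
      s₅.fld (13 * S + (l * N + j)) = pivotStep X i ⟨q, hqN⟩ l j := by
    intro l j
    rw [pivotStep, Matrix.of_apply]
    split
    · rename_i hli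
      subst hli
      simpa using v5 0 one_pos j j.2 0 one_pos 0 one_pos
    · rename_i hli
      rw [o5 13 _ (by norm_num) (hoff l j) (Or.inr fun _ _ j' hj' _ _ _ _ heq =>
        hli (Fin.ext (mul_add_inj j.2 hj' heq).1))]
      simpa using v4 l l.2 j j.2 0 one_pos 0 one_pos
  -- copying back
  obtain ⟨s₆, r6, g6, v6, o6⟩ := Runs.fill (O := O) (V := V) (b₁ := 1) (b₂ := cN) (b₃ := 6) (b₄ := 6)
    (a := a) (nl := 6) (S := S) (N₁ := r) (N₂ := N) (N₃ := 1) (N₄ := 1) (n := 1) hl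
    (.add (.mul (cell 10) (cell cN)) (cell 11)) (entry 13 cN (cell 10) (cell 11))
    (fun l j _ _ => l * N + j)
    (fun l j _ _ _ => s₅.fld (13 * S + (l * N + j))) r5.1
    (by rw [g5' 4 (by omega), nlow 4 (by omega), hS])
    (by rw [g5' 1 (by omega), nlow 1 (by omega), hr])
    (by rw [g5' cN (by omega), nlow cN (by omega), hN])
    (by rw [g5' 6 (by omega), nlow 6 (by omega), h6])
    (by rw [g5' 6 (by omega), nlow 6 (by omega), h6])
    (by rw [g5' 6 (by omega), nlow 6 (by omega), h6])
    (by omega)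
    (fun ν hν => by simp only [NExp.ev, hν cN (by omega), g5' cN (by omega), nlow cN (by omega), hN])
    (fun l hl j hj _ _ _ _ _ _ ν f hν hf e10 e11 _ _ _ => by
      simp only [FExp.ev, NExp.ev, hν cN (by omega), g5' cN (by omega), nlow cN (by omega), hN,
        hν 4 (by omega), g5' 4 (by omega), nlow 4 (by omega), hS, e10, e11]
      exact hf 13 _ (Ne.symm ha13) (by norm_num) (hoff ⟨l, hl⟩ ⟨j, hj⟩))
    (fun l hl j hj _ _ _ _ => hoff ⟨l, hl⟩ ⟨j, hj⟩)
    (fun l _ j hj k hk h hh l' _ j' hj' k' hk' h' hh' heq => by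
      have := mul_add_inj hj hj' heq
      omega)
    (fun l hlr j hj _ _ _ _ => len_sum_range_one hs.zero (r5.1.fld _))
  refine ⟨s₆, ⟨q, hqN⟩, (h1.seq (h2.seq (h3.seq (r4.seq (r5.seq r6))))).mono ?_, by
    simp only; omega, hq, fun x hx => ?_, ?_, fun x hx => ?_, fun l j => ?_,
    fun b o hb12 hb13 hba ho => ?_⟩
  · have e : (V + 2) ^ 13 = (V + 2) ^ 11 * ((V + 2) * (V + 2)) := by ring
    have hU : V + 2 ≤ (V + 2) ^ 11 := Nat.le_self_pow (by norm_num) _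
    rw [e]
    generalize (V + 2) ^ 11 = U at hU ⊢
    have h9 : 9 ≤ (V + 2) * (V + 2) := by nlinarith
    have := Nat.mul_le_mul_left U h9
    omega
  · rw [g6 x (by omega), g5' x (by omega), nlow x (by omega)]
  · rw [g6 16 (by omega), g5' 16 (by omega), n16]
  · rw [g6 x (by omega), g5' x (by omega), hs₃]
    simp only
    by_cases hxi : x = 100 + i
    · subst hxi; simp
    · rw [Function.update_of_ne hxi, Function.update_of_ne (by omega), Function.update_of_ne hxi]
  · rw [v6 l l.2 j j.2 0 one_pos 0 one_pos]
    simp [k5]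
  · rw [o6 b o hb12 ho (Or.inl hba), o5 b o hb12 ho (Or.inl hb13), o4 b o hb12 ho (Or.inl hb13), f3]

/-- The result of the elimination for a matrix whose rows are linearly independent in the columns before
`L`: all intermediate matrices are of the kind described by `IsPivoted`, and `hlen` bounds their
entries. -/
theorem runs_elim (hl : IsBitLength len c) {a cN r N S : ℕ} {s : State F} (hs : s.Good len V)
    (hr : s.nat 1 = r) (hN : s.nat cN = N) (hS : s.nat 4 = S) (h6 : s.nat 6 = 1) (hrN : r * N ≤ S)
    (ha : a ≠ 12 ∧ a ≠ 13) (hc : cN < 10) (hV : 100 + r ≤ V) (hN0 : 0 < N)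
    (X₀ : Matrix (Fin r) (Fin N) F) (hX₀ : ∀ (l : Fin r) (j : Fin N), s.fld (a * S + (l * N + j)) = X₀ l j)
    (hlen : ∀ X C p k, IsPivoted X₀ X C p k → ∀ l j, len (X l j) ≤ V) {L : ℕ}
    (hL : ∀ v : Fin r → F, (∀ j : Fin N, (j : ℕ) < L → Matrix.vecMul v X₀ j = 0) → v = 0) :
    ∃ (s' : State F) (X : Matrix (Fin r) (Fin N) F) (C : Matrix (Fin r) (Fin r) F)
      (p : Fin r → Fin N), Runs len c V O (elim a cN) s s' ((V + 2) ^ 15) ∧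
      IsPivoted X₀ X C p r ∧ (∀ l, (p l : ℕ) < L) ∧ (∀ x < 10, s'.nat x = s.nat x) ∧
      (∀ l : Fin r, s'.nat (100 + l) = p l) ∧
      (∀ (l : Fin r) (j : Fin N), s'.fld (a * S + (l * N + j)) = X l j) ∧
      ∀ b o, b ≠ 12 → b ≠ 13 → b ≠ a → o < S → s'.fld (b * S + o) = s.fld (b * S + o) := by
  obtain ⟨s', h1, h2⟩ := Runs.forLoop (O := O) (V := V) (v := 16) (nb := 1) (p := elimStep a cN)
    (N := r) (T := (V + 2) ^ 13) hl
    (fun i s' => s'.nat 16 = i ∧ (∀ x < 10, s'.nat x = s.nat x) ∧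
      (∀ b o, b ≠ 12 → b ≠ 13 → b ≠ a → o < S → s'.fld (b * S + o) = s.fld (b * S + o)) ∧
      ∃ (X : Matrix (Fin r) (Fin N) F) (C : Matrix (Fin r) (Fin r) F) (p : Fin r → Fin N),
        IsPivoted X₀ X C p i ∧ (∀ l : Fin r, (l : ℕ) < i → (p l : ℕ) < L) ∧
        (∀ l : Fin r, (l : ℕ) < i → s'.nat (100 + l) = p l) ∧
        ∀ (l : Fin r) (j : Fin N), s'.fld (a * S + (l * N + j)) = X l j)
    (by omega) (fun i _ s' h => ⟨by rw [h.2.1 1 (by norm_num), hr], h.1⟩)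
    (fun i hi s₁ hs₁ ⟨a1, a2, a3, X, C, p, a4, a5, a6, a7⟩ => by
      obtain ⟨s₂, q, b1, b2, b3, b4, b5, b6, b7, b8⟩ := runs_elimStep (O := O) (a := a) (cN := cN)
        hl hs₁ (by rw [a2 1 (by norm_num), hr]) (by rw [a2 cN hc, hN])
        (by rw [a2 4 (by norm_num), hS]) (by rw [a2 6 (by norm_num), h6]) hrN ha hc hV ⟨i, hi⟩ a1
        X a7 (fun q hq => hlen _ _ _ _ (IsPivoted.succ (i := ⟨i, hi⟩) a4 hq))
        (a4.exists_pivot hL ⟨i, hi⟩)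
      refine ⟨s₂, b1, b5, by simp, fun x hx => ?_, fun b o hb12 hb13 hba ho => ?_, _, _, _,
        IsPivoted.succ (i := ⟨i, hi⟩) a4 b3, fun l hl => ?_, fun l hl => ?_, b7⟩
      · simp only; rw [Function.update_of_ne (by omega), b4 x hx, a2 x hx]
      · exact (b8 b o hb12 hb13 hba ho).trans (a3 b o hb12 hb13 hba ho)
      · by_cases hli : l = ⟨i, hi⟩
        · subst hli; simpa using b2
        · have : (l : ℕ) ≠ i := fun h => hli (Fin.ext h)
          rw [Function.update_of_ne hli]; exact a5 l (by omega)
      · simp only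
        rw [Function.update_of_ne (by omega), b6 _ (by omega)]
        by_cases hli : l = ⟨i, hi⟩
        · subst hli; simp
        · have : (l : ℕ) ≠ i := fun h => hli (Fin.ext h)
          rw [Function.update_of_ne hli, Function.update_of_ne (by simp only; omega)]
          exact a6 l (by omega))
    hs ⟨by simp, fun x hx => by simp only; rw [Function.update_of_ne (by omega)],
      fun _ _ _ _ _ _ => rfl, X₀, 1, fun _ => ⟨0, hN0⟩, IsPivoted.zero _ _, fun l hl => by omega,
      fun l hl => by omega, hX₀⟩
  obtain ⟨-, c2, c3, X, C, p, c4, c5, c6, c7⟩ := h2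
  refine ⟨s', X, C, p, h1.mono ?_, c4, fun l => c5 l l.2, c2, fun l => c6 l l.2, c7, c3⟩
  have e : (V + 2) ^ 15 = (V + 2) ^ 13 * ((V + 2) * (V + 2)) := by ring
  have hU : V + 2 ≤ (V + 2) ^ 13 := Nat.le_self_pow (by norm_num) _
  rw [e]
  generalize (V + 2) ^ 13 = U at hU ⊢
  have h2 : r * (U + 2) ≤ V * (U + 2) := Nat.mul_le_mul_right _ (by omega)
  have h3 := Nat.mul_le_mul_left U (show V + 4 ≤ (V + 2) * (V + 2) by nlinarith)
  have h4 : V * (U + 2) = U * V + 2 * V := by ring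
  rw [mul_add U V 4] at h3
  omega

end Elim

/-! ### Tensors isomorphic to matrix multiplication -/

section TensorIso

variable {F : Type*} [Field F] {w : ℕ}

/-- The matrix of linear forms `B x`, at the `i`-th unit vector. -/
def formMatrix (B : Matrix (Fin (w * w)) (Fin (w * w)) F) (i : Fin (w * w)) :
    Matrix (Fin w) (Fin w) F := Matrix.of fun a b => B (finProdFinEquiv (a, b)) i

theorem trIMM_three : TrIMM F w 3 = ∑ a, ∑ b, ∑ c,
    MvPolynomial.X (0, a, b) * MvPolynomial.X (1, b, c) * MvPolynomial.X (2, c, a) := by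
  simp only [TrIMM, List.ofFn_succ, List.ofFn_zero, List.prod_cons, List.prod_nil, mul_one,
    Matrix.trace, Matrix.diag_apply, Matrix.mul_apply, Matrix.of_apply, Finset.mul_sum]
  refine Finset.sum_congr rfl fun a _ => Finset.sum_congr rfl fun b _ =>
    Finset.sum_congr rfl fun c _ => ?_
  rw [mul_assoc]; rfl

theorem substTrIMM_eq (B : Fin 3 → Matrix (Fin (w * w)) (Fin (w * w)) F) :
    substTrIMM w B = tensorPoly fun i j k =>
      (formMatrix (B 0) i * formMatrix (B 1) j * formMatrix (B 2) k).trace := by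
  have hR : ∀ i j k, (formMatrix (B 0) i * formMatrix (B 1) j * formMatrix (B 2) k).trace
      = ∑ p : Fin w × Fin w × Fin w, B 0 (finProdFinEquiv (p.1, p.2.1)) i *
        (B 1 (finProdFinEquiv (p.2.1, p.2.2)) j * B 2 (finProdFinEquiv (p.2.2, p.1)) k) := by
    intro i j k
    simp only [Fintype.sum_prod_type, Matrix.mul_assoc, Matrix.trace, Matrix.diag_apply,
      Matrix.mul_apply, formMatrix, Matrix.of_apply, Finset.mul_sum]
  have hL : substTrIMM w B = ∑ p : Fin w × Fin w × Fin w,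
      ∑ q : Fin (w * w) × Fin (w * w) × Fin (w * w),
        MvPolynomial.C (B 0 (finProdFinEquiv (p.1, p.2.1)) q.1 *
          (B 1 (finProdFinEquiv (p.2.1, p.2.2)) q.2.1 *
            B 2 (finProdFinEquiv (p.2.2, p.1)) q.2.2)) *
        (MvPolynomial.X (0, q.1) * MvPolynomial.X (1, q.2.1) * MvPolynomial.X (2, q.2.2)) := by
    simp only [substTrIMM, trIMM_three, map_sum, map_mul, MvPolynomial.bind₁_X_right,
      Fintype.sum_prod_type]
    refine Finset.sum_congr rfl fun a _ => Finset.sum_congr rfl fun b _ =>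
      Finset.sum_congr rfl fun c _ => ?_
    rw [mul_assoc, Finset.sum_mul_sum, Finset.sum_mul_sum]
    refine Finset.sum_congr rfl fun i _ => ?_
    refine (Finset.sum_congr rfl fun j _ => ?_)
    rw [Finset.mul_sum]
    exact Finset.sum_congr rfl fun k _ => by ring
  rw [hL, Finset.sum_comm, tensorPoly]
  simp only [hR, map_sum, Finset.sum_mul]
  rw [Fintype.sum_prod_type]
  exact Finset.sum_congr rfl fun i _ => by rw [Fintype.sum_prod_type]

theorem tensorPoly_injective {n : ℕ} : Function.Injective (tensorPoly (F := F) (n := n)) := by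
  intro t t' h
  funext i j k
  have key : ∀ t : Coeffs F n, MvPolynomial.eval (fun v : Fin 3 × Fin n =>
      if v.1 = 0 then (if v.2 = i then (1 : F) else 0) else
        if v.1 = 1 then (if v.2 = j then 1 else 0) else if v.2 = k then 1 else 0)
      (tensorPoly t) = t i j k := by
    intro t
    simp [tensorPoly]
  rw [← key t, ← key t', h]

theorem isTensorIso_iff {t : Coeffs F (w * w)}
    {B : Fin 3 → Matrix (Fin (w * w)) (Fin (w * w)) F} :
    IsTensorIso w t B ↔ (∀ k, IsUnit (B k)) ∧ ∀ i j k,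
      t i j k = (formMatrix (B 0) i * formMatrix (B 1) j * formMatrix (B 2) k).trace := by
  rw [IsTensorIso, substTrIMM_eq, tensorPoly_injective.eq_iff]
  simp only [funext_iff]

end TensorIso

/-! ### Regular traces -/

section RegularTrace

variable {F : Type*} [Field F] {w : ℕ}

theorem trace_mulLeft_matrix (x : Matrix (Fin w) (Fin w) F) :
    LinearMap.trace F _ (LinearMap.mulLeft F x) = w * x.trace := by
  rw [LinearMap.trace_eq_matrix_trace F (Matrix.stdBasis F (Fin w) (Fin w)), Matrix.trace,
    Fintype.sum_prod_type]
  have h : ∀ a b : Fin w, (LinearMap.toMatrix (Matrix.stdBasis F (Fin w) (Fin w))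
      (Matrix.stdBasis F (Fin w) (Fin w)) (LinearMap.mulLeft F x)).diag (a, b) = x a a := by
    intro a b
    rw [Matrix.diag_apply, LinearMap.toMatrix_apply, LinearMap.mulLeft_apply,
      Matrix.stdBasis_eq_single]
    simp [Matrix.stdBasis, Matrix.mul_apply, Matrix.single]
  simp only [h, Finset.sum_const, Finset.card_univ, Fintype.card_fin, nsmul_eq_mul, Matrix.trace,
    Matrix.diag_apply, Finset.mul_sum]

variable {A : Type*} [NonUnitalRing A] [Module F A] [SMulCommClass F A A]

theorem trace_mulLeft_eq_of_bijective (φ : A →ₙₐ[F] Matrix (Fin w) (Fin w) F)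
    (hφ : Function.Bijective φ) (x : A) :
    LinearMap.trace F A (LinearMap.mulLeft F x) = w * (φ x).trace := by
  set e : A ≃ₗ[F] Matrix (Fin w) (Fin w) F := LinearEquiv.ofBijective (φ : A →ₗ[F] _) hφ with he
  rw [← LinearMap.trace_conj' _ e, ← trace_mulLeft_matrix]
  congr 1
  ext1 y
  obtain ⟨z, rfl⟩ := e.surjective y
  rw [LinearEquiv.conj_apply_apply, LinearEquiv.symm_apply_apply, LinearMap.mulLeft_apply,
    LinearMap.mulLeft_apply]
  exact map_mul φ x z

/-- Two matrices that pair equally with all matrices under the trace form are equal. -/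
theorem eq_of_trace_mul_eq {x y : Matrix (Fin w) (Fin w) F}
    (h : ∀ z : Matrix (Fin w) (Fin w) F, (z * x).trace = (z * y).trace) : x = y := by
  ext i j
  have := h (Matrix.single j i 1)
  simpa [Matrix.trace, Matrix.mul_apply, Matrix.single, Finset.sum_ite_eq, ite_and] using this

variable [IsScalarTower F A A]

/-- If the trilinear form `T (x y z)` of an algebra with a linear form `T` is the matrix
multiplication tensor in other coordinates, then `x ↦ B₀ x * a⁻¹` is multiplicative for some
invertible `a`. A left identity `e` of the algebra exists since the bilinear form `T (x y)` is
non-degenerate, and `a = B₀ e`. -/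
theorem exists_isUnit_mul_inv_mul [FiniteDimensional F A] (T : A →ₗ[F] F)
    (B₀ B₁ B₂ : A →ₗ[F] Matrix (Fin w) (Fin w) F)
    (h₀ : Function.Bijective B₀) (h₁ : Function.Bijective B₁) (h₂ : Function.Bijective B₂)
    (h : ∀ x y z, T (x * y * z) = (B₀ x * B₁ y * B₂ z).trace) :
    ∃ a : Matrix (Fin w) (Fin w) F, IsUnit a ∧ ∀ x y, B₀ x * a⁻¹ * B₀ y = B₀ (x * y) := by
  have cyc : ∀ p q : Matrix (Fin w) (Fin w) F, (∀ z, (p * B₂ z).trace = (q * B₂ z).trace) → p = q :=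
    fun p q hpq => eq_of_trace_mul_eq fun z => by
      obtain ⟨z, rfl⟩ := h₂.2 z
      rw [Matrix.trace_mul_comm, hpq, Matrix.trace_mul_comm]
  -- the form `T (x y)` is non-degenerate
  have hnd : ∀ u, (∀ z, T (u * z) = 0) → u = 0 := by
    intro u hu
    obtain ⟨y, hy⟩ := h₁.2 1
    refine h₀.1 (cyc _ _ fun z => ?_)
    have := h u y z
    rw [mul_assoc, hu, hy, Matrix.mul_one] at this
    rw [← this, map_zero, Matrix.zero_mul, Matrix.trace_zero]
  obtain ⟨e, he⟩ : ∃ e, ∀ z, T (e * z) = T z := by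
    let f : A →ₗ[F] Module.Dual F A := LinearMap.mk₂ F (fun u z => T (u * z))
      (fun _ _ _ => by rw [add_mul, map_add]) (fun _ _ _ => by rw [smul_mul_assoc, map_smul])
      (fun _ _ _ => by rw [mul_add, map_add]) (fun _ _ _ => by rw [mul_smul_comm, map_smul])
    have hf : Function.Injective f := (injective_iff_map_eq_zero f).2 fun u hu =>
      hnd u fun z => LinearMap.congr_fun hu z
    have hf' : Function.Surjective f :=
      (LinearMap.injective_iff_surjective_of_finrank_eq_finrank
        (Subspace.dual_finrank_eq (K := F) (V := A)).symm).1 hf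
    obtain ⟨e, he⟩ := hf' T
    exact ⟨e, fun z => LinearMap.congr_fun he z⟩
  have hel : ∀ x, e * x = x := fun x => sub_eq_zero.1 <| hnd _ fun z => by
    rw [sub_mul, map_sub, mul_assoc, he, sub_self]
  have hmul : ∀ x y, B₀ x * B₁ y = B₀ (x * y) * B₁ e := fun x y => cyc _ _ fun z => by
    rw [← h, ← h, mul_assoc (x * y), hel]
  obtain ⟨x₁, hx₁⟩ := h₀.2 1
  obtain ⟨y₁, hy₁⟩ := h₁.2 1
  -- `B₁ e` and `a = B₀ e` have one-sided inverses
  have hb : B₀ (x₁ * y₁) * B₁ e = 1 := by rw [← hmul, hx₁, hy₁, Matrix.mul_one]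
  have hb' : B₁ e * B₀ (x₁ * y₁) = 1 := mul_eq_one_comm.1 hb
  have hay : ∀ y, B₀ e * B₁ y = B₀ y * B₁ e := fun y => by rw [hmul, hel]
  have ha : B₀ e * B₁ (x₁ * y₁) = 1 := by rw [hay, hb]
  have hau : IsUnit (B₀ e) := IsUnit.of_mul_eq_one _ ha
  have haa : (B₀ e)⁻¹ * B₀ e = 1 := Matrix.nonsing_inv_mul _ ((Matrix.isUnit_iff_isUnit_det _).1 hau)
  refine ⟨B₀ e, hau, fun x y => ?_⟩
  have h5 : (B₀ e)⁻¹ * B₀ y * B₁ e = B₁ y := by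
    rw [Matrix.mul_assoc, ← hay, ← Matrix.mul_assoc, haa, Matrix.one_mul]
  have h6 : B₀ x * (B₀ e)⁻¹ * B₀ y * B₁ e = B₀ (x * y) * B₁ e := by
    rw [← hmul, ← h5]; simp only [Matrix.mul_assoc]
  calc _ = B₀ x * (B₀ e)⁻¹ * B₀ y * (B₁ e * B₀ (x₁ * y₁)) := by rw [hb', Matrix.mul_one]
    _ = B₀ (x * y) * (B₁ e * B₀ (x₁ * y₁)) := by
      rw [← Matrix.mul_assoc, h6, Matrix.mul_assoc]
    _ = _ := by rw [hb', Matrix.mul_one]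

/-- An isomorphism of the tensor of the regular trace with matrix multiplication yields an
isomorphism of the algebra with the matrix algebra. The matrix `M`, which is `w` times the inverse of
the image of the identity under `B₀`, is determined by a linear system. -/
theorem exists_algHom_of_tensor [FiniteDimensional F A] (hw : (w : F) ≠ 0)
    (B₀ B₁ B₂ : A →ₗ[F] Matrix (Fin w) (Fin w) F)
    (h₀ : Function.Bijective B₀) (h₁ : Function.Bijective B₁) (h₂ : Function.Bijective B₂)
    (h : ∀ x y z, LinearMap.trace F A (LinearMap.mulLeft F (x * y * z))
      = (B₀ x * B₁ y * B₂ z).trace) :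
    ∃ φ : A →ₙₐ[F] Matrix (Fin w) (Fin w) F, Function.Bijective φ ∧
      ∀ M : Matrix (Fin w) (Fin w) F,
        (∀ x, (B₀ x * M).trace = LinearMap.trace F A (LinearMap.mulLeft F x)) →
        ∀ x, φ x = (w : F)⁻¹ • (B₀ x * M) := by
  obtain ⟨a, ha, hmul⟩ := exists_isUnit_mul_inv_mul
    ((LinearMap.trace F A).comp (LinearMap.mul F A)) B₀ B₁ B₂ h₀ h₁ h₂ h
  have had := (Matrix.isUnit_iff_isUnit_det _).1 ha
  let φ : A →ₙₐ[F] Matrix (Fin w) (Fin w) F :=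
    { toFun := fun x => B₀ x * a⁻¹
      map_smul' := fun c x => by rw [map_smul, Matrix.smul_mul]; rfl
      map_zero' := by rw [map_zero, Matrix.zero_mul]
      map_add' := fun x y => by rw [map_add, Matrix.add_mul]
      map_mul' := fun x y => by rw [← hmul]; simp only [Matrix.mul_assoc] }
  have hφ : Function.Bijective φ := by
    refine ⟨fun x y hxy => h₀.1 ?_, fun y => ?_⟩
    · have h3 : B₀ x * a⁻¹ = B₀ y * a⁻¹ := hxy
      have h4 := congrArg (· * a) h3
      simpa only [Matrix.mul_assoc, Matrix.nonsing_inv_mul _ had, Matrix.mul_one] using h4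
    · obtain ⟨x, hx⟩ := h₀.2 (y * a)
      refine ⟨x, ?_⟩
      change B₀ x * a⁻¹ = y
      rw [hx, Matrix.mul_assoc, Matrix.mul_nonsing_inv _ had, Matrix.mul_one]
  refine ⟨φ, hφ, fun M hM x => ?_⟩
  have hMa : M = (w : F) • a⁻¹ := by
    refine eq_of_trace_mul_eq fun z => ?_
    obtain ⟨z, rfl⟩ := h₀.2 z
    rw [hM, trace_mulLeft_eq_of_bijective φ hφ, Matrix.mul_smul, Matrix.trace_smul, smul_eq_mul]
    rfl
  rw [hMa, Matrix.mul_smul, smul_smul, inv_mul_cancel₀ hw, one_smul]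
  rfl

end RegularTrace

/-! ### Composing programs with growing bounds -/

section Reaches

variable {F : Type*} [Field F] {len : F → ℕ} {c V : ℕ} {O : Oracle F}

theorem State.Good.mono {V' : ℕ} {s : State F} (h : s.Good len V) (hV : V ≤ V') :
    s.Good len V' :=
  ⟨fun x => (h.nat x).trans hV, fun x => (h.fld x).trans hV, h.zero.trans hV, h.one.trans hV⟩

theorem Runs.mono_bound {V' : ℕ} {p : Prog} {s s' : State F} {n : ℕ}
    (h : Runs len c V O p s s' n) (hV : V ≤ V') : Runs len c V' O p s s' n := by
  obtain ⟨h1, t, h2, h3⟩ := h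
  exact ⟨h1.mono hV, t, h2, h3.trans (Nat.mul_le_mul_left _
    (Nat.pow_le_pow_left (Nat.add_le_add_right hV 2) _))⟩

/-- The growth in one stage of the exponent that bounds all numbers in the memory, when the oracle's
answers are bounded with exponent `q`. -/
def nextExp (c q e : ℕ) : ℕ := dotExp c e + solExp c e + invExp c e + (2 * e + 3) * q

theorem le_nextExp (c q e : ℕ) : e ≤ nextExp c q e := by
  have := le_dotExp c e
  unfold nextExp; omega

theorem le_nextExp_iterate (c q e k : ℕ) : e ≤ (nextExp c q)^[k] e := by
  induction k with
  | zero => exact le_rfl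
  | succ k ih =>
    rw [Function.iterate_succ_apply']
    exact ih.trans (le_nextExp _ _ _)

variable (len c O) in
/-- In `k` stages of polynomial length, in each of which the exponent of the bound for the memory
grows by `nextExp`, the program `p` leads from the state `s` to a state with property `Q`. -/
def Reaches (q P e₀ k : ℕ) (p : Prog) (s : State F) (Q : State F → Prop) : Prop :=
  ∀ e, e₀ ≤ e → s.Good len (P ^ e) → ∃ s', Runs len c (P ^ (nextExp c q)^[k] e) O p s s'
    (k * (P ^ (nextExp c q)^[k] e + 2) ^ 15) ∧ Q s'

variable {q P e₀ k : ℕ}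

theorem Reaches.seq {k' : ℕ} {p p' : Prog} {s : State F} {Q R : State F → Prop} (hP : 2 ≤ P)
    (h : Reaches len c O q P e₀ k p s Q)
    (h' : ∀ s', Q s' → Reaches len c O q P e₀ k' p' s' R) :
    Reaches len c O q P e₀ (k' + k) (.seq p p') s R := by
  intro e he hs
  obtain ⟨s₁, r₁, h₁⟩ := h e he hs
  obtain ⟨s₂, r₂, h₂⟩ := h' s₁ h₁ _ (he.trans (le_nextExp_iterate c q e k)) r₁.1
  refine ⟨s₂, ?_, h₂⟩
  rw [Function.iterate_add_apply]
  set e' := (nextExp c q)^[k] e with he'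
  have hle : P ^ e' ≤ P ^ (nextExp c q)^[k'] e' :=
    Nat.pow_le_pow_right (by omega) (le_nextExp_iterate _ _ _ _)
  refine ((r₁.mono_bound hle).seq r₂).mono ?_
  rw [add_mul, add_comm]
  exact Nat.add_le_add_left (Nat.mul_le_mul_left _
    (Nat.pow_le_pow_left (Nat.add_le_add_right hle 2) _)) _

/-- A program that runs within the bounds of a single stage. -/
theorem Reaches.of_runs {p : Prog} {s : State F} {Q : State F → Prop}
    (h : ∀ e, e₀ ≤ e → s.Good len (P ^ e) → ∃ s' V n, V ≤ P ^ nextExp c q e ∧ n ≤ (V + 2) ^ 15 ∧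
      Runs len c V O p s s' n ∧ Q s') : Reaches len c O q P e₀ 1 p s Q := by
  intro e he hs
  obtain ⟨s', V, n, hV, hn, hr, hQ⟩ := h e he hs
  refine ⟨s', (hr.mono_bound hV).mono ?_, hQ⟩
  rw [one_mul]
  exact hn.trans (Nat.pow_le_pow_left (Nat.add_le_add_right hV 2) _)

theorem Reaches.cond_true (hl : IsBitLength len c) (hP : 2 ≤ P) {b : BExp} {p p' : Prog}
    {s : State F} {Q : State F → Prop} (hb : b.Holds s) (h : Reaches len c O q P e₀ k p s Q) :
    Reaches len c O q P e₀ (k + 1) (.cond b p p') s Q := by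
  intro e he hs
  obtain ⟨s', r, hQ⟩ := h e he hs
  rw [Function.iterate_succ_apply']
  set e' := (nextExp c q)^[k] e with he'
  have hle : P ^ e' ≤ P ^ nextExp c q e' := Nat.pow_le_pow_right (by omega) (le_nextExp _ _ _)
  have hle' : P ^ e ≤ P ^ e' := Nat.pow_le_pow_right (by omega) (le_nextExp_iterate _ _ _ _)
  refine ⟨s', ((Runs.cond_true hl p' (hs.mono hle') hb r).mono_bound hle).mono ?_, hQ⟩
  rw [add_mul, one_mul]
  exact Nat.add_le_add (Nat.mul_le_mul_left _
    (Nat.pow_le_pow_left (Nat.add_le_add_right hle 2) _)) (Nat.one_le_pow _ _ (by omega))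

theorem Reaches.cond_false (hl : IsBitLength len c) (hP : 2 ≤ P) {b : BExp} {p p' : Prog}
    {s : State F} {Q : State F → Prop} (hb : ¬ b.Holds s) (h : Reaches len c O q P e₀ k p' s Q) :
    Reaches len c O q P e₀ (k + 1) (.cond b p p') s Q := by
  intro e he hs
  obtain ⟨s', r, hQ⟩ := h e he hs
  rw [Function.iterate_succ_apply']
  set e' := (nextExp c q)^[k] e with he'
  have hle : P ^ e' ≤ P ^ nextExp c q e' := Nat.pow_le_pow_right (by omega) (le_nextExp _ _ _)
  have hle' : P ^ e ≤ P ^ e' := Nat.pow_le_pow_right (by omega) (le_nextExp_iterate _ _ _ _)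
  refine ⟨s', ((Runs.cond_false hl p (hs.mono hle') hb r).mono_bound hle).mono ?_, hQ⟩
  rw [add_mul, one_mul]
  exact Nat.add_le_add (Nat.mul_le_mul_left _
    (Nat.pow_le_pow_left (Nat.add_le_add_right hle 2) _)) (Nat.one_le_pow _ _ (by omega))

theorem Reaches.mono {k' : ℕ} (hP : 2 ≤ P) {p : Prog} {s : State F} {Q : State F → Prop}
    (h : Reaches len c O q P e₀ k p s Q) (hk : k ≤ k') : Reaches len c O q P e₀ k' p s Q := by
  intro e he hs
  obtain ⟨s', r, hQ⟩ := h e he hs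
  obtain ⟨d, rfl⟩ := Nat.exists_eq_add_of_le' hk
  rw [Function.iterate_add_apply]
  have hle : P ^ (nextExp c q)^[k] e ≤ P ^ (nextExp c q)^[d] ((nextExp c q)^[k] e) :=
    Nat.pow_le_pow_right (by omega) (le_nextExp_iterate _ _ _ _)
  refine ⟨s', (r.mono_bound hle).mono (Nat.mul_le_mul hk
    (Nat.pow_le_pow_left (Nat.add_le_add_right hle 2) _)), hQ⟩

theorem Reaches.setNat (hP : 2 ≤ P) {s : State F} (a e : NExp) (he : e.eval s ≤ P ^ e₀) :
    Reaches len c O q P e₀ 1 (.setNat a e) s (· = s.setN (a.eval s) (e.eval s)) :=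
  Reaches.of_runs fun e' he' hs => ⟨_, P ^ e', 1, Nat.pow_le_pow_right (by omega) (le_nextExp _ _ _),
    Nat.one_le_pow _ _ (by omega),
    Runs.setNat hs a e (he.trans (Nat.pow_le_pow_right (by omega) he')), rfl⟩

theorem Reaches.setFld_one (hl : IsBitLength len c) (hP : 2 ≤ P) {s : State F} (a : NExp) :
    Reaches len c O q P e₀ 1 (.setFld a .one) s (· = s.setF (a.eval s) 1) :=
  Reaches.of_runs fun e' _ hs => ⟨_, P ^ e', 1, Nat.pow_le_pow_right (by omega) (le_nextExp _ _ _),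
    Nat.one_le_pow _ _ (by omega), Runs.setFld hl hs a .one hs.one, rfl⟩

theorem Reaches.setFld_inv (hl : IsBitLength len c) (hP : 2 ≤ P) {s : State F} (a b : NExp) :
    Reaches len c O q P e₀ 1 (.setFld a (.inv (.load b))) s
      (· = s.setF (a.eval s) (s.fld (b.eval s))⁻¹) :=
  Reaches.of_runs fun e' _ hs => ⟨_, P ^ nextExp c q e', 1, le_rfl, Nat.one_le_pow _ _ (by omega),
    Runs.setFld hl (hs.mono (Nat.pow_le_pow_right (by omega) (le_nextExp _ _ _))) a (.inv (.load b))
      ((hl.len_inv_le_pow hP hs.zero (hs.fld _)).trans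
        (Nat.pow_le_pow_right (by omega) (by unfold nextExp; omega))), rfl⟩

/-- Fill array `a` with sums of products of entries of the arrays `a₁` and `a₂`. -/
theorem Reaches.fill (hl : IsBitLength len c) (hP : 2 ≤ P)
    {b₁ b₂ b₃ b₄ a a₁ a₂ nl S N₁ N₂ N₃ N₄ n : ℕ} {o o₁ o₂ : NExp} {s : State F}
    (δ : ℕ → ℕ → ℕ → ℕ → ℕ) (ω₁ ω₂ : ℕ → ℕ → ℕ → ℕ → ℕ → ℕ) (hS : s.nat 4 = S)
    (hb₁ : s.nat b₁ = N₁) (hb₂ : s.nat b₂ = N₂) (hb₃ : s.nat b₃ = N₃) (hb₄ : s.nat b₄ = N₄)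
    (hnl : s.nat nl = n)
    (hsmall : (b₁ < 10 ∧ b₂ < 10 ∧ b₃ < 10 ∧ b₄ < 10 ∧ nl < 10 ∧ a ≠ 12) ∧
      a₁ ≠ a ∧ a₁ ≠ 12 ∧ a₂ ≠ a ∧ a₂ ≠ 12)
    (hδ : ∀ ν, AgreeN ν s.nat → o.ev ν = δ (ν 10) (ν 11) (ν 12) (ν 13))
    (hω₁ : ∀ ν, AgreeN ν s.nat → o₁.ev ν = ω₁ (ν 10) (ν 11) (ν 12) (ν 13) (ν 14))
    (hω₂ : ∀ ν, AgreeN ν s.nat → o₂.ev ν = ω₂ (ν 10) (ν 11) (ν 12) (ν 13) (ν 14))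
    (hlt : ∀ i < N₁, ∀ j < N₂, ∀ k < N₃, ∀ h < N₄, δ i j k h < S ∧
      ∀ l < n, ω₁ i j k h l < S ∧ ω₂ i j k h l < S)
    (hinj : ∀ i < N₁, ∀ j < N₂, ∀ k < N₃, ∀ h < N₄, ∀ i' < N₁, ∀ j' < N₂, ∀ k' < N₃, ∀ h' < N₄,
      δ i j k h = δ i' j' k' h' → i = i' ∧ j = j' ∧ k = k' ∧ h = h') :
    Reaches len c O q P e₀ 1
      (_root_.fill b₁ b₂ b₃ b₄ a o nl (.mul (.load (arr a₁ o₁)) (.load (arr a₂ o₂)))) s fun s' =>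
      AgreeN s'.nat s.nat ∧
      (∀ i < N₁, ∀ j < N₂, ∀ k < N₃, ∀ h < N₄, s'.fld (a * S + δ i j k h)
        = ∑ l ∈ Finset.range n, s.fld (a₁ * S + ω₁ i j k h l) * s.fld (a₂ * S + ω₂ i j k h l)) ∧
      ∀ b o', b ≠ 12 → o' < S →
        (b ≠ a ∨ ∀ i < N₁, ∀ j < N₂, ∀ k < N₃, ∀ h < N₄, o' ≠ δ i j k h) →
        s'.fld (b * S + o') = s.fld (b * S + o') := by
  refine Reaches.of_runs fun e _ hs => ?_
  obtain ⟨hsm, ha₁, ha₁', ha₂, ha₂'⟩ := hsmall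
  have hle : P ^ e ≤ P ^ nextExp c q e := Nat.pow_le_pow_right (by omega) (le_nextExp _ _ _)
  obtain ⟨s', h1, h2⟩ := Runs.fill (O := O) (V := P ^ nextExp c q e) (S := S) hl o
    (.mul (.load (arr a₁ o₁)) (.load (arr a₂ o₂))) δ
    (fun i j k h l => s.fld (a₁ * S + ω₁ i j k h l) * s.fld (a₂ * S + ω₂ i j k h l))
    (hs.mono hle) hS hb₁ hb₂ hb₃ hb₄ hnl hsm hδ
    (fun i hi j hj k hk h hh l hl' ν f hν hf e10 e11 e12 e13 e14 => by
      obtain ⟨l1, l2⟩ := (hlt i hi j hj k hk h hh).2 l hl'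
      simp only [FExp.ev, NExp.ev, hω₁ ν hν, hω₂ ν hν, hν 4 (by omega), hS, e10, e11, e12, e13, e14]
      rw [hf a₁ _ ha₁ ha₁' l1, hf a₂ _ ha₂ ha₂' l2])
    (fun i hi j hj k hk h hh => (hlt i hi j hj k hk h hh).1) hinj
    (fun i _ j _ k _ h _ n' hn' => by
      refine (hl.len_sum_mul_le_pow hP (e := e) ?_ hs.zero hs.one (fun l _ => hs.fld _)
        (fun l _ => hs.fld _)).trans (Nat.pow_le_pow_right (by omega) (by unfold nextExp; omega))
      rw [← hnl] at hn'
      exact hn'.trans (hs.nat nl))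
  exact ⟨s', _, _, le_rfl, Nat.pow_le_pow_right (by omega) (by norm_num), h1, h2⟩

theorem Reaches.elim (hl : IsBitLength len c) (hP : 2 ≤ P) {a cN r N S : ℕ} {s : State F}
    (hr : s.nat 1 = r) (hN : s.nat cN = N) (hS : s.nat 4 = S) (h6 : s.nat 6 = 1) (hrN : r * N ≤ S)
    (ha : a ≠ 12 ∧ a ≠ 13) (hc : cN < 10) (hV : 100 + r ≤ P ^ e₀) (hN0 : 0 < N)
    (X₀ : Matrix (Fin r) (Fin N) F)
    (hX₀ : ∀ (l : Fin r) (j : Fin N), s.fld (a * S + (l * N + j)) = X₀ l j) {L : ℕ}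
    (hL : ∀ v : Fin r → F, (∀ j : Fin N, (j : ℕ) < L → Matrix.vecMul v X₀ j = 0) → v = 0) :
    Reaches len c O q P e₀ 1 (_root_.elim a cN) s fun s' =>
      ∃ (X : Matrix (Fin r) (Fin N) F) (C : Matrix (Fin r) (Fin r) F) (p : Fin r → Fin N),
      IsPivoted X₀ X C p r ∧ (∀ l, (p l : ℕ) < L) ∧ (∀ x < 10, s'.nat x = s.nat x) ∧
      (∀ l : Fin r, s'.nat (100 + l) = p l) ∧
      (∀ (l : Fin r) (j : Fin N), s'.fld (a * S + (l * N + j)) = X l j) ∧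
      ∀ b o, b ≠ 12 → b ≠ 13 → b ≠ a → o < S → s'.fld (b * S + o) = s.fld (b * S + o) := by
  refine Reaches.of_runs fun e he hs => ?_
  have hle : P ^ e ≤ P ^ nextExp c q e := Nat.pow_le_pow_right (by omega) (le_nextExp _ _ _)
  have hle' : P ^ e₀ ≤ P ^ e := Nat.pow_le_pow_right (by omega) he
  obtain ⟨s', X, C, p, h1, h2⟩ := runs_elim (O := O) (V := P ^ nextExp c q e) hl (hs.mono hle) hr hN
    hS h6 hrN ha hc (by omega) hN0 X₀ hX₀
    (fun X C p k h l j => (h.len_le hl hP (e := e) (by omega) hs.zero hs.one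
      (fun i j => by rw [← hX₀]; exact hs.fld _) l j).trans
        (Nat.pow_le_pow_right (by omega) (by unfold nextExp; omega))) hL
  exact ⟨s', _, _, le_rfl, le_rfl, h1, X, C, p, h2⟩

theorem Reaches.query (hP : 2 ≤ P) {w : ℕ} {s : State F}
    (hO : PolyLength len q O) (hst : Standing F w 3) (cw src dst flag : NExp)
    (hw : cw.eval s = w) (hwP : w ≤ P ^ e₀) :
    Reaches len c O q P e₀ 1 (.query cw src dst flag) s
      (· = s.afterQuery O w (src.eval s) (dst.eval s) (flag.eval s)) := by
  refine Reaches.of_runs fun e he hs => ?_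
  have hle : P ^ e ≤ P ^ nextExp c q e := Nat.pow_le_pow_right (by omega) (le_nextExp _ _ _)
  have hle' : P ^ e₀ ≤ P ^ e := Nat.pow_le_pow_right (by omega) he
  have h1 : 1 ≤ P ^ nextExp c q e := Nat.one_le_pow _ _ (by omega)
  have hlenB : ∀ B, O w (readCoeffs s (src.eval s) (w * w)) = some B →
      ∀ k i j, len (B k i j) ≤ P ^ nextExp c q e := by
    intro B hB k i j
    refine (hO w hst _ (P ^ e) (fun i j k => hs.fld _) B hB k i j).trans ?_
    have p2 : 2 ≤ P ^ 1 := by rwa [pow_one]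
    refine (le_pow_mul (c := q) _ (add_le_pow _ hP (add_le_pow _ hP (hwP.trans hle')
      (le_refl (P ^ e)) le_rfl) p2 le_rfl) rfl).trans (Nat.pow_le_pow_right (by omega) ?_)
    have : e + e + 1 + 1 + 1 = 2 * e + 3 := by omega
    rw [this]; unfold nextExp; omega
  have hg := hs.mono hle
  refine ⟨_, P ^ nextExp c q e, 1, le_rfl, Nat.one_le_pow _ _ (by omega),
    Runs.query hg cw src dst flag (by omega) (by rw [hw]; exact hlenB) rfl ?_, by rw [hw]⟩
  rw [hw]
  unfold State.afterQuery
  split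
  · exact hg.setN _ (Nat.zero_le _)
  · rename_i B hB
    refine ⟨(hg.setN (flag.eval s) h1).nat, fun x => ?_, hg.zero, hg.one⟩
    simp only [writeMatrices]
    split
    · exact hlenB B hB _ _ _
    · exact hg.fld x

end Reaches

/-! ### Bases and structure constants -/

section Bases

variable {F : Type*} [Field F] {m r w : ℕ}

/-- The entries of a square matrix in row-major order. -/
def flat (y : Matrix (Fin m) (Fin m) F) (j : Fin (m * m)) : F :=
  y (finProdFinEquiv.symm j).1 (finProdFinEquiv.symm j).2

theorem IsPivoted.injective {n N : ℕ} {X₀ X : Matrix (Fin n) (Fin N) F}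
    {C : Matrix (Fin n) (Fin n) F} {p : Fin n → Fin N} (h : IsPivoted X₀ X C p n) :
    Function.Injective p := by
  intro i j hij
  have h1 := h.apply_pivot i i i.2
  rw [hij, h.apply_pivot i j j.2, Matrix.one_apply_eq] at h1
  by_contra hne
  rw [Matrix.one_apply_ne hne] at h1
  exact zero_ne_one h1

/-- A solution of a linear system can be read off from the reduced augmented matrix. -/
theorem IsPivoted.sum_mul_eq {n : ℕ} {X₀ X : Matrix (Fin n) (Fin (n + 1)) F}
    {C : Matrix (Fin n) (Fin n) F} {p : Fin n → Fin (n + 1)} (h : IsPivoted X₀ X C p n)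
    (hp : ∀ l, (p l : ℕ) < n) {μ : Fin n → F} (hμ : ∀ l, μ ⟨p l, hp l⟩ = X l (Fin.last n))
    (i : Fin n) : ∑ j, X₀ i (Fin.castSucc j) * μ j = X₀ i (Fin.last n) := by
  have hinj : Function.Injective fun l : Fin n => (⟨p l, hp l⟩ : Fin n) := fun a b hab =>
    h.injective (Fin.ext (by simpa using hab))
  rw [← (Equiv.ofBijective _ (Finite.injective_iff_bijective.1 hinj)).sum_comp]
  simp only [Equiv.ofBijective_apply, hμ]
  rw [← h.mul, Matrix.mul_apply]
  refine Finset.sum_congr rfl fun l _ => ?_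
  rw [h.mul, h.col i l, if_pos l.2]
  rfl

variable {A : NonUnitalSubalgebra F (Matrix (Fin m) (Fin m) F)}

/-- The rows of the reduced matrix form a basis in which coordinates are entries at the pivots. -/
theorem IsPivoted.exists_basis (E : Module.Basis (Fin r) F A)
    {X : Matrix (Fin r) (Fin (m * m)) F} {C : Matrix (Fin r) (Fin r) F} {p : Fin r → Fin (m * m)}
    (h : IsPivoted (Matrix.of fun i => flat (E i : Matrix (Fin m) (Fin m) F)) X C p r) :
    ∃ E' : Module.Basis (Fin r) F A,
      (∀ l j, flat (E' l : Matrix (Fin m) (Fin m) F) j = X l j) ∧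
      ∀ (y : A) i, E'.repr y i = flat (y : Matrix (Fin m) (Fin m) F) (p i) := by
  have hu : IsUnit C.det := h.det.isUnit
  have hX : ∀ l j, X l j = ∑ a, C⁻¹ l a * flat (E a : Matrix (Fin m) (Fin m) F) j := by
    intro l j
    have h1 : C⁻¹ * (Matrix.of fun i => flat (E i : Matrix (Fin m) (Fin m) F)) = X := by
      rw [← h.mul, ← Matrix.mul_assoc, Matrix.nonsing_inv_mul _ hu, Matrix.one_mul]
    rw [← h1, Matrix.mul_apply]; rfl
  have hsum : ∀ (v : Fin r → F) (e : Fin r → A) (j : Fin (m * m)),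
      flat ((∑ a, v a • e a : A) : Matrix (Fin m) (Fin m) F) j
        = ∑ a, v a * flat (e a : Matrix (Fin m) (Fin m) F) j := by
    intro v e j
    have : ((∑ a, v a • e a : A) : Matrix (Fin m) (Fin m) F)
        = ∑ a, v a • (e a : Matrix (Fin m) (Fin m) F) := by
      exact map_sum (NonUnitalSubalgebraClass.subtype A) _ _
    simp only [flat, this, Matrix.sum_apply, Matrix.smul_apply, smul_eq_mul]
  set e' : Fin r → A := fun l => ∑ a, C⁻¹ l a • E a with he'
  have hflat : ∀ l j, flat (e' l : Matrix (Fin m) (Fin m) F) j = X l j := fun l j => by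
    rw [he', hX]; exact hsum _ _ _
  have hcoord : ∀ (v : Fin r → F) i,
      flat ((∑ a, v a • e' a : A) : Matrix (Fin m) (Fin m) F) (p i) = v i := by
    intro v i
    rw [hsum]
    simp only [hflat, h.apply_pivot _ i i.2, Matrix.one_apply, mul_ite, mul_one, mul_zero,
      Finset.sum_ite_eq', Finset.mem_univ, if_true]
  have hli : LinearIndependent F e' := Fintype.linearIndependent_iff.2 fun v hv i => by
    rw [← hcoord v i, hv]; rfl
  have hcard : Fintype.card (Fin r) = Module.finrank F A := (Module.finrank_eq_card_basis E).symm
  rcases Nat.eq_zero_or_pos r with rfl | hr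
  · exact ⟨E, fun l => l.elim0, fun _ i => i.elim0⟩
  · have : Nonempty (Fin r) := ⟨⟨0, hr⟩⟩
    set E' := basisOfLinearIndependentOfCardEqFinrank hli hcard with hE'
    have hEe : ∀ l, E' l = e' l := fun l => by
      rw [hE', coe_basisOfLinearIndependentOfCardEqFinrank]
    refine ⟨E', fun l j => by rw [hEe, hflat], fun y i => ?_⟩
    conv_rhs => rw [← E'.sum_repr y]
    simp only [hEe, hcoord]

theorem flat_mul (x y : Matrix (Fin m) (Fin m) F) (a b : Fin m) :
    flat (x * y) (finProdFinEquiv (a, b))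
      = ∑ l, flat x (finProdFinEquiv (a, l)) * flat y (finProdFinEquiv (l, b)) := by
  simp [flat, Matrix.mul_apply]

/-- The trace of the left multiplication by `x`. -/
noncomputable def regTrace (A : NonUnitalSubalgebra F (Matrix (Fin m) (Fin m) F)) : A →ₗ[F] F :=
  (LinearMap.trace F A).comp (LinearMap.mul F A)

theorem regTrace_apply (x : A) :
    regTrace A x = LinearMap.trace F A (LinearMap.mulLeft F x) := rfl

theorem regTrace_basis (E : Module.Basis (Fin r) F A) (x : A) :
    regTrace A x = ∑ l, E.repr (x * E l) l := by
  rw [regTrace_apply, LinearMap.trace_eq_matrix_trace F E, Matrix.trace]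
  simp [LinearMap.toMatrix_apply]

theorem regTrace_eq_sum (E : Module.Basis (Fin r) F A) (x : A) :
    regTrace A x = ∑ l, E.repr x l * regTrace A (E l) := by
  conv_lhs => rw [← E.sum_repr x, map_sum]
  exact Finset.sum_congr rfl fun l _ => map_smul _ _ _

theorem regTrace_mul_eq_sum (E : Module.Basis (Fin r) F A) (x y : A) :
    regTrace A (x * y) = ∑ l, E.repr x l * regTrace A (E l * y) := by
  conv_lhs => rw [← E.sum_repr x, Finset.sum_mul, map_sum]
  exact Finset.sum_congr rfl fun l _ => by rw [smul_mul_assoc, map_smul, smul_eq_mul]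

/-- The tensor of the regular trace with respect to a basis. -/
noncomputable def regTensor (E : Module.Basis (Fin r) F A) : Coeffs F r :=
  fun i j k => regTrace A (E i * E j * E k)

/-- The tensor of the regular trace of a matrix algebra is matrix multiplication, because the regular
trace is `w` times the trace; the factor `w` is put into the first of the three matrices. -/
theorem exists_isTensorIso (E : Module.Basis (Fin (w * w)) F A) (hw : (w : F) ≠ 0)
    (φ : A →ₙₐ[F] Matrix (Fin w) (Fin w) F) (hφ : Function.Bijective φ) :
    ∃ B, IsTensorIso w (regTensor E) B := by
  have key : ∀ d : F, d ≠ 0 → IsUnit (Matrix.of fun (v i : Fin (w * w)) =>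
      d * φ (E i) (finProdFinEquiv.symm v).1 (finProdFinEquiv.symm v).2) := by
    intro d hd
    rw [← Matrix.mulVec_injective_iff_isUnit]
    refine (injective_iff_map_eq_zero (Matrix.mulVecLin _)).2 fun v hv => ?_
    have h1 : φ (∑ i, v i • E i) = 0 := by
      ext a b
      have h2 := congrFun hv (finProdFinEquiv (a, b))
      simp only [Matrix.mulVecLin_apply, Matrix.mulVec, dotProduct, Matrix.of_apply,
        Equiv.symm_apply_apply, mul_assoc, ← Finset.mul_sum, Pi.zero_apply, mul_eq_zero, hd,
        false_or] at h2
      rw [map_sum, Matrix.sum_apply, Matrix.zero_apply, ← h2]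
      exact Finset.sum_congr rfl fun i _ => by rw [map_smul, Matrix.smul_apply, smul_eq_mul, mul_comm]
    have h3 : ∑ i, v i • E i = 0 := hφ.1 (by rw [h1, map_zero])
    funext i
    exact Fintype.linearIndependent_iff.1 E.linearIndependent v h3 i
  have hform : ∀ (d : F) (i : Fin (w * w)), formMatrix (Matrix.of fun (v i : Fin (w * w)) =>
      d * φ (E i) (finProdFinEquiv.symm v).1 (finProdFinEquiv.symm v).2) i = d • φ (E i) := by
    intro d i
    ext a b
    rw [formMatrix, Matrix.of_apply, Matrix.of_apply, Equiv.symm_apply_apply]; rfl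
  refine ⟨fun k => Matrix.of fun v i =>
    (if k = 0 then (w : F) else 1) * φ (E i) (finProdFinEquiv.symm v).1 (finProdFinEquiv.symm v).2,
    isTensorIso_iff.2 ⟨fun k => key _ (by split <;> simp [hw]), fun i j k => ?_⟩⟩
  simp only [hform]
  rw [regTensor, regTrace_apply, trace_mulLeft_eq_of_bijective φ hφ, map_mul, map_mul]
  simp

/-- The statement of `exists_algHom_of_tensor` in coordinates: only the matrix `B 0` of the answer and
a solution `M` of a linear system are needed to write down the isomorphism. -/
theorem exists_algHom_of_isTensorIso (E : Module.Basis (Fin (w * w)) F A) (hw : (w : F) ≠ 0)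
    {B : Fin 3 → Matrix (Fin (w * w)) (Fin (w * w)) F} (hB : IsTensorIso w (regTensor E) B) :
    ∃ φ : A →ₙₐ[F] Matrix (Fin w) (Fin w) F, Function.Bijective φ ∧
      ∀ M : Matrix (Fin w) (Fin w) F,
        (∀ i, (formMatrix (B 0) i * M).trace = regTrace A (E i)) →
        ∀ x, φ x = (w : F)⁻¹ • ((∑ i, E.repr x i • formMatrix (B 0) i) * M) := by
  obtain ⟨hunit, ht⟩ := isTensorIso_iff.1 hB
  have : FiniteDimensional F A := E.finiteDimensional_of_finite
  set f : Fin 3 → A →ₗ[F] Matrix (Fin w) (Fin w) F := fun k => E.constr F (formMatrix (B k)) with hf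
  have hfE : ∀ k i, f k (E i) = formMatrix (B k) i := fun k i => E.constr_basis F _ i
  have hfx : ∀ k x, f k x = ∑ i, E.repr x i • formMatrix (B k) i := fun k x =>
    E.constr_apply_fintype F _ x
  have hbij : ∀ k, Function.Bijective (f k) := by
    intro k
    have hinj : Function.Injective (f k) := by
      refine (injective_iff_map_eq_zero (f k)).2 fun x hx => ?_
      have h1 : (B k).mulVec (E.repr x) = 0 := by
        funext v
        obtain ⟨⟨a, b⟩, rfl⟩ := finProdFinEquiv.surjective v
        have h2 := congrFun (congrFun hx a) b
        rw [hfx, Matrix.sum_apply] at h2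
        refine Eq.trans ?_ h2
        rw [Matrix.mulVec, dotProduct]
        exact Finset.sum_congr rfl fun i _ => by
          rw [Matrix.smul_apply, smul_eq_mul, mul_comm]; rfl
      have h3 : (E.repr x : Fin (w * w) → F) = 0 :=
        (Matrix.mulVec_injective_iff_isUnit.2 (hunit k)) (by rw [h1, Matrix.mulVec_zero])
      exact E.repr.map_eq_zero_iff.1 (DFunLike.coe_injective h3)
    refine ⟨hinj, (LinearMap.injective_iff_surjective_of_finrank_eq_finrank ?_).1 hinj⟩
    rw [Module.finrank_eq_card_basis E, Module.finrank_matrix]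
    simp
  have hind : ∀ Q : A → Prop, (∀ i, Q (E i)) → Q 0 → (∀ x y, Q x → Q y → Q (x + y)) →
      (∀ (d : F) x, Q x → Q (d • x)) → ∀ x, Q x := by
    intro Q h1 h2 h3 h4 x
    refine Submodule.span_induction (p := fun x _ => Q x) ?_ h2 (fun x y _ _ => h3 x y)
      (fun d x _ => h4 d x) (E.mem_span x)
    rintro _ ⟨i, rfl⟩; exact h1 i
  have htri : ∀ x y z, regTrace A (x * y * z) = (f 0 x * f 1 y * f 2 z).trace := by
    refine hind _ (fun i => hind _ (fun j => hind _ (fun k => ?_) ?_ ?_ ?_) ?_ ?_ ?_) ?_ ?_ ?_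
    · rw [hfE, hfE, hfE, ← ht]; rfl
    · simp
    · intro x y hx hy; simp only [mul_add, map_add, Matrix.trace_add, hx, hy]
    · intro d x hx; simp only [mul_smul_comm, map_smul, Matrix.trace_smul, hx]
    · simp
    · intro x y hx hy z; simp only [mul_add, add_mul, map_add, Matrix.trace_add, hx, hy]
    · intro d x hx z
      simp only [mul_smul_comm, smul_mul_assoc, map_smul, Matrix.trace_smul, hx]
    · simp
    · intro x y hx hy y' z; simp only [add_mul, map_add, Matrix.trace_add, hx, hy]
    · intro d x hx y z; simp only [smul_mul_assoc, map_smul, Matrix.trace_smul, hx]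
  obtain ⟨φ, hφ, hM⟩ := exists_algHom_of_tensor hw (f 0) (f 1) (f 2) (hbij 0) (hbij 1) (hbij 2)
    htri
  refine ⟨φ, hφ, fun M hM' x => ?_⟩
  rw [hM M ?_ x, hfx]
  refine hind _ (fun i => by rw [hfE]; exact hM' i) ?_ ?_ ?_
  · rw [← regTrace_apply]; simp
  · intro x y hx hy
    rw [← regTrace_apply] at *
    rw [map_add, map_add, add_mul, Matrix.trace_add, hx, hy]
  · intro d x hx
    rw [← regTrace_apply] at *
    rw [map_smul, map_smul, smul_mul_assoc, Matrix.trace_smul, hx]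

end Bases

/-! ### Computing the tensor of the regular trace -/

/-- The contents of the fixed addresses: the size `m` of the matrices, the dimension `r`, its square
root `w`, and derived bounds for the loops. -/
structure Layout (m r w S : ℕ) (ν : ℕ → ℕ) : Prop where
  size : ν 0 = m
  dim : ν 1 = r
  width : ν 2 = w
  sq : ν 3 = m * m
  stride : ν 4 = S
  dim_succ : ν 5 = r + 1
  one : ν 6 = 1
  input : ν 7 = r * (m * m)

theorem Layout.congr {m r w S : ℕ} {ν ν' : ℕ → ℕ} (h : Layout m r w S ν)
    (h' : ∀ x < 10, ν' x = ν x) : Layout m r w S ν' :=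
  ⟨(h' 0 (by norm_num)).trans h.size, (h' 1 (by norm_num)).trans h.dim,
    (h' 2 (by norm_num)).trans h.width, (h' 3 (by norm_num)).trans h.sq,
    (h' 4 (by norm_num)).trans h.stride, (h' 5 (by norm_num)).trans h.dim_succ,
    (h' 6 (by norm_num)).trans h.one, (h' 7 (by norm_num)).trans h.input⟩

theorem Layout.agree {m r w S : ℕ} {ν ν' : ℕ → ℕ} (h : Layout m r w S ν) (h' : AgreeN ν' ν) :
    Layout m r w S ν' := h.congr fun x hx => h' x (Or.inl hx)

/-- The arrays are long enough. -/
structure Room (m r S : ℕ) : Prop where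
  dim : r ≤ S
  input : r * (m * m) ≤ S
  products : r * r * (m * m) ≤ S
  tensor : r * r * r ≤ S
  square : r * r ≤ S
  augmented : r * (r + 1) ≤ S
  answer : 3 * (r * r) ≤ S
  pos : 0 < S

theorem room {m r : ℕ} (hr : r ≤ m * m) : Room m r ((m + 2) ^ 6) := by
  have h1 : m * m ≤ (m + 2) ^ 2 := by nlinarith
  have h2 : r ≤ (m + 2) ^ 2 := hr.trans h1
  have h4 : 4 ≤ (m + 2) ^ 2 := by nlinarith
  have e : (m + 2) ^ 6 = (m + 2) ^ 2 * (m + 2) ^ 2 * (m + 2) ^ 2 := by ring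
  rw [e]
  generalize (m + 2) ^ 2 = q at h1 h2 h4
  have h5 : q * 1 ≤ q * q := Nat.mul_le_mul_left _ (by omega)
  have h6 : q * q * 4 ≤ q * q * q := Nat.mul_le_mul_left _ h4
  have h7 : r * (m * m) ≤ q * q := Nat.mul_le_mul h2 h1
  have h8 : r * r ≤ q * q := Nat.mul_le_mul h2 h2
  refine ⟨by omega, by omega, ?_, ?_, by omega, by rw [mul_add]; omega, by omega, by omega⟩
  · exact Nat.mul_le_mul h8 h1
  · exact Nat.mul_le_mul h8 h2

/-- The constant `1`, which is the entry of array `14`. -/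
abbrev oneEntry : FExp := .load (arr 14 (.const 0))

/-- Row-major offsets. -/
abbrev off (x n y : NExp) : NExp := .add (.mul x n) y

/-- Compute a reduced basis `E'` (array `1`) from the input (array `0`), the coordinates of the input
in this basis (array `2`), the structure constants of the algebra (array `4`), the values of the
regular trace at the basis (array `5`) and at its products (array `6`), and its tensor (array `7`). -/
def tensorProg : Prog :=
  .seq (fill 7 6 6 6 1 (cell 10) 6 (.mul (.load (arr 0 (cell 10))) oneEntry)) <|
  .seq (elim 1 3) <|
  .seq (fill 1 1 6 6 2 (off (cell 10) (cell 1) (cell 11)) 6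
    (.mul (.load (arr 0 (off (cell 10) (cell 3) (.load (.add (.const 100) (cell 11))))))
      oneEntry)) <|
  .seq (fill 1 1 0 0 3
    (off (off (cell 10) (cell 1) (cell 11)) (cell 3) (off (cell 12) (cell 0) (cell 13))) 0
    (.mul (.load (arr 1 (off (cell 10) (cell 3) (off (cell 12) (cell 0) (cell 14)))))
      (.load (arr 1 (off (cell 11) (cell 3) (off (cell 14) (cell 0) (cell 13))))))) <|
  .seq (fill 1 1 1 6 4 (off (off (cell 10) (cell 1) (cell 11)) (cell 1) (cell 12)) 6
    (.mul (.load (arr 3 (off (off (cell 10) (cell 1) (cell 11)) (cell 3)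
      (.load (.add (.const 100) (cell 12)))))) oneEntry)) <|
  .seq (fill 1 6 6 6 5 (cell 10) 1
    (.mul (.load (arr 4 (off (off (cell 10) (cell 1) (cell 14)) (cell 1) (cell 14)))) oneEntry)) <|
  .seq (fill 1 1 6 6 6 (off (cell 10) (cell 1) (cell 11)) 1
    (.mul (.load (arr 4 (off (off (cell 10) (cell 1) (cell 11)) (cell 1) (cell 14))))
      (.load (arr 5 (cell 14)))))
  (fill 1 1 1 6 7 (off (off (cell 10) (cell 1) (cell 11)) (cell 1) (cell 12)) 1
    (.mul (.load (arr 4 (off (off (cell 10) (cell 1) (cell 11)) (cell 1) (cell 14))))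
      (.load (arr 6 (off (cell 14) (cell 1) (cell 12))))))

section TensorProg

variable {F : Type*} [Field F] {len : F → ℕ} {c q P e₀ k : ℕ} {O : Oracle F} {m r w S : ℕ}

theorem Reaches.imp {p : Prog} {s : State F} {Q R : State F → Prop}
    (h : Reaches len c O q P e₀ k p s Q) (hQ : ∀ s', Q s' → R s') :
    Reaches len c O q P e₀ k p s R := fun e he hs => by
  obtain ⟨s', h1, h2⟩ := h e he hs
  exact ⟨s', h1, hQ s' h2⟩

variable {A : NonUnitalSubalgebra F (Matrix (Fin m) (Fin m) F)}

/-- What `tensorProg` computes: the coordinates of the input in a basis `E'`, the regular trace on `E'`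
and its tensor. -/
theorem reaches_tensorProg (hl : IsBitLength len c) (hP : 2 ≤ P) (hV : 100 + r ≤ P ^ e₀)
    (hm : 0 < m) (hR : Room m r S) (E : Module.Basis (Fin r) F A) {s : State F}
    (L : Layout m r w S s.nat)
    (hE : ∀ (l : Fin r) (j : Fin (m * m)),
      s.fld (0 * S + (l * (m * m) + j)) = flat (E l : Matrix (Fin m) (Fin m) F) j)
    (hone : s.fld (14 * S + 0) = 1) :
    Reaches len c O q P e₀ 8 tensorProg s fun s' => Layout m r w S s'.nat ∧
      s'.fld (14 * S + 0) = 1 ∧ ∃ E' : Module.Basis (Fin r) F A,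
        (∀ i j : Fin r, s'.fld (2 * S + (i * r + j)) = E'.repr (E i) j) ∧
        (∀ i : Fin r, s'.fld (5 * S + i) = regTrace A (E' i)) ∧
        ∀ i j k : Fin r, s'.fld (7 * S + ((i * r + j) * r + k)) = regTensor E' i j k := by
  have hmm : 0 < m * m := Nat.mul_pos hm hm
  have hS0 := hR.pos
  have lt1 : ∀ {i}, i < r → i < S := fun h => h.trans_le hR.dim
  have lt2 : ∀ {i j}, i < r → j < r → i * r + j < S := fun h h' => (mul_add_lt h h').trans_le hR.square
  have lt3 : ∀ {i j k}, i < r → j < r → k < r → (i * r + j) * r + k < S := fun h h' h'' =>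
    (mul_add_lt (mul_add_lt h h') h'').trans_le hR.tensor
  have ltE : ∀ {i j}, i < r → j < m * m → i * (m * m) + j < S := fun h h' =>
    (mul_add_lt h h').trans_le hR.input
  have ltP : ∀ {i j k}, i < r → j < r → k < m * m → (i * r + j) * (m * m) + k < S :=
    fun h h' h'' => (mul_add_lt (mul_add_lt h h') h'').trans_le hR.products
  -- copy the input
  refine Reaches.seq (k := 1) (k' := 7) hP (Reaches.fill hl hP (S := S) (fun i _ _ _ => i)
    (fun i _ _ _ _ => i) (fun _ _ _ _ _ => 0) L.stride L.input L.one L.one L.one L.one (by norm_num)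
    (fun _ _ => rfl) (fun _ _ => rfl) (fun _ _ => rfl)
    (fun i hi _ _ _ _ _ _ => ⟨hi.trans_le hR.input, fun _ _ => ⟨hi.trans_le hR.input, hS0⟩⟩)
    (fun i _ _ _ _ _ _ _ _ _ _ _ _ _ _ _ _ => by omega)) ?_
  rintro s₁ ⟨a₁, v₁, o₁⟩
  replace L := L.agree a₁
  have hX : ∀ (l : Fin r) (j : Fin (m * m)), s₁.fld (1 * S + (l * (m * m) + j))
      = (Matrix.of fun i => flat (E i : Matrix (Fin m) (Fin m) F)) l j := by
    intro l j
    rw [v₁ _ (mul_add_lt l.2 j.2) 0 one_pos 0 one_pos 0 one_pos, Finset.sum_range_one, hone, mul_one,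
      hE]
    rfl
  have keep : ∀ b o, b ≠ 12 → b ≠ 1 → o < S → s₁.fld (b * S + o) = s.fld (b * S + o) :=
    fun b o h h' ho => o₁ b o h ho (Or.inl h')
  replace hone : s₁.fld (14 * S + 0) = 1 := by rw [keep 14 0 (by norm_num) (by norm_num) hS0, hone]
  replace hE : ∀ (l : Fin r) (j : Fin (m * m)),
      s₁.fld (0 * S + (l * (m * m) + j)) = flat (E l : Matrix (Fin m) (Fin m) F) j := fun l j => by
    rw [keep 0 _ (by norm_num) (by norm_num) (ltE l.2 j.2), hE]
  clear v₁ o₁ keep a₁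
  -- the reduced basis
  refine Reaches.seq (k := 1) (k' := 6) hP (Reaches.elim hl hP (S := S) L.dim L.sq L.stride L.one
    hR.input (by norm_num) (by norm_num) hV hmm _ hX (L := m * m) (fun v hv => ?_)) ?_
  · have h0 : ∑ a, v a • E a = 0 := by
      have h1 : ((∑ a, v a • E a : A) : Matrix (Fin m) (Fin m) F)
          = ∑ a, v a • (E a : Matrix (Fin m) (Fin m) F) :=
        map_sum (NonUnitalSubalgebraClass.subtype A) _ _
      refine Subtype.ext ?_
      rw [h1]
      ext a b
      have h2 := hv (finProdFinEquiv (a, b)) (Fin.is_lt _)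
      rw [Matrix.sum_apply]
      refine Eq.trans (Finset.sum_congr rfl fun i _ => ?_) h2
      simp only [Matrix.of_apply, flat, Equiv.symm_apply_apply]
      rfl
    funext i
    exact Fintype.linearIndependent_iff.1 E.linearIndependent v h0 i
  rintro s₂ ⟨X, C, p, hpiv, -, hlow, hp, hX₂, o₂⟩
  obtain ⟨E', hE', hrepr⟩ := hpiv.exists_basis E
  replace L := L.congr hlow
  replace hone : s₂.fld (14 * S + 0) = 1 := by
    rw [o₂ 14 0 (by norm_num) (by norm_num) (by norm_num) hS0, hone]
  replace hE : ∀ (l : Fin r) (j : Fin (m * m)),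
      s₂.fld (0 * S + (l * (m * m) + j)) = flat (E l : Matrix (Fin m) (Fin m) F) j := fun l j => by
    rw [o₂ 0 _ (by norm_num) (by norm_num) (by norm_num) (ltE l.2 j.2), hE]
  simp only [← hE'] at hX₂
  have hpl : ∀ j (hj : j < r), s₂.nat (100 + j) = p ⟨j, hj⟩ := fun j hj => hp ⟨j, hj⟩
  have hpl' : ∀ j, j < r → s₂.nat (100 + j) < m * m := fun j hj => by
    rw [hpl j hj]; exact Fin.is_lt _
  clear hX hE' o₂ hlow
  -- the coordinates of the input
  refine Reaches.seq (k := 1) (k' := 5) hP (Reaches.fill hl hP (S := S) (fun i j _ _ => i * r + j)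
    (fun i j _ _ _ => i * (m * m) + s₂.nat (100 + j)) (fun _ _ _ _ _ => 0) L.stride L.dim L.dim L.one
    L.one L.one (by norm_num)
    (fun ν hν => by simp only [NExp.ev, (L.agree hν).dim])
    (fun ν hν => by simp only [NExp.ev, (L.agree hν).sq]; rw [hν (100 + ν 11) (by omega)])
    (fun _ _ => rfl)
    (fun i hi j hj _ _ _ _ => ⟨lt2 hi hj, fun _ _ => ⟨ltE hi (hpl' j hj), hS0⟩⟩)
    (fun i _ j hj _ _ _ _ i' _ j' hj' _ _ _ _ h => by
      have := mul_add_inj hj hj' h; omega)) ?_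
  rintro s₃ ⟨a₃, v₃, o₃⟩
  have keep : ∀ b o, b ≠ 12 → b ≠ 2 → o < S → s₃.fld (b * S + o) = s₂.fld (b * S + o) :=
    fun b o h h' ho => o₃ b o h ho (Or.inl h')
  have hC : ∀ i j : Fin r, s₃.fld (2 * S + (i * r + j)) = E'.repr (E i) j := fun i j => by
    rw [v₃ i i.2 j j.2 0 one_pos 0 one_pos, Finset.sum_range_one, hone, mul_one, hpl j j.2, hE, hrepr]
  replace L := L.agree a₃
  replace hone : s₃.fld (14 * S + 0) = 1 := by rw [keep 14 0 (by norm_num) (by norm_num) hS0, hone]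
  have hX₃ : ∀ (l : Fin r) (j : Fin (m * m)), s₃.fld (1 * S + (l * (m * m) + j))
      = flat (E' l : Matrix (Fin m) (Fin m) F) j := fun l j => by
    rw [keep 1 _ (by norm_num) (by norm_num) (ltE l.2 j.2), hX₂]
  have hpl₃ : ∀ j (hj : j < r), s₃.nat (100 + j) = p ⟨j, hj⟩ := fun j hj => by
    rw [a₃ _ (by omega), hpl j hj]
  clear hX₂ hE v₃ o₃ keep a₃ hpl hpl' hp
  -- the products of the basis
  refine Reaches.seq (k := 1) (k' := 4) hP (Reaches.fill hl hP (S := S)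
    (fun i j k h => (i * r + j) * (m * m) + (k * m + h))
    (fun i _ k _ l => i * (m * m) + (k * m + l)) (fun _ j _ h l => j * (m * m) + (l * m + h))
    L.stride L.dim L.dim L.size L.size L.size (by norm_num)
    (fun ν hν => by simp only [NExp.ev, (L.agree hν).dim, (L.agree hν).sq, (L.agree hν).size])
    (fun ν hν => by simp only [NExp.ev, (L.agree hν).sq, (L.agree hν).size])
    (fun ν hν => by simp only [NExp.ev, (L.agree hν).sq, (L.agree hν).size])
    (fun i hi j hj k hk h hh => ⟨ltP hi hj (mul_add_lt hk hh),
      fun l hl => ⟨ltE hi (mul_add_lt hk hl), ltE hj (mul_add_lt hl hh)⟩⟩)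
    (fun i _ j hj k hk h hh i' _ j' hj' k' hk' h' hh' heq => by
      obtain ⟨h1, h2⟩ := mul_add_inj (mul_add_lt hk hh) (mul_add_lt hk' hh') heq
      have h3 := mul_add_inj hj hj' h1
      have h4 := mul_add_inj hh hh' h2
      omega)) ?_
  rintro s₄ ⟨a₄, v₄, o₄⟩
  have keep : ∀ b o, b ≠ 12 → b ≠ 3 → o < S → s₄.fld (b * S + o) = s₃.fld (b * S + o) :=
    fun b o h h' ho => o₄ b o h ho (Or.inl h')
  have hprod : ∀ (i j : Fin r) (x : Fin (m * m)), s₄.fld (3 * S + ((i * r + j) * (m * m) + x))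
      = flat ((E' i * E' j : A) : Matrix (Fin m) (Fin m) F) x := by
    intro i j x
    obtain ⟨⟨a, b⟩, rfl⟩ := finProdFinEquiv.surjective x
    have hv : ∀ a b : Fin m, (finProdFinEquiv (a, b) : ℕ) = a * m + b := fun a b => by
      rw [finProdFinEquiv_apply_val, add_comm, mul_comm]
    have hcoe : ((E' i * E' j : A) : Matrix (Fin m) (Fin m) F)
        = (E' i : Matrix (Fin m) (Fin m) F) * (E' j : Matrix (Fin m) (Fin m) F) := rfl
    rw [hv, v₄ i i.2 j j.2 a a.2 b b.2, hcoe, flat_mul, Finset.sum_range]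
    refine Finset.sum_congr rfl fun l _ => ?_
    rw [← hX₃, ← hX₃, hv, hv]
  replace L := L.agree a₄
  replace hone : s₄.fld (14 * S + 0) = 1 := by rw [keep 14 0 (by norm_num) (by norm_num) hS0, hone]
  replace hC : ∀ i j : Fin r, s₄.fld (2 * S + (i * r + j)) = E'.repr (E i) j := fun i j => by
    rw [keep 2 _ (by norm_num) (by norm_num) (lt2 i.2 j.2), hC]
  have hpl₄ : ∀ j (hj : j < r), s₄.nat (100 + j) = p ⟨j, hj⟩ := fun j hj => by
    rw [a₄ _ (by omega), hpl₃ j hj]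
  clear hX₃ v₄ o₄ keep a₄ hpl₃
  -- the structure constants
  refine Reaches.seq (k := 1) (k' := 3) hP (Reaches.fill hl hP (S := S)
    (fun i j k _ => (i * r + j) * r + k)
    (fun i j k _ _ => (i * r + j) * (m * m) + s₄.nat (100 + k)) (fun _ _ _ _ _ => 0)
    L.stride L.dim L.dim L.dim L.one L.one (by norm_num)
    (fun ν hν => by simp only [NExp.ev, (L.agree hν).dim])
    (fun ν hν => by
      simp only [NExp.ev, (L.agree hν).sq, (L.agree hν).dim]; rw [hν (100 + ν 12) (by omega)])
    (fun _ _ => rfl)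
    (fun i hi j hj k hk _ _ => ⟨lt3 hi hj hk, fun _ _ => ⟨ltP hi hj (by
      rw [hpl₄ k hk]; exact Fin.is_lt _), hS0⟩⟩)
    (fun i _ j hj k hk h hh i' _ j' hj' k' hk' h' hh' heq => by
      obtain ⟨h1, h2⟩ := mul_add_inj hk hk' heq
      have h3 := mul_add_inj hj hj' h1
      omega)) ?_
  rintro s₅ ⟨a₅, v₅, o₅⟩
  have keep : ∀ b o, b ≠ 12 → b ≠ 4 → o < S → s₅.fld (b * S + o) = s₄.fld (b * S + o) :=
    fun b o h h' ho => o₅ b o h ho (Or.inl h')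
  have hγ : ∀ i j k : Fin r,
      s₅.fld (4 * S + ((i * r + j) * r + k)) = E'.repr (E' i * E' j) k := by
    intro i j k
    rw [v₅ i i.2 j j.2 k k.2 0 one_pos, Finset.sum_range_one, hone, mul_one, hpl₄ k k.2, hprod, hrepr]
  replace L := L.agree a₅
  replace hone : s₅.fld (14 * S + 0) = 1 := by rw [keep 14 0 (by norm_num) (by norm_num) hS0, hone]
  replace hC : ∀ i j : Fin r, s₅.fld (2 * S + (i * r + j)) = E'.repr (E i) j := fun i j => by
    rw [keep 2 _ (by norm_num) (by norm_num) (lt2 i.2 j.2), hC]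
  clear hprod v₅ o₅ keep a₅ hpl₄ hrepr
  -- the regular trace of the basis
  refine Reaches.seq (k := 1) (k' := 2) hP (Reaches.fill hl hP (S := S) (fun i _ _ _ => i)
    (fun i _ _ _ l => (i * r + l) * r + l) (fun _ _ _ _ _ => 0)
    L.stride L.dim L.one L.one L.one L.dim (by norm_num)
    (fun _ _ => rfl) (fun ν hν => by simp only [NExp.ev, (L.agree hν).dim]) (fun _ _ => rfl)
    (fun i hi _ _ _ _ _ _ => ⟨lt1 hi, fun l hl => ⟨lt3 hi hl hl, hS0⟩⟩)
    (fun i _ _ _ _ _ _ _ _ _ _ _ _ _ _ _ _ => by omega)) ?_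
  rintro s₆ ⟨a₆, v₆, o₆⟩
  have keep : ∀ b o, b ≠ 12 → b ≠ 5 → o < S → s₆.fld (b * S + o) = s₅.fld (b * S + o) :=
    fun b o h h' ho => o₆ b o h ho (Or.inl h')
  have hT : ∀ i : Fin r, s₆.fld (5 * S + i) = regTrace A (E' i) := by
    intro i
    rw [v₆ i i.2 0 one_pos 0 one_pos 0 one_pos, Finset.sum_range, regTrace_basis E']
    refine Finset.sum_congr rfl fun l _ => ?_
    rw [hone, mul_one, hγ]
  replace L := L.agree a₆
  replace hone : s₆.fld (14 * S + 0) = 1 := by rw [keep 14 0 (by norm_num) (by norm_num) hS0, hone]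
  replace hC : ∀ i j : Fin r, s₆.fld (2 * S + (i * r + j)) = E'.repr (E i) j := fun i j => by
    rw [keep 2 _ (by norm_num) (by norm_num) (lt2 i.2 j.2), hC]
  replace hγ : ∀ i j k : Fin r,
      s₆.fld (4 * S + ((i * r + j) * r + k)) = E'.repr (E' i * E' j) k := fun i j k => by
    rw [keep 4 _ (by norm_num) (by norm_num) (lt3 i.2 j.2 k.2), hγ]
  clear v₆ o₆ keep a₆
  -- the regular trace of products of two elements of the basis
  refine Reaches.seq (k := 1) (k' := 1) hP (Reaches.fill hl hP (S := S) (fun i j _ _ => i * r + j)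
    (fun i j _ _ l => (i * r + j) * r + l) (fun _ _ _ _ l => l)
    L.stride L.dim L.dim L.one L.one L.dim (by norm_num)
    (fun ν hν => by simp only [NExp.ev, (L.agree hν).dim])
    (fun ν hν => by simp only [NExp.ev, (L.agree hν).dim]) (fun _ _ => rfl)
    (fun i hi j hj _ _ _ _ => ⟨lt2 hi hj, fun l hl => ⟨lt3 hi hj hl, lt1 hl⟩⟩)
    (fun i _ j hj _ _ _ _ i' _ j' hj' _ _ _ _ h => by
      have := mul_add_inj hj hj' h; omega)) ?_
  rintro s₇ ⟨a₇, v₇, o₇⟩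
  have keep : ∀ b o, b ≠ 12 → b ≠ 6 → o < S → s₇.fld (b * S + o) = s₆.fld (b * S + o) :=
    fun b o h h' ho => o₇ b o h ho (Or.inl h')
  have hTT : ∀ i j : Fin r, s₇.fld (6 * S + (i * r + j)) = regTrace A (E' i * E' j) := by
    intro i j
    rw [v₇ i i.2 j j.2 0 one_pos 0 one_pos, Finset.sum_range, regTrace_eq_sum E']
    exact Finset.sum_congr rfl fun l _ => by rw [hT, hγ]
  replace L := L.agree a₇
  replace hone : s₇.fld (14 * S + 0) = 1 := by rw [keep 14 0 (by norm_num) (by norm_num) hS0, hone]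
  replace hC : ∀ i j : Fin r, s₇.fld (2 * S + (i * r + j)) = E'.repr (E i) j := fun i j => by
    rw [keep 2 _ (by norm_num) (by norm_num) (lt2 i.2 j.2), hC]
  replace hγ : ∀ i j k : Fin r,
      s₇.fld (4 * S + ((i * r + j) * r + k)) = E'.repr (E' i * E' j) k := fun i j k => by
    rw [keep 4 _ (by norm_num) (by norm_num) (lt3 i.2 j.2 k.2), hγ]
  replace hT : ∀ i : Fin r, s₇.fld (5 * S + i) = regTrace A (E' i) := fun i => by
    rw [keep 5 _ (by norm_num) (by norm_num) (lt1 i.2), hT]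
  clear v₇ o₇ keep a₇
  -- the tensor
  refine (Reaches.fill hl hP (S := S) (fun i j k _ => (i * r + j) * r + k)
    (fun i j _ _ l => (i * r + j) * r + l) (fun _ _ k _ l => l * r + k)
    L.stride L.dim L.dim L.dim L.one L.dim (by norm_num)
    (fun ν hν => by simp only [NExp.ev, (L.agree hν).dim])
    (fun ν hν => by simp only [NExp.ev, (L.agree hν).dim])
    (fun ν hν => by simp only [NExp.ev, (L.agree hν).dim])
    (fun i hi j hj k hk _ _ => ⟨lt3 hi hj hk, fun l hl => ⟨lt3 hi hj hl, lt2 hl hk⟩⟩)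
    (fun i _ j hj k hk h hh i' _ j' hj' k' hk' h' hh' heq => by
      obtain ⟨h1, h2⟩ := mul_add_inj hk hk' heq
      have h3 := mul_add_inj hj hj' h1
      omega)).imp ?_
  rintro s₈ ⟨a₈, v₈, o₈⟩
  have keep : ∀ b o, b ≠ 12 → b ≠ 7 → o < S → s₈.fld (b * S + o) = s₇.fld (b * S + o) :=
    fun b o h h' ho => o₈ b o h ho (Or.inl h')
  refine ⟨L.agree a₈, by rw [keep 14 0 (by norm_num) (by norm_num) hS0, hone], E', fun i j => ?_,
    fun i => ?_, fun i j k => ?_⟩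
  · rw [keep 2 _ (by norm_num) (by norm_num) (lt2 i.2 j.2), hC]
  · rw [keep 5 _ (by norm_num) (by norm_num) (lt1 i.2), hT]
  · rw [v₈ i i.2 j j.2 k k.2 0 one_pos, Finset.sum_range, regTensor, regTrace_mul_eq_sum E']
    exact Finset.sum_congr rfl fun l _ => by rw [hγ, hTT]

end TensorProg

/-! ### Reading off the isomorphism -/

/-- The isomorphism is computed from the matrix `B₀` (array `8`) of the oracle's answer. The matrix
`M` with `tr (B₀(e) M) = T e` for the basis elements `e`, where `T` is the regular trace, solves a
linear system whose augmented matrix is reduced in array `9`; array `10` receives `w⁻¹ M`, array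
`11` the images of the input under `B₀`, and array `0` the products of both. -/
def isoProg : Prog :=
  .seq (fill 1 1 6 6 9 (off (cell 10) (cell 5) (cell 11)) 6
    (.mul (.load (arr 8 (off (cell 11) (cell 1) (cell 10)))) oneEntry)) <|
  .seq (fill 1 6 6 6 9 (off (cell 10) (cell 5) (cell 1)) 6
    (.mul (.load (arr 5 (cell 10))) oneEntry)) <|
  .seq (elim 9 5) <|
  .seq (fill 6 6 6 6 15 (.const 0) 2 (.mul oneEntry oneEntry)) <|
  .seq (.setFld (arr 15 (.const 0)) (.inv (.load (arr 15 (.const 0))))) <|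
  .seq (fill 1 6 6 6 10 (.load (.add (.const 100) (cell 10))) 6
    (.mul (.load (arr 9 (off (cell 10) (cell 5) (cell 1)))) (.load (arr 15 (.const 0))))) <|
  .seq (fill 1 1 6 6 11 (off (cell 10) (cell 1) (cell 11)) 1
    (.mul (.load (arr 2 (off (cell 10) (cell 1) (cell 14))))
      (.load (arr 8 (off (cell 11) (cell 1) (cell 14)))))) <|
  .seq (fill 1 2 2 6 0 (off (off (cell 10) (cell 2) (cell 11)) (cell 2) (cell 12)) 2
    (.mul (.load (arr 11 (off (cell 10) (cell 1) (off (cell 11) (cell 2) (cell 14)))))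
      (.load (arr 10 (off (cell 12) (cell 2) (cell 14)))))) <|
  .seq (.setNat (.const 1) (cell 2)) (.setNat (.const 0) (.const 1))

section IsoProg

variable {F : Type*} [Field F] {len : F → ℕ} {c q P e₀ k : ℕ} {O : Oracle F} {m w S : ℕ}
  {A : NonUnitalSubalgebra F (Matrix (Fin m) (Fin m) F)}

theorem finProdFinEquiv_val {a b : ℕ} (x : Fin a) (y : Fin b) :
    (finProdFinEquiv (x, y) : ℕ) = x * b + y := by
  rw [finProdFinEquiv_apply_val, add_comm, mul_comm]

/-- Given an isomorphism of the tensor with matrix multiplication, `isoProg` outputs an isomorphism of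
algebras. -/
theorem reaches_isoProg (hl : IsBitLength len c) (hP : 2 ≤ P) (hV : 100 + w * w ≤ P ^ e₀)
    (hw : (w : F) ≠ 0) (hR : Room m (w * w) S) (E E' : Module.Basis (Fin (w * w)) F A)
    {B : Fin 3 → Matrix (Fin (w * w)) (Fin (w * w)) F} (hB : IsTensorIso w (regTensor E') B)
    {s : State F} (L : Layout m (w * w) w S s.nat)
    (hone : s.fld (14 * S + 0) = 1)
    (hC : ∀ i j : Fin (w * w), s.fld (2 * S + (i * (w * w) + j)) = E'.repr (E i) j)
    (hT : ∀ i : Fin (w * w), s.fld (5 * S + i) = regTrace A (E' i))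
    (hB₀ : ∀ v i : Fin (w * w), s.fld (8 * S + (v * (w * w) + i)) = B 0 v i) :
    Reaches len c O q P e₀ 10 isoProg s (OutputsIso E) := by
  have hw0 : 0 < w := Nat.pos_of_ne_zero fun h => hw (by rw [h, Nat.cast_zero])
  have hS0 := hR.pos
  obtain ⟨φ, hφ, hM⟩ := exists_algHom_of_isTensorIso E' hw hB
  have hunit := hB.1 0
  have lt1 : ∀ {i}, i < w * w → i < S := fun h => h.trans_le hR.dim
  have lt2 : ∀ {i j}, i < w * w → j < w * w → i * (w * w) + j < S := fun h h' =>
    (mul_add_lt h h').trans_le hR.square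
  have ltA : ∀ {i j}, i < w * w → j < w * w + 1 → i * (w * w + 1) + j < S := fun h h' =>
    (mul_add_lt h h').trans_le hR.augmented
  have ltO : ∀ {i a b}, i < w * w → a < w → b < w → (i * w + a) * w + b < S := fun h h' h'' =>
    (mul_add_lt (mul_add_lt h h') h'').trans_le (by rw [mul_assoc]; exact hR.square)
  -- the coefficients of the linear system
  refine Reaches.seq (k := 1) (k' := 9) hP (Reaches.fill hl hP (S := S)
    (fun i j _ _ => i * (w * w + 1) + j) (fun i j _ _ _ => j * (w * w) + i) (fun _ _ _ _ _ => 0)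
    L.stride L.dim L.dim L.one L.one L.one (by norm_num)
    (fun ν hν => by simp only [NExp.ev, (L.agree hν).dim_succ])
    (fun ν hν => by simp only [NExp.ev, (L.agree hν).dim]) (fun _ _ => rfl)
    (fun i hi j hj _ _ _ _ => ⟨ltA hi (by omega), fun _ _ => ⟨lt2 hj hi, hS0⟩⟩)
    (fun i _ j hj _ _ _ _ i' _ j' hj' _ _ _ _ h => by
      have := mul_add_inj (b := w * w + 1) (by omega) (by omega) h; omega)) ?_
  rintro s₁ ⟨a₁, v₁, o₁⟩
  replace L := L.agree a₁
  have keep : ∀ b o, b ≠ 12 → b ≠ 9 → o < S → s₁.fld (b * S + o) = s.fld (b * S + o) :=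
    fun b o h h' ho => o₁ b o h ho (Or.inl h')
  have hY : ∀ i j : Fin (w * w), s₁.fld (9 * S + (i * (w * w + 1) + j)) = B 0 j i := fun i j => by
    rw [v₁ i i.2 j j.2 0 one_pos 0 one_pos, Finset.sum_range_one, hone, mul_one, hB₀]
  replace hone : s₁.fld (14 * S + 0) = 1 := by rw [keep 14 0 (by norm_num) (by norm_num) hS0, hone]
  replace hC : ∀ i j : Fin (w * w), s₁.fld (2 * S + (i * (w * w) + j)) = E'.repr (E i) j :=
    fun i j => by rw [keep 2 _ (by norm_num) (by norm_num) (lt2 i.2 j.2), hC]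
  replace hB₀ : ∀ v i : Fin (w * w), s₁.fld (8 * S + (v * (w * w) + i)) = B 0 v i :=
    fun i j => by rw [keep 8 _ (by norm_num) (by norm_num) (lt2 i.2 j.2), hB₀]
  replace hT : ∀ i : Fin (w * w), s₁.fld (5 * S + i) = regTrace A (E' i) := fun i => by
    rw [keep 5 _ (by norm_num) (by norm_num) (lt1 i.2), hT]
  clear v₁ o₁ keep a₁
  -- the right-hand sides
  refine Reaches.seq (k := 1) (k' := 8) hP (Reaches.fill hl hP (S := S)
    (fun i _ _ _ => i * (w * w + 1) + w * w) (fun i _ _ _ _ => i) (fun _ _ _ _ _ => 0)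
    L.stride L.dim L.one L.one L.one L.one (by norm_num)
    (fun ν hν => by simp only [NExp.ev, (L.agree hν).dim_succ, (L.agree hν).dim])
    (fun _ _ => rfl) (fun _ _ => rfl)
    (fun i hi _ _ _ _ _ _ => ⟨ltA hi (by omega), fun _ _ => ⟨lt1 hi, hS0⟩⟩)
    (fun i _ j hj _ _ _ _ i' _ j' hj' _ _ _ _ h => by
      have := mul_add_inj (b := w * w + 1) (by omega) (by omega) h; omega)) ?_
  rintro s₂ ⟨a₂, v₂, o₂⟩
  replace L := L.agree a₂
  have keep : ∀ b o, b ≠ 12 → b ≠ 9 → o < S → s₂.fld (b * S + o) = s₁.fld (b * S + o) :=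
    fun b o h h' ho => o₂ b o h ho (Or.inl h')
  have hY₂ : ∀ (i : Fin (w * w)) (j : Fin (w * w + 1)),
      s₂.fld (9 * S + (i * (w * w + 1) + j)) = (Matrix.of fun (i : Fin (w * w)) =>
        Fin.snoc (α := fun _ => F) (fun j => B 0 j i) (regTrace A (E' i))) i j := by
    intro i j
    rw [Matrix.of_apply]
    induction j using Fin.lastCases with
    | last =>
      rw [Fin.snoc_last, Fin.val_last, v₂ i i.2 0 one_pos 0 one_pos 0 one_pos,
        Finset.sum_range_one, hone, mul_one, hT]
    | cast j =>
      rw [Fin.snoc_castSucc, Fin.val_castSucc, ← hY]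
      refine o₂ 9 _ (by norm_num) (ltA i.2 (by omega)) (Or.inr fun i' _ _ _ _ _ _ _ h => ?_)
      have := mul_add_inj (b := w * w + 1) (by omega) (by omega) h
      omega
  replace hone : s₂.fld (14 * S + 0) = 1 := by rw [keep 14 0 (by norm_num) (by norm_num) hS0, hone]
  replace hC : ∀ i j : Fin (w * w), s₂.fld (2 * S + (i * (w * w) + j)) = E'.repr (E i) j :=
    fun i j => by rw [keep 2 _ (by norm_num) (by norm_num) (lt2 i.2 j.2), hC]
  replace hB₀ : ∀ v i : Fin (w * w), s₂.fld (8 * S + (v * (w * w) + i)) = B 0 v i :=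
    fun i j => by rw [keep 8 _ (by norm_num) (by norm_num) (lt2 i.2 j.2), hB₀]
  clear v₂ o₂ keep a₂ hT hY
  -- solve the system
  refine Reaches.seq (k := 1) (k' := 7) hP (Reaches.elim hl hP (S := S) L.dim L.dim_succ L.stride
    L.one hR.augmented (by norm_num) (by norm_num) hV (by omega) _ hY₂ (L := w * w)
    (fun v hv => ?_)) ?_
  · refine Matrix.mulVec_injective_iff_isUnit.2 hunit ?_
    rw [Matrix.mulVec_zero]
    funext j
    refine Eq.trans ?_ (hv j.castSucc j.2)
    rw [Matrix.mulVec, Matrix.vecMul, dotProduct, dotProduct]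
    refine Finset.sum_congr rfl fun i _ => ?_
    rw [Matrix.of_apply, Fin.snoc_castSucc, mul_comm]
  rintro s₃ ⟨X, C, p, hpiv, hpL, hlow, hp, hX, o₃⟩
  replace L := L.congr hlow
  replace hone : s₃.fld (14 * S + 0) = 1 := by
    rw [o₃ 14 0 (by norm_num) (by norm_num) (by norm_num) hS0, hone]
  replace hC : ∀ i j : Fin (w * w), s₃.fld (2 * S + (i * (w * w) + j)) = E'.repr (E i) j :=
    fun i j => by rw [o₃ 2 _ (by norm_num) (by norm_num) (by norm_num) (lt2 i.2 j.2), hC]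
  replace hB₀ : ∀ v i : Fin (w * w), s₃.fld (8 * S + (v * (w * w) + i)) = B 0 v i :=
    fun i j => by rw [o₃ 8 _ (by norm_num) (by norm_num) (by norm_num) (lt2 i.2 j.2), hB₀]
  have hXl : ∀ l : Fin (w * w), s₃.fld (9 * S + (l * (w * w + 1) + w * w)) = X l (Fin.last _) :=
    fun l => hX l (Fin.last _)
  clear hX o₃ hlow hY₂
  -- the inverse of the width
  refine Reaches.seq (k := 1) (k' := 6) hP (Reaches.fill hl hP (S := S)
    (fun _ _ _ _ => 0) (fun _ _ _ _ _ => 0) (fun _ _ _ _ _ => 0)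
    L.stride L.one L.one L.one L.one L.width (by norm_num)
    (fun _ _ => rfl) (fun _ _ => rfl) (fun _ _ => rfl)
    (fun i hi _ _ _ _ _ _ => ⟨hS0, fun _ _ => ⟨hS0, hS0⟩⟩)
    (fun i _ j hj _ _ _ _ i' _ j' hj' _ _ _ _ h => by omega)) ?_
  rintro s₄ ⟨a₄, v₄, o₄⟩
  have keep : ∀ b o, b ≠ 12 → b ≠ 15 → o < S → s₄.fld (b * S + o) = s₃.fld (b * S + o) :=
    fun b o h h' ho => o₄ b o h ho (Or.inl h')
  have hw₄ : s₄.fld (15 * S + 0) = w := by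
    rw [v₄ 0 one_pos 0 one_pos 0 one_pos 0 one_pos]
    rw [hone, mul_one, Finset.sum_const, Finset.card_range, nsmul_eq_mul, mul_one]
  replace L := L.agree a₄
  refine Reaches.seq (k := 1) (k' := 5) hP (Reaches.setFld_inv hl hP _ _) ?_
  rintro s₅ rfl
  have he15 : (arr 15 (.const 0)).eval s₄ = 15 * S + 0 := by
    rw [NExp.eval_eq_ev]; simp only [NExp.ev, L.stride]
  rw [he15, hw₄]
  set s₅ := s₄.setF (15 * S + 0) (w : F)⁻¹ with hs₅
  have hn₅ : s₅.nat = s₄.nat := rfl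
  have keep' : ∀ b o, b ≠ 12 → b ≠ 15 → o < S → s₅.fld (b * S + o) = s₃.fld (b * S + o) :=
    fun b o h h' ho => (Function.update_of_ne (arr_ne h' ho hS0) _ _).trans (keep b o h h' ho)
  have hw₅ : s₅.fld (15 * S + 0) = (w : F)⁻¹ := Function.update_self _ _ _
  replace L : Layout m (w * w) w S s₅.nat := L
  replace hC : ∀ i j : Fin (w * w), s₅.fld (2 * S + (i * (w * w) + j)) = E'.repr (E i) j :=
    fun i j => by rw [keep' 2 _ (by norm_num) (by norm_num) (lt2 i.2 j.2), hC]
  replace hB₀ : ∀ v i : Fin (w * w), s₅.fld (8 * S + (v * (w * w) + i)) = B 0 v i :=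
    fun i j => by rw [keep' 8 _ (by norm_num) (by norm_num) (lt2 i.2 j.2), hB₀]
  replace hXl : ∀ l : Fin (w * w),
      s₅.fld (9 * S + (l * (w * w + 1) + w * w)) = X l (Fin.last _) :=
    fun l => by rw [keep' 9 _ (by norm_num) (by norm_num) (ltA l.2 (by omega)), hXl]
  have hpl : ∀ j (hj : j < w * w), s₅.nat (100 + j) = p ⟨j, hj⟩ := fun j hj => by
    rw [hn₅, a₄ _ (by omega)]; exact hp ⟨j, hj⟩
  have hpl' : ∀ j, j < w * w → s₅.nat (100 + j) < w * w := fun j hj => by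
    rw [hpl j hj]; exact hpL _
  clear keep keep' v₄ o₄ a₄ hp hone hw₄ he15
  clear_value s₅
  clear hs₅ hn₅ s₄
  -- the solution
  refine Reaches.seq (k := 1) (k' := 4) hP (Reaches.fill hl hP (S := S)
    (fun i _ _ _ => s₅.nat (100 + i)) (fun i _ _ _ _ => i * (w * w + 1) + w * w)
    (fun _ _ _ _ _ => 0) L.stride L.dim L.one L.one L.one L.one (by norm_num)
    (fun ν hν => by simp only [NExp.ev]; rw [hν (100 + ν 10) (by omega)])
    (fun ν hν => by simp only [NExp.ev, (L.agree hν).dim_succ, (L.agree hν).dim])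
    (fun _ _ => rfl)
    (fun i hi _ _ _ _ _ _ => ⟨lt1 (hpl' i hi), fun _ _ => ⟨ltA hi (by omega), hS0⟩⟩)
    (fun i hi j hj _ _ _ _ i' hi' j' hj' _ _ _ _ h => by
      rw [hpl i hi, hpl i' hi'] at h
      have := congrArg Fin.val (hpiv.injective (Fin.ext h))
      simp only at this
      omega)) ?_
  rintro s₆ ⟨a₆, v₆, o₆⟩
  replace L := L.agree a₆
  have keep : ∀ b o, b ≠ 12 → b ≠ 10 → o < S → s₆.fld (b * S + o) = s₅.fld (b * S + o) :=
    fun b o h h' ho => o₆ b o h ho (Or.inl h')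
  set M : Matrix (Fin w) (Fin w) F := Matrix.of fun b a =>
    s₆.fld (10 * S + (finProdFinEquiv (a, b) : Fin (w * w))) * w with hMdef
  have hMT : ∀ i, (formMatrix (B 0) i * M).trace = regTrace A (E' i) := by
    intro i
    have h1 := hpiv.sum_mul_eq hpL (μ := fun j => s₆.fld (10 * S + j) * w) (fun l => by
      have h2 := v₆ l l.2 0 one_pos 0 one_pos 0 one_pos
      rw [hpl l l.2, Finset.sum_range_one, hXl, hw₅] at h2
      simp only [Fin.eta] at h2 ⊢
      rw [h2, mul_assoc, inv_mul_cancel₀ hw, mul_one]) i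
    simp only [Matrix.of_apply, Fin.snoc_castSucc, Fin.snoc_last] at h1
    rw [← h1, ← finProdFinEquiv.sum_comp, Fintype.sum_prod_type, Matrix.trace]
    refine Finset.sum_congr rfl fun a _ => ?_
    rw [Matrix.diag_apply, Matrix.mul_apply]
    rfl
  have hφM := hM M hMT
  have hMt : ∀ a b : Fin w, s₆.fld (10 * S + (b * w + a)) = (w : F)⁻¹ * M a b := fun a b => by
    rw [hMdef, Matrix.of_apply, finProdFinEquiv_val, mul_comm _ (w : F), ← mul_assoc,
      inv_mul_cancel₀ hw, one_mul]
  replace hC : ∀ i j : Fin (w * w), s₆.fld (2 * S + (i * (w * w) + j)) = E'.repr (E i) j :=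
    fun i j => by rw [keep 2 _ (by norm_num) (by norm_num) (lt2 i.2 j.2), hC]
  replace hB₀ : ∀ v i : Fin (w * w), s₆.fld (8 * S + (v * (w * w) + i)) = B 0 v i :=
    fun i j => by rw [keep 8 _ (by norm_num) (by norm_num) (lt2 i.2 j.2), hB₀]
  clear_value M
  clear hMdef hMT hM v₆ o₆ keep a₆ hpl hpl' hXl hw₅ hpiv hpL
  -- the images of the input under `B₀`
  refine Reaches.seq (k := 1) (k' := 3) hP (Reaches.fill hl hP (S := S)
    (fun i j _ _ => i * (w * w) + j) (fun i _ _ _ l => i * (w * w) + l)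
    (fun _ j _ _ l => j * (w * w) + l) L.stride L.dim L.dim L.one L.one L.dim (by norm_num)
    (fun ν hν => by simp only [NExp.ev, (L.agree hν).dim])
    (fun ν hν => by simp only [NExp.ev, (L.agree hν).dim])
    (fun ν hν => by simp only [NExp.ev, (L.agree hν).dim])
    (fun i hi j hj _ _ _ _ => ⟨lt2 hi hj, fun l hl => ⟨lt2 hi hl, lt2 hj hl⟩⟩)
    (fun i _ j hj _ _ _ _ i' _ j' hj' _ _ _ _ h => by
      have := mul_add_inj hj hj' h; omega)) ?_
  rintro s₇ ⟨a₇, v₇, o₇⟩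
  replace L := L.agree a₇
  have hZ : ∀ (i : Fin (w * w)) (a b : Fin w),
      s₇.fld (11 * S + (i * (w * w) + (a * w + b)))
        = (∑ l, E'.repr (E i) l • formMatrix (B 0) l) a b := by
    intro i a b
    rw [← finProdFinEquiv_val, v₇ i i.2 _ (finProdFinEquiv (a, b)).2 0 one_pos 0 one_pos,
      Finset.sum_range, Matrix.sum_apply]
    exact Finset.sum_congr rfl fun l _ => by rw [hC, hB₀]; rfl
  replace hMt : ∀ a b : Fin w, s₇.fld (10 * S + (b * w + a)) = (w : F)⁻¹ * M a b := fun a b => by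
    rw [o₇ 10 _ (by norm_num) (lt1 (mul_add_lt b.2 a.2)) (Or.inl (by norm_num)), hMt]
  clear v₇ o₇ a₇ hC hB₀
  -- the images of the input under the isomorphism
  refine Reaches.seq (k := 1) (k' := 2) hP (Reaches.fill hl hP (S := S)
    (fun i j k _ => (i * w + j) * w + k) (fun i j _ _ l => i * (w * w) + (j * w + l))
    (fun _ _ k _ l => k * w + l) L.stride L.dim L.width L.width L.one L.width (by norm_num)
    (fun ν hν => by simp only [NExp.ev, (L.agree hν).width])
    (fun ν hν => by simp only [NExp.ev, (L.agree hν).dim, (L.agree hν).width])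
    (fun ν hν => by simp only [NExp.ev, (L.agree hν).width])
    (fun i hi j hj k hk _ _ => ⟨ltO hi hj hk, fun l hl =>
      ⟨lt2 hi (mul_add_lt hj hl), lt1 (mul_add_lt hk hl)⟩⟩)
    (fun i _ j hj k hk _ _ i' _ j' hj' k' hk' _ _ h => by
      obtain ⟨h1, h2⟩ := mul_add_inj hk hk' h
      have h3 := mul_add_inj hj hj' h1
      omega)) ?_
  rintro s₈ ⟨a₈, v₈, -⟩
  replace L := L.agree a₈
  have hout : ∀ (i : Fin (w * w)) (a b : Fin w),
      s₈.fld ((i * w + a) * w + b) = φ (E i) a b := by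
    intro i a b
    have h1 := v₈ i i.2 a a.2 b b.2 0 one_pos
    rw [zero_mul, zero_add] at h1
    rw [h1, hφM, Matrix.smul_apply, Matrix.mul_apply, Finset.sum_range, smul_eq_mul,
      Finset.mul_sum]
    exact Finset.sum_congr rfl fun l _ => by rw [hZ, hMt]; ring
  have h2 : (cell 2).eval s₈ = w := L.width
  refine Reaches.seq (k := 1) (k' := 1) hP (Reaches.setNat hP _ _ ?_) ?_
  · rw [h2]; nlinarith
  rintro s₉ rfl
  refine (Reaches.setNat hP _ _ ((?_ : 1 ≤ 100 + w * w).trans hV)).imp ?_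
  · omega
  rintro s' rfl
  refine ⟨w, by rw [Module.finrank_eq_card_basis E', Fintype.card_fin, sq], φ, hφ, rfl, ?_, hout⟩
  rw [← h2]
  rfl

end IsoProg

/-! ### The algorithm -/

/-- The least number whose square is at least the dimension. -/
def sqrtProg : Prog :=
  .loop (.lt (.mul (cell 2) (cell 2)) (cell 1)) (.setNat (.const 2) (.add (cell 2) (.const 1)))

/-- Fill the fixed addresses. -/
def setupProg : Prog :=
  .seq (.setNat (.const 3) (.mul (cell 0) (cell 0))) <|
  .seq (.setNat (.const 4) (.mul (.mul (.mul (.add (cell 0) (.const 2)) (.add (cell 0) (.const 2)))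
    (.mul (.add (cell 0) (.const 2)) (.add (cell 0) (.const 2))))
    (.mul (.add (cell 0) (.const 2)) (.add (cell 0) (.const 2))))) <|
  .seq (.setNat (.const 5) (.add (cell 1) (.const 1))) <|
  .seq (.setNat (.const 6) (.const 1)) <|
  .seq (.setNat (.const 7) (.mul (cell 1) (cell 3)))
  (.setFld (arr 14 (.const 0)) .one)

/-- The test for full matrix algebras, for algebras whose dimension is the square of the content of address `2`. -/
def squareProg : Prog :=
  .seq setupProg <|
  .seq tensorProg <|
  .seq (.query (cell 2) (arr 7 (.const 0)) (arr 8 (.const 0)) (.const 16))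
  (.cond (.lt (.const 0) (cell 16)) isoProg (.setNat (.const 0) (.const 0)))

/-- The algorithm: the answer is No at once if the dimension is not a square. -/
def fmaiProg : Prog :=
  .seq sqrtProg
  (.cond (.lt (cell 1) (.mul (cell 2) (cell 2))) (.setNat (.const 0) (.const 0)) squareProg)

theorem finProdFinEquiv_symm_mk {a b x : ℕ} (h : x < a * b) (i : Fin a) (j : Fin b)
    (hx : x = i * b + j) : finProdFinEquiv.symm ⟨x, h⟩ = (i, j) := by
  rw [Equiv.symm_apply_eq]
  exact Fin.ext (hx.trans (finProdFinEquiv_val i j).symm)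

theorem writeMatrices_zero {F : Type*} (f : ℕ → F) (d : ℕ) {n : ℕ} (B : Fin 3 → Matrix (Fin n) (Fin n) F)
    (v i : Fin n) : writeMatrices f d B (d + (v * n + i)) = B 0 v i := by
  have h := mul_add_lt v.2 i.2
  have h1 : d + (v * n + i) - d < 3 * (n * n) := by omega
  have h2 : finProdFinEquiv.symm ⟨d + (v * n + i) - d, h1⟩ 
      = ((0 : Fin 3), (⟨v * n + i, h⟩ : Fin (n * n))) :=
    finProdFinEquiv_symm_mk _ _ _ (by simp)
  rw [writeMatrices, dif_pos ⟨by omega, h1⟩, h2, finProdFinEquiv_symm_mk h v i rfl]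

theorem writeMatrices_of_notMem {F : Type*} (f : ℕ → F) {d x n : ℕ} (B : Fin 3 → Matrix (Fin n) (Fin n) F)
    (hx : x < d ∨ d + 3 * (n * n) ≤ x) : writeMatrices f d B x = f x := by
  rw [writeMatrices, dif_neg (by omega)]

section Main

variable {F : Type*} [Field F] {len : F → ℕ} {c q P e₀ k : ℕ} {O : Oracle F} {m r w S : ℕ}

/-- The loop ends at the least `N` with `r ≤ N²`. -/
theorem reaches_sqrtProg (hl : IsBitLength len c) (hP : 2 ≤ P) {s : State F}
    (h1 : s.nat 1 = r) (h2 : s.nat 2 = 0) :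
    Reaches len c O q P e₀ 1 sqrtProg s fun s' =>
      ∃ N, s' = s.setN 2 N ∧ r ≤ N * N ∧ ∀ n < N, n * n < r := by
  refine Reaches.of_runs fun e _ hs => ?_
  have hex : ∃ N, r ≤ N * N := ⟨r, Nat.le_mul_self r⟩
  classical
  set N := Nat.find hex with hN
  have hNr : N ≤ r := Nat.find_min' hex (Nat.le_mul_self r)
  have hrV : r ≤ P ^ e := h1 ▸ hs.nat 1
  have hlt : ∀ n < N, n * n < r := fun n hn => not_le.1 (Nat.find_min hex hn)
  have ev1 : ∀ i, (cell 1).eval (s.setN 2 i) = r := fun i => h1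
  have ev2 : ∀ i, (cell 2).eval (s.setN 2 i) = i := fun i => by
    simp [NExp.eval, State.setN]
  have hinit : s.setN 2 0 = s := by
    unfold State.setN
    rw [← h2, Function.update_eq_self]
  obtain ⟨s', h3, h4⟩ := Runs.loop (O := O) (V := P ^ e)
    (b := .lt (.mul (cell 2) (cell 2)) (cell 1))
    (p := .setNat (.const 2) (.add (cell 2) (.const 1))) hl (fun i s' => s' = s.setN 2 i) (N := N)
    (T := 1)
    (fun i hi s' h => by
      subst h
      change (cell 2).eval _ * (cell 2).eval _ < (cell 1).eval _
      rw [ev1, ev2]; exact hlt i hi)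
    (fun s' h => by
      subst h
      change ¬ (cell 2).eval _ * (cell 2).eval _ < (cell 1).eval _
      rw [ev1, ev2]; exact not_lt.2 (Nat.find_spec hex))
    (fun i hi s' hs' h => by
      subst h
      have he : (NExp.add (cell 2) (.const 1)).eval (s.setN 2 i) = i + 1 :=
        congrArg (· + 1) (ev2 i)
      have h5 := Runs.setNat (c := c) (O := O) hs' (.const 2) (.add (cell 2) (.const 1))
        (by rw [he]; omega)
      rw [he] at h5
      refine ⟨_, h5, ?_⟩
      simp only [State.setN, NExp.eval, Function.update_idem])
    hs hinit.symm
  refine ⟨s', P ^ e, _, Nat.pow_le_pow_right (by omega) (le_nextExp _ _ _), ?_, h3, N, h4,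
    Nat.find_spec hex, hlt⟩
  calc N * (1 + 1) + 1 ≤ (P ^ e + 2) ^ 2 := by nlinarith [hNr.trans hrV]
    _ ≤ _ := Nat.pow_le_pow_right (by omega) (by norm_num)

theorem reaches_setupProg (hl : IsBitLength len c) (hP : 2 ≤ P) {s : State F}
    (h0 : s.nat 0 = m) (h1 : s.nat 1 = r) (h2 : s.nat 2 = w) (hR : Room m r ((m + 2) ^ 6))
    (hS : (m + 2) ^ 6 ≤ P ^ e₀) (hm : m * m ≤ P ^ e₀) (hr : r + 1 ≤ P ^ e₀) :
    Reaches len c O q P e₀ 6 setupProg s fun s' => Layout m r w ((m + 2) ^ 6) s'.nat ∧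
      s'.fld (14 * (m + 2) ^ 6 + 0) = 1 ∧ ∀ o < (m + 2) ^ 6, s'.fld o = s.fld o := by
  have hS0 := hR.pos
  have e4 : (m + 2) * (m + 2) * ((m + 2) * (m + 2)) * ((m + 2) * (m + 2)) = (m + 2) ^ 6 := by ring
  refine Reaches.seq (k := 1) (k' := 5) hP (Reaches.setNat hP _ _ (by
    simp only [NExp.eval, h0]; exact hm)) ?_
  rintro s₁ rfl
  refine Reaches.seq (k := 1) (k' := 4) hP (Reaches.setNat hP _ _ (by
    simpa [NExp.eval, State.setN, h0, e4] using hS)) ?_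
  rintro s₂ rfl
  refine Reaches.seq (k := 1) (k' := 3) hP (Reaches.setNat hP _ _ (by
    simpa [NExp.eval, State.setN, h1] using hr)) ?_
  rintro s₃ rfl
  refine Reaches.seq (k := 1) (k' := 2) hP (Reaches.setNat hP _ _ (by
    simp only [NExp.eval]; omega)) ?_
  rintro s₄ rfl
  refine Reaches.seq (k := 1) (k' := 1) hP (Reaches.setNat hP _ _ (by
    simpa [NExp.eval, State.setN, h0, h1] using hR.input.trans hS)) ?_
  rintro s₅ rfl
  refine (Reaches.setFld_one hl hP _).imp ?_
  rintro s₆ rfl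
  refine ⟨?_, ?_, fun o ho => ?_⟩
  · constructor <;> simp [NExp.eval, State.setN, h0, h1, h2, e4]
  · simp [NExp.eval, State.setN, h0, e4]
  · have : o ≠ 14 * (m + 2) ^ 6 := by omega
    simp [NExp.eval, State.setN, h0, e4, this]

theorem inputState_fld (E : Fin r → Matrix (Fin m) (Fin m) F) (coins : ℕ → Bool) (l : Fin r)
    (j : Fin (m * m)) : (inputState E coins).fld (l * (m * m) + j) = flat (E l) j := by
  have h := mul_add_lt l.2 j.2
  simp only [inputState, dif_pos h, finProdFinEquiv_symm_mk h l j rfl]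
  rfl

variable {A : NonUnitalSubalgebra F (Matrix (Fin m) (Fin m) F)}

theorem reaches_squareProg (hl : IsBitLength len c) (hO : SolvesMMTI O) (hq : PolyLength len q O)
    (hst : Standing F w 3) (hP : 2 ≤ P) (hm : 0 < m) (hV : 100 + w * w ≤ P ^ e₀)
    (hS : (m + 2) ^ 6 ≤ P ^ e₀) (hR : Room m (w * w) ((m + 2) ^ 6))
    (E : Module.Basis (Fin (w * w)) F A) {s : State F}
    (h0 : s.nat 0 = m) (h1 : s.nat 1 = w * w) (h2 : s.nat 2 = w)
    (hE : ∀ (l : Fin (w * w)) (j : Fin (m * m)),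
      s.fld (l * (m * m) + j) = flat (E l : Matrix (Fin m) (Fin m) F) j) :
    Reaches len c O q P e₀ 26 squareProg s fun s' =>
      (IsFullMatrixAlgebra A → OutputsIso E s') ∧ (¬ IsFullMatrixAlgebra A → OutputsNo s') := by
  have hw : (w : F) ≠ 0 := by
    -- a positive characteristic exceeds `w`
    intro h
    obtain ⟨hw2, -, hc⟩ := hst
    have hdvd := (ringChar.spec F w).1 h
    rcases hc with hc | hc
    · rw [hc, zero_dvd_iff] at hdvd; omega
    · have h3 := Nat.le_of_dvd (by omega) hdvd
      have h4 : w ≤ w ^ 2 * 3 := by nlinarith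
      have h5 : w ^ 2 * 3 ≤ (w ^ 2 * 3) ^ 5 := Nat.le_self_pow (by norm_num) _
      omega
  have hrank : Module.finrank F A = w * w := by
    rw [Module.finrank_eq_card_basis E, Fintype.card_fin]
  have hwP : w ≤ P ^ e₀ := by nlinarith
  have hmm : m * m ≤ (m + 2) ^ 6 :=
    le_trans (by nlinarith) (Nat.pow_le_pow_right (n := m + 2) (i := 2) (by omega) (by norm_num))
  refine Reaches.seq (k := 6) (k' := 20) hP (reaches_setupProg hl hP h0 h1 h2 hR hS
    (hmm.trans hS) (by omega)) ?_
  rintro s₁ ⟨L, hone, hfld⟩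
  generalize (m + 2) ^ 6 = S at *
  refine Reaches.seq (k := 8) (k' := 12) hP (reaches_tensorProg hl hP hV hm hR E L (fun l j => by
    rw [zero_mul, zero_add, hfld _ ((mul_add_lt l.2 j.2).trans_le hR.input), hE]) hone) ?_
  rintro s₂ ⟨L₂, hone₂, E', hC, hT, ht⟩
  have hcw : (cell 2).eval s₂ = w := L₂.width
  refine Reaches.seq (k := 1) (k' := 11) hP (Reaches.query hP hq hst _ _ _ _ hcw hwP) ?_
  rintro s₃ rfl
  have ev : ∀ a, (arr a (.const 0)).eval s₂ = a * S + 0 := fun a => by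
    rw [NExp.eval_eq_ev]; simp only [NExp.ev, L₂.stride]
  have hread : readCoeffs s₂ (7 * S + 0) (w * w) = regTensor E' := by
    funext i j k
    rw [readCoeffs, add_zero]
    exact ht i j k
  obtain ⟨hsome, hnone⟩ := hO w hst (regTensor E')
  rw [ev, ev]
  unfold State.afterQuery
  rw [hread]
  cases hans : O w (regTensor E') with
  | none =>
    refine Reaches.mono hP (k := 2) (Reaches.cond_false hl hP ?_ ((Reaches.setNat hP _ _
      (Nat.zero_le _)).imp ?_)) (by norm_num)
    · simp [BExp.Holds, NExp.eval]
    rintro s₄ rfl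
    refine ⟨?_, fun _ => by simp [OutputsNo, NExp.eval]⟩
    rintro ⟨w', hw', φ, hφ⟩
    obtain rfl : w' = w := by rwa [hrank, sq, Nat.mul_self_inj] at hw'
    exact absurd (exists_isTensorIso E' hw φ hφ) (hnone hans)
  | some B =>
    have hB := hsome B hans
    have hfull : IsFullMatrixAlgebra A := by
      obtain ⟨φ, hφ, -⟩ := exists_algHom_of_isTensorIso E' hw hB
      exact ⟨w, by rw [hrank, sq], φ, hφ⟩
    have hans3 := hR.answer
    refine Reaches.cond_true hl hP ?_ ((reaches_isoProg hl hP hV hw hR E E' hB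
      (L₂.congr fun x hx => Function.update_of_ne (by simp only [NExp.eval]; omega) _ _)
      ?_ ?_ ?_ ?_).imp fun s' h => ⟨fun _ => h, fun h' => absurd hfull h'⟩)
    · simp [BExp.Holds, NExp.eval]
    · rw [← hone₂]
      exact writeMatrices_of_notMem _ _ (by omega)
    · intro i j
      rw [← hC]
      have := (mul_add_lt i.2 j.2).trans_le hR.square
      exact writeMatrices_of_notMem _ _ (by omega)
    · intro i
      rw [← hT]
      have := i.2.trans_le hR.dim
      exact writeMatrices_of_notMem _ _ (by omega)
    · intro v i
      exact writeMatrices_zero _ (8 * S + 0) _ _ _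

theorem reaches_fmaiProg (hl : IsBitLength len c) (hO : SolvesMMTI O) (hq : PolyLength len q O)
    (E : Module.Basis (Fin r) F A) (hst : ∀ w : ℕ, w ^ 2 = r → Standing F w 3)
    (hP : 2 ≤ P) (hr0 : 0 < r) (hr : r ≤ m * m) (hV : 100 + r ≤ P ^ e₀)
    (hS : (m + 2) ^ 6 ≤ P ^ e₀) (coins : ℕ → Bool) :
    Reaches len c O q P e₀ 28 fmaiProg
      (inputState (fun i => (E i : Matrix (Fin m) (Fin m) F)) coins) fun s' =>
      (IsFullMatrixAlgebra A → OutputsIso E s') ∧ (¬ IsFullMatrixAlgebra A → OutputsNo s') := by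
  have hm : 0 < m := Nat.pos_of_ne_zero fun h => by subst h; omega
  have hrank : Module.finrank F A = r := by
    rw [Module.finrank_eq_card_basis E, Fintype.card_fin]
  refine Reaches.seq (k := 1) (k' := 27) hP (reaches_sqrtProg hl hP (r := r) rfl rfl) ?_
  rintro s ⟨N, rfl, hN, hmin⟩
  rcases hN.lt_or_eq with hlt | rfl
  · refine Reaches.mono hP (k := 2) (Reaches.cond_true hl hP hlt ((Reaches.setNat hP _ _
      (Nat.zero_le _)).imp ?_)) (by norm_num)
    rintro s' rfl
    refine ⟨?_, fun _ => by simp [OutputsNo, State.setN, NExp.eval]⟩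
    rintro ⟨w, hw, -⟩
    rw [hrank, sq] at hw
    rcases lt_or_ge w N with h | h
    · exact absurd hw (hmin w h).ne
    · exact absurd (hlt.trans_le (Nat.mul_self_le_mul_self h)) hw.not_gt
  · refine Reaches.cond_false hl hP (lt_irrefl _) ?_
    exact reaches_squareProg hl hO hq (hst N (sq N)) hP hm hV hS (room hr) E rfl rfl rfl
      fun l j => inputState_fld (fun i => (E i : Matrix (Fin m) (Fin m) F)) coins l j

/-- A basis of an algebra of positive dimension has a non-zero entry, so that `β` bounds `len 1`. -/
theorem len_one_le (hl : IsBitLength len c) (hr0 : 0 < r) (E : Module.Basis (Fin r) F A)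
    {β : ℕ} (hβ : ∀ i a b, len ((E i : Matrix (Fin m) (Fin m) F) a b) ≤ β) : len 1 ≤ β := by
  have h := E.ne_zero ⟨0, hr0⟩
  obtain ⟨a, b, hab⟩ : ∃ a b, (E ⟨0, hr0⟩ : Matrix (Fin m) (Fin m) F) a b ≠ 0 := by
    by_contra! hz
    exact h (Subtype.ext (Matrix.ext hz))
  exact (hl.one_le _ hab).trans (hβ _ a b)

theorem good_inputState (hl : IsBitLength len c) (hr0 : 0 < r) (hr : r ≤ m * m)
    (E : Module.Basis (Fin r) F A) {β : ℕ}
    (hβ : ∀ i a b, len ((E i : Matrix (Fin m) (Fin m) F) a b) ≤ β) (coins : ℕ → Bool) :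
    (inputState (fun i => (E i : Matrix (Fin m) (Fin m) F)) coins).Good len
      ((m + β + 2) ^ (10 + 3 * c)) := by
  have h1 := len_one_le hl hr0 E hβ
  have hpow : ∀ {i}, i ≤ 10 + 3 * c → (m + β + 2) ^ i ≤ (m + β + 2) ^ (10 + 3 * c) := fun h =>
    Nat.pow_le_pow_right (by omega) h
  have hβ' : β ≤ (m + β + 2) ^ (10 + 3 * c) := by
    have := hpow (i := 1) (by omega)
    rw [pow_one] at this; omega
  have hz : len 0 ≤ (m + β + 2) ^ (10 + 3 * c) := by
    refine hl.len_zero_le.trans (le_trans ?_ (hpow (i := 2 * c) (by omega)))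
    rw [pow_mul]
    exact Nat.pow_le_pow_left (by nlinarith) _
  refine ⟨fun x => ?_, fun x => ?_, hz, h1.trans hβ'⟩
  · have := hpow (i := 2) (by omega)
    simp only [inputState]
    split_ifs <;> nlinarith
  · simp only [inputState]
    split_ifs
    · exact (hβ _ _ _).trans hβ'
    · exact hz

end Main

theorem theorem2 :
    ∃ M : Prog, ∀ c q : ℕ, ∃ k : ℕ,
      ∀ (F : Type*) [Field F] (len : F → ℕ) (O : Oracle F),
        IsBitLength len c → SolvesMMTI O → PolyLength len q O →
      ∀ (m r : ℕ) (A : NonUnitalSubalgebra F (Matrix (Fin m) (Fin m) F))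
        (E : Module.Basis (Fin r) F A) (β : ℕ),
        (∀ w : ℕ, w ^ 2 = r → Standing F w 3) →
        (∀ i a b, len ((E i : Matrix (Fin m) (Fin m) F) a b) ≤ β) →
      (∀ coins : ℕ → Bool, ∃ (s : State F) (t : ℕ),
        Exec len O M (inputState (fun i => (E i : Matrix (Fin m) (Fin m) F)) coins) s t ∧
          t ≤ (m + β + 2) ^ k ∧ (OutputsNo s ∨ OutputsIso E s)) ∧
      1 - (1 / 2 : ℝ) ^ (m + 1) ≤ fairCoins.real {coins : ℕ → Bool | ∃ (s : State F) (t : ℕ),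
        Exec len O M (inputState (fun i => (E i : Matrix (Fin m) (Fin m) F)) coins) s t ∧
          (IsFullMatrixAlgebra A → OutputsIso E s) ∧
          (¬ IsFullMatrixAlgebra A → OutputsNo s)} := by
  refine ⟨fmaiProg, fun c q => ⟨28 + ((nextExp c q)^[28] (10 + 3 * c) + 2) * (15 + fmaiProg.wt c),
    ?_⟩⟩
  intro F _ len O hl hO hq m r A E β hst hβ
  have hr0 : 0 < r := Nat.pos_of_ne_zero fun h => by
    -- `0 = 0²` is excluded by the lower bound for the width
    have := (hst 0 (by rw [h]; rfl)).1
    omega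
  have hr : r ≤ m * m := by
    have h1 : Module.finrank F A ≤ Module.finrank F (Matrix (Fin m) (Fin m) F) :=
      LinearMap.finrank_le_finrank_of_injective
        (f := NonUnitalSubalgebra.toSubmodule A |>.subtype) Subtype.val_injective
    rw [Module.finrank_eq_card_basis E, Fintype.card_fin, Module.finrank_matrix] at h1
    simpa using h1
  set P := m + β + 2 with hPdef
  have hP : 2 ≤ P := by omega
  have hS : (m + 2) ^ 6 ≤ P ^ 10 :=
    (Nat.pow_le_pow_left (by omega) _).trans (Nat.pow_le_pow_right (by omega) (by norm_num))
  have hV : 100 + r ≤ P ^ 10 := by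
    have h1 : r ≤ P ^ 2 := hr.trans (by rw [sq]; exact Nat.mul_le_mul (by omega) (by omega))
    have h2 : 100 ≤ P ^ 7 := le_trans (by norm_num) (Nat.pow_le_pow_left hP 7)
    exact add_le_pow 10 hP h2 h1 (by norm_num)
  have key : ∀ coins : ℕ → Bool, ∃ (s : State F) (t : ℕ),
      Exec len O fmaiProg (inputState (fun i => (E i : Matrix (Fin m) (Fin m) F)) coins) s t ∧
        t ≤ P ^ (28 + ((nextExp c q)^[28] (10 + 3 * c) + 2) * (15 + fmaiProg.wt c)) ∧
        (IsFullMatrixAlgebra A → OutputsIso E s) ∧ (¬ IsFullMatrixAlgebra A → OutputsNo s) := by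
    intro coins
    obtain ⟨s, ⟨-, t, h1, h2⟩, h3⟩ := reaches_fmaiProg hl hO hq E hst hP hr0 hr hV hS coins
      (10 + 3 * c) (by omega) (good_inputState hl hr0 hr E hβ coins)
    refine ⟨s, t, h1, h2.trans ?_, h3⟩
    generalize (nextExp c q)^[28] (10 + 3 * c) = e
    have h4 : P ^ e + 2 ≤ P ^ (e + 2) :=
      add_le_pow (x := e) (y := 1) _ hP le_rfl (by rwa [pow_one]) (by omega)
    have h5 : 28 ≤ P ^ 28 := le_trans (by norm_num) (Nat.pow_le_pow_left hP 28)
    rw [mul_assoc, ← pow_add, pow_add P 28, pow_mul]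
    exact Nat.mul_le_mul h5 (Nat.pow_le_pow_left h4 _)
  refine ⟨fun coins => ?_, ?_⟩
  · obtain ⟨s, t, h1, h2, h3, h4⟩ := key coins
    exact ⟨s, t, h1, h2, (em (IsFullMatrixAlgebra A)).elim (fun h => Or.inr (h3 h))
      fun h => Or.inl (h4 h)⟩
  · -- the algorithm tosses no coins
    have : MeasureTheory.IsProbabilityMeasure fairCoins := by
      unfold fairCoins; infer_instance
    rw [Set.eq_univ_of_forall (s := {coins : ℕ → Bool | _}) fun coins => by
      obtain ⟨s, t, h1, -, h3⟩ := key coins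
      exact ⟨s, t, h1, h3⟩, MeasureTheory.probReal_univ]
    have : (0 : ℝ) ≤ (1 / 2) ^ (m + 1) := by positivity
    linarith
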